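/- Let $\mathcal O\subseteq\mathcal O'$ be complete local principal ideal domains with $J(\mathcal O)\subseteq J(\mathcal O')$, where $J$ denotes the maximal ideal (so each of them is a complete discrete valuation ring or a field). Let $A$ and $B$ be symmetric $\mathcal O$-algebras, i.e. $\mathcal O$-algebras that are finitely generated free as $\mathcal O$-modules with $A\cong A^\vee$ as $(A,A)$-bimodules and $B\cong B^\vee$ as $(B,B)$-bimodules, where $(-)^\vee=\operatorname{Hom}_{\mathcal O}(-,\mathcal O)$. Write $(-)'=\mathcal O'\otimes_{\mathcal O}-$ for extension of scalars on algebras, bimodules and complexes; for $(A',B')$-bimodules, $(-)^\vee$ is the $\mathcal O'$-dual. Let $M$, $N$ be finitely generated $(A,B)$-bimodules that are projective as left $A$-modules and as right $B$-modules, and let $X$ be a bounded complex of such bimodules. Then: (a) $X'$ induces a Rickard equivalence between $A'$ and $B'$ if and only if $X$ induces a Rickard equivalence between $A$ and $B$. Here $X$ induces a Rickard equivalence if there are contractible complexes $Y$ of $(A,A)$-bimodules and $Z$ of $(B,B)$-bimodules with $X\otimes_B X^\vee\cong A\oplus Y$ and $X^\vee\otimes_A X\cong B\oplus Z$ as complexes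 of bimodules. (b) $M'$ induces a stable equivalence of Morita type between $A'$ and $B'$ if and only if $M$ induces one between $A$ and $B$. Here $M$ induces a stable equivalence of Morita type if there are a projective $(A,A)$-bimodule $U$ and a projective $(B,B)$-bimodule $V$ with $M\otimes_B M^\vee\cong A\oplus U$ and $M^\vee\otimes_A M\cong B\oplus V$ as bimodules. (c) $M'$ induces a Morita equivalence between $A'$ and $B'$ if and only if $M$ induces a Morita equivalence between $A$ and $B$, i.e. $M\otimes_B-$ is an equivalence from finitely generated left $B$-modules to finitely generated left $A$-modules. (d) $[M']-[N']$ and $[(M')^\vee]-[(N')^\vee]$ induce a virtual Morita equivalence between $A'$ and $B'$ if and only if $[M]-[N]$ and $[M^\vee]-[N^\vee]$ induce a virtual Morita equivalence between $A$ and $B$. Here $\mathcal R(A,B)$ is the Grothendieck group of finitely generated $(A,B)$-bimodules with respect to split exact sequences, $\mathcal P(A,B)\subseteq\mathcal R(A,B)$ is the subgroup generated by the classes of bimodules that are finitely generated projective as left and as right modules, and $\cdot_B\colon\mathcal R(A,B)\times\mathcal R(B,C)\to\mathcal R(A,C)$ is the biadditive map with $[P]\cdot_B[Q]=[P\otimes_B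 Q]$. Elements $U\in\mathcal P(A,B)$ and $V\in\mathcal P(B,A)$ induce a virtual Morita equivalence if $U\cdot_B V=[A]$ in $\mathcal R(A,A)$ and $V\cdot_A U=[B]$ in $\mathcal R(B,B)$. -/

import Mathlib

open CategoryTheory CategoryTheory.Limits TensorProduct MulOpposite

universe u

noncomputable section

namespace SymAlg

/-! ### Modules over an `O`-algebra, seen as `O`-modules with an action -/

section Basic

variable {O : Type u} [CommRing O]
variable {Λ : Type u} [Ring Λ] [Algebra O Λ]

/-- A module over an `O`-algebra `Λ` is an `O`-module through the structure map `O → Λ`. -/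
abbrev moduleO (V : ModuleCat.{u} Λ) : Module O V := Module.compHom V (algebraMap O Λ)

attribute [local instance] moduleO

theorem isScalarTowerO (V : ModuleCat.{u} Λ) : IsScalarTower O Λ V where
  smul_assoc r a v := by
    change (r • a) • v = (algebraMap O Λ r) • a • v
    rw [Algebra.smul_def, mul_smul]

attribute [local instance] isScalarTowerO

/-- The action of `Λ` on a `Λ`-module `V` by `O`-linear maps. -/
def act (V : ModuleCat.{u} Λ) : Λ →ₐ[O] Module.End O V := Algebra.lsmul O O V

/-- The `O`-linear map underlying a homomorphism of `Λ`-modules. -/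
def homO {V W : ModuleCat.{u} Λ} (f : V ⟶ W) : V →ₗ[O] W := f.hom.restrictScalars O

/-- The `Λ`-module given by an `O`-module `V` and an action `ρ` of `Λ` on `V`. -/
def ofAction {V : Type u} [AddCommGroup V] [Module O V] (ρ : Λ →ₐ[O] Module.End O V) :
    ModuleCat.{u} Λ :=
  letI := Module.compHom V ρ.toRingHom
  ModuleCat.of Λ V

/-- An `O`-linear map commuting with the actions is a homomorphism of `Λ`-modules. -/
def ofActionHom {V W : Type u} [AddCommGroup V] [Module O V] [AddCommGroup W] [Module O W]
    {ρ : Λ →ₐ[O] Module.End O V} {σ : Λ →ₐ[O] Module.End O W} (f : V →ₗ[O] W)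
    (hf : ∀ a v, f (ρ a v) = σ a (f v)) : ofAction ρ ⟶ ofAction σ :=
  letI := Module.compHom V ρ.toRingHom
  letI := Module.compHom W σ.toRingHom
  ModuleCat.ofHom
    ({ toFun := f
       map_add' := map_add f
       map_smul' := hf } : V →ₗ[Λ] W)

theorem finite_ofAction {V : Type u} [AddCommGroup V] [Module O V]
    (ρ : Λ →ₐ[O] Module.End O V) [Module.Finite O V] : Module.Finite Λ (ofAction ρ) := by
  let := Module.compHom V ρ.toRingHom
  have : IsScalarTower O Λ V :=
    ⟨fun r a v => by
      change ρ (r • a) v = r • ρ a v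
      rw [map_smul, LinearMap.smul_apply]⟩
  exact Module.Finite.of_restrictScalars_finite O Λ V

theorem finiteO [Module.Finite O Λ] (V : ModuleCat.{u} Λ) [Module.Finite Λ V] :
    Module.Finite O V :=
  Module.Finite.trans Λ V

end Basic

/-! ### The tensor product over a non-commutative algebra -/

section Balanced

variable {O : Type u} [CommRing O]
variable {Λ : Type u} [Ring Λ] [Algebra O Λ] {B : Type u} [Ring B] [Algebra O B]

/-- Given a right `B`-action `r` on `M`, a left `B`-action `l` on `N` and a `Λ`-action `ρ` on
`M ⊗[O] N`: the `Λ`-submodule spanned by the elements `m b ⊗ n - m ⊗ b n`. -/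
def balancedRel {M N : Type u} [AddCommGroup M] [Module O M] [AddCommGroup N] [Module O N]
    (r : Bᵐᵒᵖ →ₐ[O] Module.End O M) (l : B →ₐ[O] Module.End O N)
    (ρ : Λ →ₐ[O] Module.End O (M ⊗[O] N)) : Submodule Λ (ofAction ρ) :=
  Submodule.span Λ
    {z | ∃ (m : M) (b : B) (n : N), z = (r (op b) m ⊗ₜ[O] n - m ⊗ₜ[O] l b n : M ⊗[O] N)}

/-- The tensor product `M ⊗_B N`, as a `Λ`-module: the quotient of `M ⊗[O] N` by the relations
`m b ⊗ n = m ⊗ b n`. -/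
def balanced {M N : Type u} [AddCommGroup M] [Module O M] [AddCommGroup N] [Module O N]
    (r : Bᵐᵒᵖ →ₐ[O] Module.End O M) (l : B →ₐ[O] Module.End O N)
    (ρ : Λ →ₐ[O] Module.End O (M ⊗[O] N)) : ModuleCat.{u} Λ :=
  ModuleCat.of Λ (ofAction ρ ⧸ balancedRel r l ρ)

variable {M N M₁ N₁ M₂ N₂ : Type u} [AddCommGroup M] [Module O M] [AddCommGroup N] [Module O N]
  [AddCommGroup M₁] [Module O M₁] [AddCommGroup N₁] [Module O N₁]
  [AddCommGroup M₂] [Module O M₂] [AddCommGroup N₂] [Module O N₂]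
  {r : Bᵐᵒᵖ →ₐ[O] Module.End O M} {l : B →ₐ[O] Module.End O N}
  {ρ : Λ →ₐ[O] Module.End O (M ⊗[O] N)}
  {r₁ : Bᵐᵒᵖ →ₐ[O] Module.End O M₁} {l₁ : B →ₐ[O] Module.End O N₁}
  {ρ₁ : Λ →ₐ[O] Module.End O (M₁ ⊗[O] N₁)}
  {r₂ : Bᵐᵒᵖ →ₐ[O] Module.End O M₂} {l₂ : B →ₐ[O] Module.End O N₂}
  {ρ₂ : Λ →ₐ[O] Module.End O (M₂ ⊗[O] N₂)}

/-- The class of `m ⊗ n` in `M ⊗_B N`. -/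
def btmul (r : Bᵐᵒᵖ →ₐ[O] Module.End O M) (l : B →ₐ[O] Module.End O N)
    (ρ : Λ →ₐ[O] Module.End O (M ⊗[O] N)) (m : M) (n : N) : balanced r l ρ :=
  (balancedRel r l ρ).mkQ (m ⊗ₜ[O] n : M ⊗[O] N)

theorem balanced_induction {p : balanced r l ρ → Prop} (h0 : p 0)
    (ht : ∀ m n, p (btmul r l ρ m n)) (ha : ∀ x y, p x → p y → p (x + y)) (z) : p z := by
  obtain ⟨z, rfl⟩ := Submodule.mkQ_surjective _ z
  exact TensorProduct.induction_on (motive := fun z => p ((balancedRel r l ρ).mkQ z)) z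
    (by rw [show (balancedRel r l ρ).mkQ (0 : M ⊗[O] N) = 0 from map_zero _]; exact h0)
    (fun m n => ht m n)
    (fun x y hx hy => by
      rw [show (balancedRel r l ρ).mkQ (x + y : M ⊗[O] N) = (balancedRel r l ρ).mkQ x +
        (balancedRel r l ρ).mkQ y from map_add _ _ _]
      exact ha _ _ hx hy)

/-- The homomorphism `f ⊗ g : M ⊗_B N → M₁ ⊗_B N₁`. -/
def balancedMap (f : M →ₗ[O] M₁) (g : N →ₗ[O] N₁)
    (hf : ∀ b m, f (r b m) = r₁ b (f m)) (hg : ∀ b n, g (l b n) = l₁ b (g n))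
    (hfg : ∀ a z, TensorProduct.map f g (ρ a z) = ρ₁ a (TensorProduct.map f g z)) :
    balanced r l ρ ⟶ balanced r₁ l₁ ρ₁ :=
  ModuleCat.ofHom <| Submodule.mapQ (balancedRel r l ρ) (balancedRel r₁ l₁ ρ₁)
    (ofActionHom (TensorProduct.map f g) hfg).hom <| by
      refine Submodule.span_le.2 ?_
      rintro _ ⟨m, b, n, rfl⟩
      refine Submodule.subset_span ⟨f m, b, g n, ?_⟩
      change TensorProduct.map f g (r (op b) m ⊗ₜ[O] n - m ⊗ₜ[O] l b n) = _
      rw [map_sub, TensorProduct.map_tmul, TensorProduct.map_tmul, hf, hg]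

theorem balancedMap_tmul (f : M →ₗ[O] M₁) (g : N →ₗ[O] N₁)
    (hf : ∀ b m, f (r b m) = r₁ b (f m)) (hg : ∀ b n, g (l b n) = l₁ b (g n))
    (hfg : ∀ a z, TensorProduct.map f g (ρ a z) = ρ₁ a (TensorProduct.map f g z)) (m : M) (n : N) :
    (balancedMap f g hf hg hfg).hom (btmul r l ρ m n) = btmul r₁ l₁ ρ₁ (f m) (g n) := rfl

theorem balanced_hom_ext {W : ModuleCat.{u} Λ} {f g : balanced r l ρ ⟶ W}
    (h : ∀ m n, f.hom (btmul r l ρ m n) = g.hom (btmul r l ρ m n)) : f = g := by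
  ext z
  refine balanced_induction (p := fun z => f.hom z = g.hom z) ?_ h ?_ z
  · rw [map_zero, map_zero]
  · intro x y hx hy
    rw [map_add, map_add, hx, hy]

theorem btmul_add_left (m m' : M) (n : N) :
    btmul r l ρ (m + m') n = btmul r l ρ m n + btmul r l ρ m' n := by
  unfold btmul
  rw [TensorProduct.add_tmul]
  exact map_add (balancedRel r l ρ).mkQ _ _

theorem btmul_add_right (m : M) (n n' : N) :
    btmul r l ρ m (n + n') = btmul r l ρ m n + btmul r l ρ m n' := by
  unfold btmul
  rw [TensorProduct.tmul_add]
  exact map_add (balancedRel r l ρ).mkQ _ _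

theorem finite_balanced [Module.Finite O M] [Module.Finite O N] :
    Module.Finite Λ (balanced r l ρ) := by
  have : Module.Finite Λ (ofAction ρ) := finite_ofAction ρ
  exact Module.Finite.quotient Λ (balancedRel r l ρ)

end Balanced

/-! ### Bimodules -/

section Bimodules

attribute [local instance] moduleO isScalarTowerO

/-- The abelian category of `(A, B)`-bimodules over `O` (with `O` acting in the same way from both
sides), that is, of left modules over `A ⊗[O] Bᵐᵒᵖ`. -/
abbrev BimodCat (O A B : Type u) [CommRing O] [Ring A] [Algebra O A] [Ring B] [Algebra O B] :=
  ModuleCat.{u} (A ⊗[O] Bᵐᵒᵖ)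

variable {O : Type u} [CommRing O]
variable {A : Type u} [Ring A] [Algebra O A] {B : Type u} [Ring B] [Algebra O B]
variable {C : Type u} [Ring C] [Algebra O C]

/-- The left action of `A` on an `(A, B)`-bimodule. -/
def leftAct (M : BimodCat O A B) : A →ₐ[O] Module.End O M :=
  (act M).comp Algebra.TensorProduct.includeLeft

/-- The right action of `B` on an `(A, B)`-bimodule: `rightAct M (op b) m` is `m b`. -/
def rightAct (M : BimodCat O A B) : Bᵐᵒᵖ →ₐ[O] Module.End O M :=
  (act M).comp Algebra.TensorProduct.includeRight

theorem smul_eq (M : BimodCat O A B) (a : A) (b : Bᵐᵒᵖ) (m : M) :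
    (a ⊗ₜ[O] b : A ⊗[O] Bᵐᵒᵖ) • m = leftAct M a (rightAct M b m) := by
  change _ = (a ⊗ₜ[O] (1 : Bᵐᵒᵖ) : A ⊗[O] Bᵐᵒᵖ) • ((1 : A) ⊗ₜ[O] b : A ⊗[O] Bᵐᵒᵖ) • m
  rw [← mul_smul, Algebra.TensorProduct.tmul_mul_tmul, mul_one, one_mul]

theorem commute_act (M : BimodCat O A B) (a : A) (b : Bᵐᵒᵖ) :
    Commute (leftAct M a) (rightAct M b) := by
  unfold leftAct rightAct
  refine Commute.map (?_ : Commute (a ⊗ₜ[O] (1 : Bᵐᵒᵖ)) ((1 : A) ⊗ₜ[O] b)) (act M)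
  simp [Commute, SemiconjBy]

theorem homO_leftAct {M N : BimodCat O A B} (f : M ⟶ N) (a : A) (m : M) :
    homO (O := O) f (leftAct M a m) = leftAct N a (homO (O := O) f m) :=
  f.hom.map_smul _ _

theorem homO_rightAct {M N : BimodCat O A B} (f : M ⟶ N) (b : Bᵐᵒᵖ) (m : M) :
    homO (O := O) f (rightAct M b m) = rightAct N b (homO (O := O) f m) :=
  f.hom.map_smul _ _

/-- The bimodule underlying commuting left and right actions. -/
def ofActions {V : Type u} [AddCommGroup V] [Module O V] (l : A →ₐ[O] Module.End O V)
    (r : Bᵐᵒᵖ →ₐ[O] Module.End O V) (h : ∀ a b, Commute (l a) (r b)) : BimodCat O A B :=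
  ofAction (Algebra.TensorProduct.lift l r h)

/-- An `O`-linear map commuting with left and right actions is a bimodule homomorphism. -/
def ofActionsHom {V W : Type u} [AddCommGroup V] [Module O V] [AddCommGroup W] [Module O W]
    {l : A →ₐ[O] Module.End O V} {r : Bᵐᵒᵖ →ₐ[O] Module.End O V} {h : ∀ a b, Commute (l a) (r b)}
    {l' : A →ₐ[O] Module.End O W} {r' : Bᵐᵒᵖ →ₐ[O] Module.End O W}
    {h' : ∀ a b, Commute (l' a) (r' b)} (f : V →ₗ[O] W)
    (hl : ∀ a v, f (l a v) = l' a (f v)) (hr : ∀ b v, f (r b v) = r' b (f v)) :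
    ofActions l r h ⟶ ofActions l' r' h' :=
  ofActionHom f fun x v => by
    induction x with
    | zero => simp
    | tmul a b => simp [hl, hr]
    | add x y hx hy => simp [hx, hy]

/-- The restriction of an `(A, B)`-bimodule to a left `A`-module. -/
abbrev leftModule (M : BimodCat O A B) : ModuleCat.{u} A :=
  (ModuleCat.restrictScalars
    (Algebra.TensorProduct.includeLeft : A →ₐ[O] A ⊗[O] Bᵐᵒᵖ).toRingHom).obj M

/-- The restriction of an `(A, B)`-bimodule to a right `B`-module. -/
abbrev rightModule (M : BimodCat O A B) : ModuleCat.{u} Bᵐᵒᵖ :=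
  (ModuleCat.restrictScalars
    (Algebra.TensorProduct.includeRight : Bᵐᵒᵖ →ₐ[O] A ⊗[O] Bᵐᵒᵖ).toRingHom).obj M

/-- The finitely generated bimodules which are projective as left and as right modules.
(Over `O`-algebras that are finitely generated as `O`-modules, being finitely generated as a
bimodule, as a left module, as a right module or as an `O`-module are all the same.) -/
structure IsBiprojective (M : BimodCat O A B) : Prop where
  finite : Module.Finite (A ⊗[O] Bᵐᵒᵖ) M
  left : Module.Projective A (leftModule M)
  right : Module.Projective Bᵐᵒᵖ (rightModule M)

variable (O A) in
/-- The `(A, A)`-bimodule `A`. -/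
def regular : BimodCat O A A :=
  ofActions (Algebra.lmul O A)
    { toFun := fun a => LinearMap.mulRight O a.unop
      map_one' := by ext; simp
      map_mul' := fun a b => by ext; simp [mul_assoc]
      map_zero' := by ext; simp
      map_add' := fun a b => by ext; simp [mul_add]
      commutes' := fun c => by
        ext x
        change x * algebraMap O A c = c • x
        rw [Algebra.smul_def, Algebra.commutes] }
    fun a b => by
      ext x
      simp [mul_assoc]

instance [Module.Finite O A] : Module.Finite (A ⊗[O] Aᵐᵒᵖ) (regular O A) := finite_ofAction _

/-- The `(B, A)`-bimodule `M^∨ = Hom_O(M, O)` dual to an `(A, B)`-bimodule `M`, with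
`(b f a)(m) = f (a m b)`. -/
def dual (M : BimodCat O A B) : BimodCat O B A :=
  ofActions (V := Module.Dual O M)
    { toFun := fun b => LinearMap.dualMap (rightAct M (op b))
      map_one' := by ext; simp
      map_mul' := fun a b => by ext; simp
      map_zero' := by ext; simp
      map_add' := fun a b => by ext; simp
      commutes' := fun c => by
        ext f m
        change f (rightAct M (algebraMap O Bᵐᵒᵖ c) m) = c • f m
        rw [AlgHom.commutes, Module.algebraMap_end_apply, map_smul] }
    { toFun := fun a => LinearMap.dualMap (leftAct M a.unop)
      map_one' := by ext; simp
      map_mul' := fun a b => by ext; simp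
      map_zero' := by ext; simp
      map_add' := fun a b => by ext; simp
      commutes' := fun c => by
        ext f m
        change f (leftAct M (algebraMap O A c) m) = c • f m
        rw [AlgHom.commutes, Module.algebraMap_end_apply, map_smul] }
    fun b a => by
      ext f m
      change f (leftAct M a.unop (rightAct M (op b) m)) = f (rightAct M (op b) (leftAct M a.unop m))
      exact congrArg f (LinearMap.congr_fun (commute_act M a.unop (op b)).eq m)

/-- The transpose `f ↦ f ∘ g` of a bimodule homomorphism `g`. -/
def dualMap {M N : BimodCat O A B} (g : M ⟶ N) : dual N ⟶ dual M :=
  ofActionsHom (LinearMap.dualMap (homO (O := O) g))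
    (fun b f => by
      ext m
      exact congrArg f (homO_rightAct g (op b) m).symm)
    (fun a f => by
      ext m
      exact congrArg f (homO_leftAct g a.unop m).symm)

theorem dualMap_id (M : BimodCat O A B) : dualMap (𝟙 M) = 𝟙 (dual M) := rfl

theorem dualMap_comp {M N P : BimodCat O A B} (f : M ⟶ N) (g : N ⟶ P) :
    dualMap (f ≫ g) = dualMap g ≫ dualMap f := rfl

theorem dualMap_zero (M N : BimodCat O A B) : dualMap (0 : M ⟶ N) = 0 := by
  ext f
  exact LinearMap.ext fun m => map_zero (show N →ₗ[O] O from f)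

instance finite_dual [IsNoetherianRing O] [Module.Finite O A] [Module.Finite O B] (M : BimodCat O A B)
    [Module.Finite (A ⊗[O] Bᵐᵒᵖ) M] : Module.Finite (B ⊗[O] Aᵐᵒᵖ) (dual M) := by
  have : Module.Finite O M := finiteO M
  have : Module.Finite O (Module.Dual O M) :=
    inferInstanceAs (Module.Finite O (M →ₗ[O] O))
  exact finite_ofAction _

/-! ### Tensor products of bimodules -/

/-- The action `(a ⊗ c) (m ⊗ n) = a m ⊗ n c` on `M ⊗[O] N`. -/
def outerAct (M : BimodCat O A B) (N : BimodCat O B C) :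
    A ⊗[O] Cᵐᵒᵖ →ₐ[O] Module.End O (M ⊗[O] N) :=
  Algebra.TensorProduct.lift ((Module.End.rTensorAlgHom O M N).comp (leftAct M))
    ((Module.End.lTensorAlgHom O N M).comp (rightAct N))
    fun _ _ => TensorProduct.ext' fun _ _ => rfl

theorem outerAct_tmul (M : BimodCat O A B) (N : BimodCat O B C) (a : A) (c : Cᵐᵒᵖ) (m : M) (n : N) :
    outerAct M N (a ⊗ₜ c) (m ⊗ₜ n) = leftAct M a m ⊗ₜ rightAct N c n := rfl

theorem map_outerAct {M M₁ : BimodCat O A B} {N N₁ : BimodCat O B C} (f : M ⟶ M₁) (g : N ⟶ N₁)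
    (x : A ⊗[O] Cᵐᵒᵖ) (z : M ⊗[O] N) :
    TensorProduct.map (homO (O := O) f) (homO (O := O) g) (outerAct M N x z) =
      outerAct M₁ N₁ x (TensorProduct.map (homO (O := O) f) (homO (O := O) g) z) := by
  induction x with
  | zero => simp
  | add x y hx hy => simp [hx, hy]
  | tmul a c =>
    induction z with
    | zero => simp
    | add x y hx hy => simp only [map_add, hx, hy]
    | tmul m n =>
      rw [outerAct_tmul, TensorProduct.map_tmul, TensorProduct.map_tmul, outerAct_tmul,
        homO_leftAct, homO_rightAct]

/-- The `(A, C)`-bimodule `M ⊗_B N`. -/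
def tensor (M : BimodCat O A B) (N : BimodCat O B C) : BimodCat O A C :=
  balanced (rightAct M) (leftAct N) (outerAct M N)

/-- The bimodule homomorphism `f ⊗ g`. -/
def tensorMap {M M₁ : BimodCat O A B} {N N₁ : BimodCat O B C} (f : M ⟶ M₁) (g : N ⟶ N₁) :
    tensor M N ⟶ tensor M₁ N₁ :=
  balancedMap (homO (O := O) f) (homO (O := O) g) (homO_rightAct f) (homO_leftAct g)
    (map_outerAct f g)

theorem tensorMap_id (M : BimodCat O A B) (N : BimodCat O B C) :
    tensorMap (𝟙 M) (𝟙 N) = 𝟙 (tensor M N) :=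
  balanced_hom_ext fun _ _ => rfl

theorem tensorMap_comp {M M₁ M₂ : BimodCat O A B} {N N₁ N₂ : BimodCat O B C} (f : M ⟶ M₁)
    (f' : M₁ ⟶ M₂) (g : N ⟶ N₁) (g' : N₁ ⟶ N₂) :
    tensorMap (f ≫ f') (g ≫ g') = tensorMap f g ≫ tensorMap f' g' :=
  balanced_hom_ext fun _ _ => rfl

theorem tensorMap_add_left {M M₁ : BimodCat O A B} {N N₁ : BimodCat O B C} (f f' : M ⟶ M₁)
    (g : N ⟶ N₁) : tensorMap (f + f') g = tensorMap f g + tensorMap f' g :=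
  balanced_hom_ext fun _ _ => btmul_add_left _ _ _

theorem tensorMap_add_right {M M₁ : BimodCat O A B} {N N₁ : BimodCat O B C} (f : M ⟶ M₁)
    (g g' : N ⟶ N₁) : tensorMap f (g + g') = tensorMap f g + tensorMap f g' :=
  balanced_hom_ext fun _ _ => btmul_add_right _ _ _

variable (O A B C) in
/-- The bifunctor `(M, N) ↦ M ⊗_B N` on bimodules. -/
def tensorBifunctor : BimodCat O A B ⥤ BimodCat O B C ⥤ BimodCat O A C where
  obj M :=
    { obj := fun N => tensor M N
      map := fun g => tensorMap (𝟙 M) g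
      map_id := fun N => tensorMap_id M N
      map_comp := fun g g' => tensorMap_comp (𝟙 M) (𝟙 M) g g' }
  map f :=
    { app := fun N => tensorMap f (𝟙 N)
      naturality := fun N N₁ g => by
        change tensorMap _ _ ≫ tensorMap _ _ = tensorMap _ _ ≫ tensorMap _ _
        rw [← tensorMap_comp, ← tensorMap_comp]
        simp only [Category.id_comp, Category.comp_id] }
  map_id M := by
    ext N : 2
    exact tensorMap_id M N
  map_comp f f' := by
    ext N : 2
    exact tensorMap_comp f f' (𝟙 N) (𝟙 N)

instance : (tensorBifunctor O A B C).Additive where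
  map_add {M M₁ f f'} := by
    ext N : 2
    exact tensorMap_add_left f f' (𝟙 N)

instance (M : BimodCat O A B) : ((tensorBifunctor O A B C).obj M).Additive where
  map_add {_ _ g g'} := tensorMap_add_right (𝟙 M) g g'

instance (N : BimodCat O B C) : ((tensorBifunctor O A B C).flip.obj N).Additive where
  map_add {_ _ f f'} := tensorMap_add_left f f' (𝟙 N)

instance finite_tensor [Module.Finite O A] [Module.Finite O B] [Module.Finite O C]
    (M : BimodCat O A B) (N : BimodCat O B C) [Module.Finite (A ⊗[O] Bᵐᵒᵖ) M]
    [Module.Finite (B ⊗[O] Cᵐᵒᵖ) N] : Module.Finite (A ⊗[O] Cᵐᵒᵖ) (tensor M N) := by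
  have : Module.Finite O M := finiteO M
  have : Module.Finite O N := finiteO N
  exact finite_balanced

/-! ### The functor `M ⊗_B -` on modules -/

/-- The action `a (m ⊗ v) = a m ⊗ v` on `M ⊗[O] V`. -/
def outerActLeft (M : BimodCat O A B) (V : ModuleCat.{u} B) : A →ₐ[O] Module.End O (M ⊗[O] V) :=
  (Module.End.rTensorAlgHom O M V).comp (leftAct M)

/-- The functor `M ⊗_B -` from left `B`-modules to left `A`-modules. -/
def tensorFunctor (M : BimodCat O A B) : ModuleCat.{u} B ⥤ ModuleCat.{u} A where
  obj V := balanced (rightAct M) (act V) (outerActLeft M V)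
  map {V W} g := balancedMap LinearMap.id (homO (O := O) g) (fun _ _ => rfl)
    (fun b v => g.hom.map_smul b v)
    (fun a z => by
      induction z with
      | zero => simp
      | add x y hx hy => simp only [map_add, hx, hy]
      | tmul m v => rfl)
  map_id V := balanced_hom_ext fun _ _ => rfl
  map_comp g g' := balanced_hom_ext fun _ _ => rfl

/-- The functor `M ⊗_B -` from finitely generated left `B`-modules to finitely generated left
`A`-modules. -/
def tensorFunctorFG [Module.Finite O A] [Module.Finite O B] (M : BimodCat O A B)
    [Module.Finite (A ⊗[O] Bᵐᵒᵖ) M] : FGModuleCat.{u} B ⥤ FGModuleCat.{u} A :=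
  ObjectProperty.lift _ ((ModuleCat.isFG.{u} B).ι ⋙ tensorFunctor M) fun V => by
    have : Module.Finite O M := finiteO M
    have : Module.Finite B V.obj := V.property
    have : Module.Finite O V.obj := finiteO V.obj
    exact finite_balanced (M := M) (N := V.obj)

/-! ### Extension of scalars -/

section BaseChange

variable (O' : Type u) [CommRing O'] [Algebra O O']

/-- The left action of `A' = O' ⊗[O] A` on `M' = O' ⊗[O] M`. -/
def baseChangeLeftAct (M : BimodCat O A B) : O' ⊗[O] A →ₐ[O'] Module.End O' (O' ⊗[O] M) :=
  Algebra.TensorProduct.lift (Algebra.ofId O' _)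
    ((Module.End.baseChangeHom O O' M).comp (leftAct M))
    fun c _ => Algebra.commutes c _

/-- The right action of `B' = O' ⊗[O] B` on `M' = O' ⊗[O] M`. -/
def baseChangeRightAct (M : BimodCat O A B) : (O' ⊗[O] B)ᵐᵒᵖ →ₐ[O'] Module.End O' (O' ⊗[O] M) :=
  AlgHom.opComm <| Algebra.TensorProduct.lift (Algebra.ofId O' _)
    (AlgHom.opComm.symm ((Module.End.baseChangeHom O O' M).comp (rightAct M)))
    fun c _ => Algebra.commutes c _

theorem baseChangeLeftAct_tmul (M : BimodCat O A B) (c d : O') (a : A) (m : M) :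
    baseChangeLeftAct O' M (c ⊗ₜ a) (d ⊗ₜ m) = (c * d) ⊗ₜ leftAct M a m := by
  change c • (d ⊗ₜ[O] leftAct M a m : O' ⊗[O] M) = _
  rw [TensorProduct.smul_tmul', smul_eq_mul]

theorem baseChangeRightAct_tmul (M : BimodCat O A B) (c d : O') (b : B) (m : M) :
    baseChangeRightAct O' M (op (c ⊗ₜ b)) (d ⊗ₜ m) = (c * d) ⊗ₜ rightAct M (op b) m := by
  change (LinearMap.baseChange O' (rightAct M (op b))) (c • (d ⊗ₜ[O] m : O' ⊗[O] M)) = _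
  rw [TensorProduct.smul_tmul', smul_eq_mul, LinearMap.baseChange_tmul]

/-- The `(A', B')`-bimodule `M' = O' ⊗[O] M`, for an `(A, B)`-bimodule `M`. -/
def baseChange (M : BimodCat O A B) : BimodCat O' (O' ⊗[O] A) (O' ⊗[O] B) :=
  ofActions (baseChangeLeftAct O' M) (baseChangeRightAct O' M) fun x y => by
    obtain ⟨y, rfl⟩ := op_surjective y
    induction x with
    | zero => simp
    | add x x' hx hx' => rw [map_add]; exact hx.add_left hx'
    | tmul c a =>
      induction y with
      | zero => simp
      | add y y' hy hy' => rw [MulOpposite.op_add, map_add]; exact hy.add_right hy'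
      | tmul d b =>
        refine LinearMap.ext fun z => ?_
        induction z with
        | zero => simp
        | add z z' hz hz' => rw [map_add, map_add, hz, hz']
        | tmul e m =>
          have h : leftAct M a (rightAct M (op b) m) = rightAct M (op b) (leftAct M a m) :=
            LinearMap.congr_fun (commute_act M a (op b)).eq m
          simp only [Module.End.mul_apply, baseChangeLeftAct_tmul, baseChangeRightAct_tmul, h,
            mul_left_comm]

/-- The homomorphism `f' = id ⊗ f`. -/
def baseChangeMap {M N : BimodCat O A B} (f : M ⟶ N) : baseChange O' M ⟶ baseChange O' N :=
  ofActionsHom (LinearMap.baseChange O' (homO (O := O) f))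
    (fun x z => by
      induction x with
      | zero => simp
      | add x y hx hy => simp only [map_add, LinearMap.add_apply, hx, hy]
      | tmul c a =>
        induction z with
        | zero => simp
        | add x y hx hy => simp only [map_add, hx, hy]
        | tmul d m =>
          rw [baseChangeLeftAct_tmul, LinearMap.baseChange_tmul, LinearMap.baseChange_tmul,
            baseChangeLeftAct_tmul, homO_leftAct])
    (fun x z => by
      obtain ⟨x, rfl⟩ := op_surjective x
      induction x with
      | zero => simp
      | add x y hx hy => simp only [MulOpposite.op_add, map_add, LinearMap.add_apply, hx, hy]
      | tmul c a =>
        induction z with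
        | zero => simp
        | add x y hx hy => simp only [map_add, hx, hy]
        | tmul d m =>
          rw [baseChangeRightAct_tmul, LinearMap.baseChange_tmul, LinearMap.baseChange_tmul,
            baseChangeRightAct_tmul, homO_rightAct])

variable (O A B) in
/-- The extension of scalars functor `M ↦ M' = O' ⊗[O] M` on bimodules. -/
def baseChangeFunctor : BimodCat O A B ⥤ BimodCat O' (O' ⊗[O] A) (O' ⊗[O] B) where
  obj M := baseChange O' M
  map f := baseChangeMap O' f
  map_id M := by
    ext z
    exact LinearMap.congr_fun (LinearMap.baseChange_id (R := O) (A := O') (M := M)) z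
  map_comp f g := by
    ext z
    exact LinearMap.congr_fun (LinearMap.baseChange_comp (A := O') (homO (O := O) f)
      (homO (O := O) g)) z

instance : (baseChangeFunctor O A B O').Additive where
  map_add {M N f g} := by
    ext z
    exact LinearMap.congr_fun (LinearMap.baseChange_add (A := O') (homO (O := O) f)
      (homO (O := O) g)) z

instance finite_baseChange [Module.Finite O A] [Module.Finite O B] (M : BimodCat O A B)
    [Module.Finite (A ⊗[O] Bᵐᵒᵖ) M] :
    Module.Finite ((O' ⊗[O] A) ⊗[O'] (O' ⊗[O] B)ᵐᵒᵖ) (baseChange O' M) := by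
  have : Module.Finite O M := finiteO M
  exact finite_ofAction _

end BaseChange

end Bimodules

/-! ### Complexes of bimodules -/

section Complexes

variable {O : Type u} [CommRing O]
variable {A : Type u} [Ring A] [Algebra O A] {B : Type u} [Ring B] [Algebra O B]
variable {C : Type u} [Ring C] [Algebra O C]

/-- A complex is bounded if all but finitely many of its terms are zero. -/
def IsBounded {Λ : Type u} [Ring Λ] (X : CochainComplex (ModuleCat.{u} Λ) ℤ) : Prop :=
  {n | ¬ IsZero (X.X n)}.Finite

/-- A complex is contractible if its identity is homotopic to zero. -/
def IsContractible {Λ : Type u} [Ring Λ] (X : CochainComplex (ModuleCat.{u} Λ) ℤ) : Prop :=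
  Nonempty (Homotopy (𝟙 X) 0)

/-- The dual complex `X^∨ = Hom_O(X, O)`, with `(X^∨)ⁿ = (X⁻ⁿ)^∨` and differentials the transposes
of those of `X`. (Inserting signs in the differentials gives an isomorphic complex.) -/
def dualComplex (X : CochainComplex (BimodCat O A B) ℤ) : CochainComplex (BimodCat O B A) ℤ where
  X n := dual (X.X (-n))
  d i j := dualMap (X.d (-j) (-i))
  shape i j h := by
    rw [X.shape _ _ fun h' => h (by simp only [ComplexShape.up_Rel] at h' ⊢; omega), dualMap_zero]
  d_comp_d' i j k _ _ := by
    rw [← dualMap_comp, X.d_comp_d, dualMap_zero]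

/-- The total tensor product `X ⊗_B Y` of complexes of bimodules, with
`(X ⊗_B Y)ⁿ = ⨁_{i + j = n} Xⁱ ⊗_B Yʲ` and `d (x ⊗ y) = d x ⊗ y + (-1)^i x ⊗ d y` for `x ∈ Xⁱ`. -/
def tensorComplex (X : CochainComplex (BimodCat O A B) ℤ) (Y : CochainComplex (BimodCat O B C) ℤ) :
    CochainComplex (BimodCat O A C) ℤ :=
  HomologicalComplex.mapBifunctor X Y (tensorBifunctor O A B C) (ComplexShape.up ℤ)

/-- The extension of scalars `X'` of a complex of bimodules, with `(X')ⁿ = (Xⁿ)'`. -/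
def baseChangeComplex (O' : Type u) [CommRing O'] [Algebra O O']
    (X : CochainComplex (BimodCat O A B) ℤ) :
    CochainComplex (BimodCat O' (O' ⊗[O] A) (O' ⊗[O] B)) ℤ :=
  ((baseChangeFunctor O A B O').mapHomologicalComplex (ComplexShape.up ℤ)).obj X

variable (O A) in
/-- The `(A, A)`-bimodule `A`, as a complex concentrated in degree `0`. -/
def regularComplex : CochainComplex (BimodCat O A A) ℤ :=
  (HomologicalComplex.single (BimodCat O A A) (ComplexShape.up ℤ) 0).obj (regular O A)

end Complexes

/-! ### Grothendieck groups with respect to split exact sequences -/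

section Grothendieck

section Ring

variable (Λ : Type u) [Ring Λ]

/-- Isomorphism of finitely generated modules. -/
def isoSetoid : Setoid (FGModuleCat.{u} Λ) where
  r X Y := Nonempty (X.obj ≅ Y.obj)
  iseqv := ⟨fun _ => ⟨Iso.refl _⟩, fun ⟨e⟩ => ⟨e.symm⟩, fun ⟨e⟩ ⟨f⟩ => ⟨e ≪≫ f⟩⟩

/-- The isomorphism classes of finitely generated `Λ`-modules. -/
def IsoClass : Type (u + 1) := Quotient (isoSetoid Λ)

variable {Λ}

theorem finite_of_iso {X Y : ModuleCat.{u} Λ} (e : X ≅ Y) [Module.Finite Λ X] :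
    Module.Finite Λ Y := Module.Finite.equiv e.toLinearEquiv

instance finite_biprod (X Y : ModuleCat.{u} Λ) [Module.Finite Λ X] [Module.Finite Λ Y] :
    Module.Finite Λ (X ⊞ Y : ModuleCat.{u} Λ) :=
  have : Module.Finite Λ (ModuleCat.of Λ (X × Y)) := inferInstanceAs (Module.Finite Λ (X × Y))
  finite_of_iso (ModuleCat.biprodIsoProd X Y).symm

/-- The isomorphism class of a finitely generated module. -/
def isoClass (X : ModuleCat.{u} Λ) [h : Module.Finite Λ X] : IsoClass Λ :=
  Quotient.mk (isoSetoid Λ) ⟨X, h⟩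

theorem isoClass_eq_iff {X Y : ModuleCat.{u} Λ} [Module.Finite Λ X] [Module.Finite Λ Y] :
    isoClass X = isoClass Y ↔ Nonempty (X ≅ Y) :=
  Quotient.eq (r := isoSetoid Λ)

theorem IsoClass.ind {p : IsoClass Λ → Prop}
    (h : ∀ (X : ModuleCat.{u} Λ) [Module.Finite Λ X], p (isoClass X)) (x : IsoClass Λ) : p x :=
  Quotient.ind (s := isoSetoid Λ) (fun X => @h X.obj X.property) x

instance : Zero (IsoClass Λ) := ⟨isoClass (ModuleCat.of Λ PUnit)⟩

/-- Addition of isomorphism classes is the direct sum. -/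
instance : Add (IsoClass Λ) :=
  ⟨Quotient.map₂ (sa := isoSetoid Λ) (sb := isoSetoid Λ) (sc := isoSetoid Λ)
    (fun X Y => ⟨X.obj ⊞ Y.obj,
      have := X.property
      have := Y.property
      finite_biprod X.obj Y.obj⟩)
    (fun _ _ ⟨e⟩ _ _ ⟨f⟩ => ⟨biprod.mapIso e f⟩)⟩

instance : AddCommMonoid (IsoClass Λ) where
  nsmul := nsmulRec
  add_assoc x y z := Quotient.inductionOn₃ x y z fun X Y Z =>
    Quotient.sound ⟨biprod.associator X.obj Y.obj Z.obj⟩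
  add_comm x y := Quotient.inductionOn₂ x y fun X Y =>
    Quotient.sound ⟨biprod.braiding X.obj Y.obj⟩
  zero_add x := Quotient.inductionOn x fun X =>
    Quotient.sound ⟨(isoZeroBiprod (ModuleCat.isZero_of_subsingleton _)).symm⟩
  add_zero x := Quotient.inductionOn x fun X =>
    Quotient.sound ⟨(isoBiprodZero (ModuleCat.isZero_of_subsingleton _)).symm⟩

theorem isoClass_add (X Y : ModuleCat.{u} Λ) [Module.Finite Λ X] [Module.Finite Λ Y] :
    isoClass X + isoClass Y = isoClass (X ⊞ Y) := rfl

theorem isoClass_zero : isoClass (ModuleCat.of Λ PUnit) = 0 := rfl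

variable (Λ) in
/-- The Grothendieck group of finitely generated `Λ`-modules with respect to split exact
sequences: the group generated by the isomorphism classes of finitely generated modules, with
the relations `[X ⊕ Y] = [X] + [Y]`. -/
abbrev GrothendieckGroup : Type (u + 1) := Algebra.GrothendieckAddGroup (IsoClass Λ)

theorem lift_of {S G : Type (u + 1)} [AddCommMonoid S] [AddCommGroup G] (f : S →+ G) (x : S) :
    Algebra.GrothendieckAddGroup.lift f (Algebra.GrothendieckAddGroup.of x) = f x :=
  DFunLike.congr_fun (Algebra.GrothendieckAddGroup.lift.symm_apply_apply f) x

theorem hom_ext {S G : Type (u + 1)} [AddCommMonoid S] [AddCommGroup G]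
    {f g : Algebra.GrothendieckAddGroup S →+ G}
    (h : ∀ x, f (Algebra.GrothendieckAddGroup.of x) = g (Algebra.GrothendieckAddGroup.of x)) :
    f = g :=
  Algebra.GrothendieckAddGroup.lift.symm.injective (AddMonoidHom.ext h)

/-- An additive functor commutes with direct sums. -/
def mapBiprodIso {Γ : Type u} [Ring Γ] (F : ModuleCat.{u} Λ ⥤ ModuleCat.{u} Γ) [F.Additive]
    (X Y : ModuleCat.{u} Λ) : F.obj (X ⊞ Y) ≅ F.obj X ⊞ F.obj Y :=
  have : PreservesBinaryBiproducts F := preservesBinaryBiproducts_of_preservesBiproducts F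
  F.mapBiprod X Y

/-- The element `[X]` of the Grothendieck group. -/
def cls (X : ModuleCat.{u} Λ) [Module.Finite Λ X] : GrothendieckGroup Λ :=
  Algebra.GrothendieckAddGroup.of (isoClass X)

end Ring

variable {O : Type u} [CommRing O]
variable {A : Type u} [Ring A] [Algebra O A] {B : Type u} [Ring B] [Algebra O B]
variable {C : Type u} [Ring C] [Algebra O C]

/-- The Grothendieck group `R(A, B)` of finitely generated `(A, B)`-bimodules. -/
abbrev BimodGroup (O A B : Type u) [CommRing O] [Ring A] [Algebra O A] [Ring B] [Algebra O B] :=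
  GrothendieckGroup (A ⊗[O] Bᵐᵒᵖ)

variable (O A B) in
/-- The subgroup `P(A, B)` of `R(A, B)` generated by the classes of the bimodules which are
finitely generated projective as left and as right modules. -/
def projGroup : AddSubgroup (BimodGroup O A B) :=
  AddSubgroup.closure {x | ∃ (M : BimodCat O A B) (hM : IsBiprojective M),
    x = have := hM.finite; cls M}

variable [Module.Finite O A] [Module.Finite O B] [Module.Finite O C]

/-- The isomorphism class of `M ⊗_B N`, as a biadditive function of those of `M` and `N`. -/
def tensorClass : IsoClass (A ⊗[O] Bᵐᵒᵖ) →+ IsoClass (B ⊗[O] Cᵐᵒᵖ) →+ IsoClass (A ⊗[O] Cᵐᵒᵖ) where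
  toFun x :=
    { toFun := fun y => Quotient.map₂ (sa := isoSetoid _) (sb := isoSetoid _) (sc := isoSetoid _)
        (fun M N => ⟨tensor M.obj N.obj,
          have := M.property
          have := N.property
          finite_tensor M.obj N.obj⟩)
        (fun _ _ ⟨e⟩ _ _ ⟨f⟩ => ⟨((tensorBifunctor O A B C).mapIso e).app _ ≪≫
          ((tensorBifunctor O A B C).obj _).mapIso f⟩) x y
      map_zero' := Quotient.inductionOn x fun M => Quotient.sound
        ⟨(((tensorBifunctor O A B C).obj M.obj).map_isZero
          (ModuleCat.isZero_of_subsingleton _)).iso (ModuleCat.isZero_of_subsingleton _)⟩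
      map_add' := fun y z => Quotient.inductionOn₃ x y z fun M N N₁ => Quotient.sound
        ⟨mapBiprodIso ((tensorBifunctor O A B C).obj M.obj) N.obj N₁.obj⟩ }
  map_zero' := by
    ext y
    exact Quotient.inductionOn y fun N => Quotient.sound
      ⟨(((tensorBifunctor O A B C).flip.obj N.obj).map_isZero
        (ModuleCat.isZero_of_subsingleton _)).iso (ModuleCat.isZero_of_subsingleton _)⟩
  map_add' x x' := by
    ext y
    exact Quotient.inductionOn₃ x x' y fun M M₁ N => Quotient.sound
      ⟨mapBiprodIso ((tensorBifunctor O A B C).flip.obj N.obj) M.obj M₁.obj⟩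

/-- The biadditive product `R(A, B) × R(B, C) → R(A, C)` with `[M] · [N] = [M ⊗_B N]`. -/
def tensorProd : BimodGroup O A B →+ BimodGroup O B C →+ BimodGroup O A C :=
  Algebra.GrothendieckAddGroup.lift
    { toFun := fun x => Algebra.GrothendieckAddGroup.lift
        (Algebra.GrothendieckAddGroup.of.comp (tensorClass x))
      map_zero' := hom_ext fun y => by
        rw [lift_of, map_zero, AddMonoidHom.zero_apply, AddMonoidHom.comp_apply,
          AddMonoidHom.zero_apply, map_zero]
      map_add' := fun x x' => hom_ext fun y => by
        rw [AddMonoidHom.add_apply, lift_of, lift_of, lift_of, map_add, AddMonoidHom.comp_apply,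
          AddMonoidHom.comp_apply, AddMonoidHom.comp_apply, AddMonoidHom.add_apply, map_add] }

theorem tensorProd_cls (M : BimodCat O A B) (N : BimodCat O B C) [Module.Finite (A ⊗[O] Bᵐᵒᵖ) M]
    [Module.Finite (B ⊗[O] Cᵐᵒᵖ) N] : tensorProd (cls M) (cls N) = cls (tensor M N) := by
  unfold tensorProd cls
  rw [lift_of]
  exact lift_of _ _

end Grothendieck

/-! ### The equivalences -/

section Equivalences

variable {O : Type u} [CommRing O]
variable {A : Type u} [Ring A] [Algebra O A] {B : Type u} [Ring B] [Algebra O B]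

variable (O A) in
/-- An `O`-algebra `A` is symmetric if `A ≅ A^∨` as `(A, A)`-bimodules. -/
def IsSymmetric : Prop := Nonempty (regular O A ≅ dual (regular O A))

/-- The bounded complex `X` of `(A, B)`-bimodules induces a Rickard equivalence: there are
contractible complexes `Y` and `Z` with `X ⊗_B X^∨ ≅ A ⊕ Y` and `X^∨ ⊗_A X ≅ B ⊕ Z`. -/
def InducesRickardEquivalence (X : CochainComplex (BimodCat O A B) ℤ) : Prop :=
  (∃ Y : CochainComplex (BimodCat O A A) ℤ, IsContractible Y ∧
    Nonempty (tensorComplex X (dualComplex X) ≅ regularComplex O A ⊞ Y)) ∧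
  (∃ Z : CochainComplex (BimodCat O B B) ℤ, IsContractible Z ∧
    Nonempty (tensorComplex (dualComplex X) X ≅ regularComplex O B ⊞ Z))

/-- The bimodule `M` induces a stable equivalence of Morita type: there are projective bimodules
`U` and `V` with `M ⊗_B M^∨ ≅ A ⊕ U` and `M^∨ ⊗_A M ≅ B ⊕ V`. -/
def InducesStableEquivalence (M : BimodCat O A B) : Prop :=
  (∃ U : BimodCat O A A, Module.Projective (A ⊗[O] Aᵐᵒᵖ) U ∧
    Nonempty (tensor M (dual M) ≅ regular O A ⊞ U)) ∧
  (∃ V : BimodCat O B B, Module.Projective (B ⊗[O] Bᵐᵒᵖ) V ∧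
    Nonempty (tensor (dual M) M ≅ regular O B ⊞ V))

/-- The bimodule `M` induces a Morita equivalence: the functor `M ⊗_B -` from finitely generated
left `B`-modules to finitely generated left `A`-modules is an equivalence of categories. -/
def InducesMoritaEquivalence [Module.Finite O A] [Module.Finite O B] (M : BimodCat O A B)
    [Module.Finite (A ⊗[O] Bᵐᵒᵖ) M] : Prop :=
  (tensorFunctorFG M).IsEquivalence

/-- `U ∈ P(A, B)` and `V ∈ P(B, A)` induce a virtual Morita equivalence: `U · V = [A]` in `R(A, A)`
and `V · U = [B]` in `R(B, B)`. -/
def InduceVirtualMoritaEquivalence [Module.Finite O A] [Module.Finite O B]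
    (U : BimodGroup O A B) (V : BimodGroup O B A) : Prop :=
  U ∈ projGroup O A B ∧ V ∈ projGroup O B A ∧
    tensorProd U V = cls (regular O A) ∧ tensorProd V U = cls (regular O B)

end Equivalences

end SymAlg

end

open SymAlg

noncomputable section

namespace SymAlg

/-! ### Comparing idempotents -/

section Idempotents

/-! The map O → O' is flat, because O' is torsion-free over a principal ideal domain, and local,
because the maximal ideal of O goes into that of O'; so it is faithfully flat. A biprojective
bimodule is a summand of some Aⁿ, hence finite free over O. For bimodules finite free over O, and
for bounded complexes of them, homomorphisms form the kernel of an O-linear map between finite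
products of modules that extend well, so that Hom(P', Q') = O' ⊗ Hom(P, Q)
(`isExtension_baseChangeMap`, `isExtension_baseChangeComplexMap`). Extension of scalars also
commutes with tensor products, with regular bimodules and, under the freeness condition, with duals.
Symmetry of A and B makes the dual of a biprojective bimodule biprojective (`IsBiprojective.dual`),
so all tensor products in the statement are again lattices over O.

Direct summands and isomorphisms descend by a Noether–Deuring argument. If P and Q are summands of Z
with idempotents e and f, then P is a summand of Q exactly when e a f b e = e is solvable in the
ring End Z. By Nakayama this may be tested in the semisimple quotient S of k ⊗ End Z, k being the
residue field of O. There it holds as soon as dim eT ≤ dim fT for all finite-dimensional S-modules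
T, and these dimensions do not change when k is enlarged to the residue field of O'. So being a
summand descends (`retract_of_map_retract`), and two objects that are summands of each other are
isomorphic by noetherianity. The same dimension count cancels common summands
(`nonempty_iso_of_biprod_iso`); no Krull–Schmidt decomposition is involved.

For (a) and (b), an isomorphism W' ≅ A' ⊕ U therefore comes from some W ≅ A ⊕ Y with Y' ≅ U. That Y
is contractible, respectively projective, amounts to the solvability of a linear equation between
Hom-modules, and solvability descends along faithfully flat extensions (`IsExtension.mem_range`).

For (d), cancellation turns an equation in the Grothendieck group into an isomorphism between actual
bimodules, which descends (`cls_eq_iff`, `IsLattice.nonempty_iso`).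

For (c), a biprojective M induces a Morita equivalence if and only if the left module M is a
generator and B → End_A(M) is bijective (`inducesMoritaEquivalence_iff`). The first condition is the
solvability of a linear equation over O, the second the bijectivity of an O-linear map; both hold
over O exactly when they hold over O'. -/

/-- For idempotents `e` and `f`, the right ideal `e E` is isomorphic to a direct summand
of `f E`. -/
def IdemLE {E : Type*} [Mul E] (e f : E) : Prop := ∃ a b, e * a * f * b * e = e

theorem IdemLE.map {E S F : Type*} [Mul E] [Mul S] [FunLike F E S] [MulHomClass F E S] {e f : E}
    (h : IdemLE e f) (φ : F) :
    IdemLE (φ e) (φ f) := by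
  obtain ⟨a, b, h⟩ := h
  exact ⟨φ a, φ b, by simpa only [map_mul] using congrArg φ h⟩

/-- The defect j = e - e a f b e of a lifted comparison lies in the kernel of φ and satisfies (1 -
j) e = e a f b e. Multiplying by a left inverse u of 1 - j gives an exact comparison, with a
replaced by u e a. -/
theorem IdemLE.of_map {E S : Type*} [Ring E] [Ring S] (φ : E →+* S) (hφ : Function.Surjective φ)
    (hinv : ∀ j, φ j = 0 → ∃ u, u * (1 - j) = 1) {e f : E} (he : IsIdempotentElem e)
    (h : IdemLE (φ e) (φ f)) : IdemLE e f := by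
  obtain ⟨a, b, h⟩ := h
  obtain ⟨a, rfl⟩ := hφ a
  obtain ⟨b, rfl⟩ := hφ b
  have hj : φ (e - e * a * f * b * e) = 0 := by
    rw [map_sub]; simp only [map_mul]; rw [h, sub_self]
  obtain ⟨u, hu⟩ := hinv _ hj
  have h1 : (1 - (e - e * a * f * b * e)) * e = e * a * f * b * e := by
    have : e * e = e := he
    rw [sub_mul, sub_mul, one_mul, this, mul_assoc (e * a * f * b) e e, this]
    abel
  refine ⟨u * e * a, b, ?_⟩
  calc e * (u * e * a) * f * b * e = e * u * (e * a * f * b * e) := by simp only [mul_assoc]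
    _ = e * (u * (1 - (e - e * a * f * b * e))) * e := by
        conv_lhs => rw [← h1]
        simp only [mul_assoc]
    _ = e := by rw [hu, mul_one, he]

end Idempotents

/-! ### Semisimple algebras over a field -/

section Semisimple

theorem finite_linearMap (k S U T : Type*) [CommRing k] [IsNoetherianRing k] [Ring S] [Algebra k S]
    [AddCommGroup U] [Module k U] [Module S U] [IsScalarTower k S U] [Module.Finite k U]
    [AddCommGroup T] [Module k T] [Module S T] [IsScalarTower k S T] [Module.Finite k T] :
    Module.Finite k (U →ₗ[S] T) := by
  have : IsNoetherian k T := isNoetherian_of_isNoetherianRing_of_finite k T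
  exact Module.Finite.of_injective (LinearMap.restrictScalarsₗ k S U T k)
    (LinearMap.restrictScalars_injective k)

variable {k : Type u} [Field k] {S : Type u} [Ring S] [Algebra k S]

/-- Simple multiplicities are compared through dimensions of Hom spaces. Split a simple T off U; the
inequality at T forces a nonzero, hence split surjective, map V → T. The copies of T cancel, and the
induction continues with the complements. -/
theorem exists_injective_of_finrank_hom_le [IsSemisimpleRing S] (n : ℕ) (U V : Type u)
    [AddCommGroup U] [Module k U] [Module S U] [IsScalarTower k S U] [Module.Finite k U]
    [AddCommGroup V] [Module k V] [Module S V] [IsScalarTower k S V] [Module.Finite k V]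
    (hn : Module.finrank k U ≤ n)
    (h : ∀ (T : Type u) [AddCommGroup T] [Module k T] [Module S T] [IsScalarTower k S T]
      [Module.Finite k T] [IsSimpleModule S T],
      Module.finrank k (U →ₗ[S] T) ≤ Module.finrank k (V →ₗ[S] T)) :
    ∃ i : U →ₗ[S] V, Function.Injective i := by
  induction n generalizing U V with
  | zero =>
    have : Subsingleton U := Module.finrank_zero_iff.1 (Nat.le_zero.1 hn)
    exact ⟨0, Function.injective_of_subsingleton _⟩
  | succ n ih =>
    rcases subsingleton_or_nontrivial U with hU | hU
    · exact ⟨0, Function.injective_of_subsingleton _⟩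
    obtain ⟨T, hT⟩ := IsSemisimpleModule.exists_simple_submodule S U
    obtain ⟨U₁, hc⟩ := exists_isCompl T
    let π : U →ₗ[S] T := T.projectionOnto U₁ hc
    let ρ : U →ₗ[S] U₁ := U₁.projectionOnto T hc.symm
    have hπ (x : T) : π x = x := Submodule.projectionOnto_apply_left hc x
    have hρ (x : U₁) : ρ x = x := Submodule.projectionOnto_apply_left hc.symm x
    have hπ0 (x : U₁) : π x = 0 := Submodule.projectionOnto_apply_right hc x
    have hρ0 (x : T) : ρ x = 0 := Submodule.projectionOnto_apply_right hc.symm x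
    have hsum (x : U) : (π x : U) + ρ x = x := 
      Submodule.projection_add_projection_eq_self hc x
    have : Module.Finite k T := Module.Finite.of_injective (T.subtype.restrictScalars k)
      Subtype.val_injective
    have : Module.Finite k U₁ := Module.Finite.of_injective (U₁.subtype.restrictScalars k)
      Subtype.val_injective
    have fin (X Y : Type u) [AddCommGroup X] [Module k X] [Module S X] [IsScalarTower k S X]
        [Module.Finite k X] [AddCommGroup Y] [Module k Y] [Module S Y] [IsScalarTower k S Y]
        [Module.Finite k Y] : Module.Finite k (X →ₗ[S] Y) := finite_linearMap k S X Y
    have hTnt : Nontrivial T := IsSimpleModule.nontrivial S T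
    obtain ⟨g, hg⟩ : ∃ g : V →ₗ[S] T, g ≠ 0 := by
      have hpos : 0 < Module.finrank k (U →ₗ[S] T) := by
        have := fin U T
        have : Nontrivial (U →ₗ[S] T) := by
          refine ⟨π, 0, fun h0 => ?_⟩
          obtain ⟨x, hx⟩ := exists_ne (0 : T)
          exact hx (by rw [← hπ x, h0]; rfl)
        exact Module.finrank_pos
      have := fin V T
      have h2 := lt_of_lt_of_le hpos (h T)
      have : Nontrivial (V →ₗ[S] T) := Module.finrank_pos_iff.1 h2
      exact exists_ne 0
    have hgs := LinearMap.surjective_of_ne_zero hg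
    obtain ⟨s, hs⟩ := IsSemisimpleModule.lifting_property g hgs LinearMap.id
    have hs' (x : T) : g (s x) = x := LinearMap.congr_fun hs x
    let V₁ := LinearMap.ker g
    have : Module.Finite k V₁ := Module.Finite.of_injective (V₁.subtype.restrictScalars k)
      Subtype.val_injective
    have hlt : Module.finrank k U₁ ≤ n := by
      have h1 : Module.finrank k (T × U₁) ≤ Module.finrank k U :=
        LinearMap.finrank_le_finrank_of_injective
          (f := ((T.prodEquivOfIsCompl U₁ hc).toLinearMap.restrictScalars k))
          (T.prodEquivOfIsCompl U₁ hc).injective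
      rw [Module.finrank_prod] at h1
      have : 0 < Module.finrank k T := Module.finrank_pos
      omega
    -- The contribution of Hom(T, T') cancels. Two injections suffice for this: Hom(T, T') × Hom(U₁,
    -- T') into Hom(U, T'), and Hom(V, T') into Hom(T, T') × Hom(V₁, T').
    obtain ⟨j, hj⟩ := ih U₁ V₁ hlt fun T' => by
      intro _ _ _ _ _ _
      have := fin U T'
      have := fin V T'
      have := fin T T'
      have := fin U₁ T'
      have := fin V₁ T'
      have h1 : Module.finrank k ((T →ₗ[S] T') × (U₁ →ₗ[S] T')) ≤ Module.finrank k (U →ₗ[S] T') :=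
        LinearMap.finrank_le_finrank_of_injective
          (f := ({ toFun := fun p => p.1 ∘ₗ π + p.2 ∘ₗ ρ
                   map_add' := fun p q => by ext x; simp; abel
                   map_smul' := fun c p => by ext x; simp } :
            ((T →ₗ[S] T') × (U₁ →ₗ[S] T')) →ₗ[k] (U →ₗ[S] T'))) <| by
          rw [injective_iff_map_eq_zero]
          rintro ⟨p, q⟩ h0
          have h0 (x : U) : p (π x) + q (ρ x) = 0 := LinearMap.congr_fun h0 x
          refine Prod.ext (LinearMap.ext fun x => ?_) (LinearMap.ext fun x => ?_)
          · simpa [hπ, hρ0] using h0 x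
          · simpa [hρ, hπ0] using h0 x
      have h2 : Module.finrank k (V →ₗ[S] T') ≤ Module.finrank k ((T →ₗ[S] T') × (V₁ →ₗ[S] T')) :=
        LinearMap.finrank_le_finrank_of_injective
          (f := ({ toFun := fun p => (p ∘ₗ s, p ∘ₗ V₁.subtype)
                   map_add' := fun p q => rfl
                   map_smul' := fun c p => rfl } :
            (V →ₗ[S] T') →ₗ[k] ((T →ₗ[S] T') × (V₁ →ₗ[S] T')))) <| by
          rw [injective_iff_map_eq_zero]
          intro p h0
          obtain ⟨h1, h2⟩ := Prod.mk.inj h0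
          ext x
          have hx : x - s (g x) ∈ V₁ := by
            rw [LinearMap.mem_ker, map_sub, hs', sub_self]
          have e1 : p (s (g x)) = 0 := LinearMap.congr_fun h1 (g x)
          have e2 : p (x - s (g x)) = 0 := LinearMap.congr_fun h2 ⟨_, hx⟩
          rw [map_sub, e1, sub_zero] at e2
          exact e2
      have h3 := h T'
      rw [Module.finrank_prod] at h1 h2
      omega
    refine ⟨s ∘ₗ π + V₁.subtype ∘ₗ j ∘ₗ ρ, ?_⟩
    rw [injective_iff_map_eq_zero]
    intro x hx
    have hx : s (π x) + (j (ρ x) : V) = 0 := hx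
    have h0 : π x = 0 := by
      have := congrArg g hx
      rw [map_add, hs', (j (ρ x)).2, map_zero, add_zero] at this
      exact this
    rw [h0, map_zero, zero_add] at hx
    have h1 : ρ x = 0 := hj (by rw [map_zero]; exact Subtype.ext hx)
    rw [← hsum x, h0, h1]
    simp

/-- The equation factors e through f, and composition does not increase rank. -/
theorem finrank_range_le_of_mul_eq {k T : Type*} [Field k] [AddCommGroup T] [Module k T]
    [Module.Finite k T] {e f a b : Module.End k T} (h : e * a * f * b * e = e) :
    Module.finrank k (LinearMap.range e) ≤ Module.finrank k (LinearMap.range f) := by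
  refine Module.finrank_le_finrank_of_rank_le_rank (Cardinal.lift_le.2 ?_)
    (Module.rank_lt_aleph0 k _)
  change LinearMap.rank e ≤ LinearMap.rank f
  calc LinearMap.rank e = LinearMap.rank ((e * a) ∘ₗ (f ∘ₗ (b * e))) := by
        rw [← Module.End.mul_eq_comp, ← Module.End.mul_eq_comp, ← mul_assoc, ← mul_assoc, h]
    _ ≤ _ := (LinearMap.rank_comp_le_right _ _).trans (LinearMap.rank_comp_le_left _ _)

/-- Evaluation at `e` identifies homomorphisms `S e → T` with `e T`. -/
theorem finrank_hom_span_idempotent {e : S} (he : IsIdempotentElem e) (T : Type u) [AddCommGroup T]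
    [Module k T] [Module S T] [IsScalarTower k S T] :
    Module.finrank k (Submodule.span S {e} →ₗ[S] T) =
      Module.finrank k (LinearMap.range (Algebra.lsmul k k T e)) := by
  have hmul (x : Submodule.span S {e}) : (x : S) * e = x := by
    obtain ⟨x, hx⟩ := x
    obtain ⟨a, rfl⟩ := Submodule.mem_span_singleton.1 hx
    change a * e * e = a * e
    rw [mul_assoc, he]
  let e₀ : Submodule.span S {e} := ⟨e, Submodule.mem_span_singleton_self e⟩
  refine LinearEquiv.finrank_eq
    { toFun := fun f => ⟨f e₀, f e₀, ?_⟩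
      map_add' := fun f g => rfl
      map_smul' := fun c f => rfl
      invFun := fun t => (LinearMap.toSpanSingleton S T t.1) ∘ₗ (Submodule.span S {e}).subtype
      left_inv := fun f => ?_
      right_inv := ?_ }
  · change e • f e₀ = f e₀
    rw [← map_smul]
    exact congrArg f (Subtype.ext he)
  · ext x
    change (x : S) • f e₀ = f x
    rw [← map_smul]
    exact congrArg f (Subtype.ext (hmul x))
  · rintro ⟨_, t, rfl⟩
    apply Subtype.ext
    change e • e • t = e • t
    rw [← mul_smul, he]

/-- Since Hom(S e, T) is e T, the inequalities embed S e into S f, and the embedding splits by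
semisimplicity. The images of the generators under the embedding and its retraction are the required
a and b. -/
theorem idemLE_of_finrank_le [IsSemisimpleRing S] [Module.Finite k S] {e f : S} (he : IsIdempotentElem e)
    (hf : IsIdempotentElem f)
    (h : ∀ (T : Type u) [AddCommGroup T] [Module k T] [Module S T] [IsScalarTower k S T]
      [Module.Finite k T],
      Module.finrank k (LinearMap.range (Algebra.lsmul k k T e)) ≤
        Module.finrank k (LinearMap.range (Algebra.lsmul k k T f))) : IdemLE e f := by
  let U := Submodule.span S {e}
  let V := Submodule.span S {f}
  have : Module.Finite k U := Module.Finite.of_injective (U.subtype.restrictScalars k)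
    Subtype.val_injective
  have : Module.Finite k V := Module.Finite.of_injective (V.subtype.restrictScalars k)
    Subtype.val_injective
  obtain ⟨i, hi⟩ := exists_injective_of_finrank_hom_le (k := k) (S := S) _ U V le_rfl fun T => by
    intro _ _ _ _ _ _
    rw [finrank_hom_span_idempotent he, finrank_hom_span_idempotent hf]
    exact h T
  obtain ⟨p, hp⟩ := IsSemisimpleModule.extension_property i hi LinearMap.id
  let e₀ : U := ⟨e, Submodule.mem_span_singleton_self e⟩
  let f₀ : V := ⟨f, Submodule.mem_span_singleton_self f⟩
  have he₀ : e • e₀ = e₀ := Subtype.ext he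
  have hv (v : V) : (v : S) • f₀ = v := by
    obtain ⟨x, hx⟩ := v
    obtain ⟨a, rfl⟩ := Submodule.mem_span_singleton.1 hx
    apply Subtype.ext
    change a * f * f = a * f
    rw [mul_assoc, hf]
  have hv' (v : V) : (v : S) * f = v := congrArg Subtype.val (hv v)
  have hu' (v : U) : (v : S) * e = v := by
    obtain ⟨x, hx⟩ := v
    obtain ⟨a, rfl⟩ := Submodule.mem_span_singleton.1 hx
    change a * e * e = a * e
    rw [mul_assoc, he]
  -- Here a = i(e) satisfies e a = a = a f, and b = p(f) satisfies b e = b; finally a b = p(a f) =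
  -- p(i(e)) = e.
  refine ⟨i e₀, p f₀, ?_⟩
  have h1 : e * (i e₀ : S) = i e₀ := by
    change ((e • i e₀ : V) : S) = i e₀
    rw [← map_smul, he₀]
  rw [h1, hv', mul_assoc, hu']
  change (((i e₀ : V) : S) • p f₀ : U).1 = e
  rw [← map_smul, hv, ← LinearMap.comp_apply, hp]
  rfl

end Semisimple

/-! ### Idempotents over local rings -/

section Local

open IsLocalRing

variable {O : Type u} [CommRing O] [IsLocalRing O] {E : Type u} [Ring E] [Algebra O E]

/-- Right multiplication by 1 - j is the identity on k ⊗ E, hence surjective on the finite module E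
by Nakayama. -/
theorem exists_mul_one_sub_eq_one [Module.Finite O E] {j : E} (hj : (1 : ResidueField O) ⊗ₜ[O] j = 0) :
    ∃ u, u * (1 - j) = 1 := by
  have h : LinearMap.range (LinearMap.mulRight O (1 - j)) = ⊤ := by
    rw [← map_tensorProduct_mk_eq_top, eq_top_iff]
    rintro z -
    obtain ⟨x, rfl⟩ : ∃ x, (1 : ResidueField O) ⊗ₜ[O] x = z :=
      TensorProduct.mk_surjective O E (ResidueField O) residue_surjective z
    refine ⟨x * (1 - j), ⟨x, rfl⟩, ?_⟩
    change (1 : ResidueField O) ⊗ₜ[O] (x * (1 - j)) = _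
    rw [mul_sub, mul_one, TensorProduct.tmul_sub, sub_eq_self]
    have := congrArg (fun z => ((1 : ResidueField O) ⊗ₜ[O] x) * z) hj
    simpa using this
  obtain ⟨u, hu⟩ := LinearMap.range_eq_top.1 h 1
  exact ⟨u, hu⟩

variable (O E) in
/-- The largest semisimple quotient of a finite algebra over a local ring. -/
def SemisimpleQuotient : Type u :=
  (ResidueField O ⊗[O] E) ⧸ Ring.jacobson (ResidueField O ⊗[O] E)

instance : Ring (SemisimpleQuotient O E) :=
  inferInstanceAs (Ring ((ResidueField O ⊗[O] E) ⧸ Ring.jacobson (ResidueField O ⊗[O] E)))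

instance : Algebra (ResidueField O) (SemisimpleQuotient O E) :=
  inferInstanceAs (Algebra (ResidueField O)
    ((ResidueField O ⊗[O] E) ⧸ Ring.jacobson (ResidueField O ⊗[O] E)))

instance : Algebra O (SemisimpleQuotient O E) :=
  Algebra.compHom _ (residue O)

instance : IsScalarTower O (ResidueField O) (SemisimpleQuotient O E) :=
  IsScalarTower.of_algebraMap_eq' rfl

instance [Module.Finite O E] : Module.Finite (ResidueField O) (SemisimpleQuotient O E) :=
  inferInstanceAs (Module.Finite (ResidueField O)
    ((ResidueField O ⊗[O] E) ⧸ Ring.jacobson (ResidueField O ⊗[O] E)))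

variable (O E) in
/-- The projection of `k ⊗ E` on its largest semisimple quotient. -/
def semisimpleQuotientMk : ResidueField O ⊗[O] E →ₐ[ResidueField O] SemisimpleQuotient O E :=
  Ideal.Quotient.mkₐ (ResidueField O) (Ring.jacobson (ResidueField O ⊗[O] E))

variable (O E) in
/-- The projection on the largest semisimple quotient. -/
def toSemisimpleQuotient : E →ₐ[O] SemisimpleQuotient O E :=
  ((semisimpleQuotientMk O E).restrictScalars O).comp Algebra.TensorProduct.includeRight

instance [Module.Finite O E] : IsSemisimpleRing (SemisimpleQuotient O E) := by
  have : IsArtinianRing (ResidueField O ⊗[O] E) := IsArtinianRing.of_finite (ResidueField O) _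
  exact inferInstanceAs
    (IsSemisimpleRing ((ResidueField O ⊗[O] E) ⧸ Ring.jacobson (ResidueField O ⊗[O] E)))

/-- The comparison is lifted twice: from the semisimple quotient to k ⊗ E, whose kernel is the
Jacobson radical, and from k ⊗ E to E by Nakayama. -/
theorem idemLE_of_toSemisimpleQuotient [Module.Finite O E] {e f : E} (he : IsIdempotentElem e)
    (h : IdemLE (toSemisimpleQuotient O E e) (toSemisimpleQuotient O E f)) : IdemLE e f := by
  refine IdemLE.of_map
    (Algebra.TensorProduct.includeRight : E →ₐ[O] ResidueField O ⊗[O] E).toRingHom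
    (TensorProduct.mk_surjective O E (ResidueField O) residue_surjective)
    (fun j hj => exists_mul_one_sub_eq_one hj) he ?_
  refine IdemLE.of_map (semisimpleQuotientMk O E).toRingHom
    Ideal.Quotient.mk_surjective (fun j hj => ?_) (he.map _) h
  change Ideal.Quotient.mk (Ring.jacobson (ResidueField O ⊗[O] E)) j = 0 at hj
  rw [Ideal.Quotient.eq_zero_iff_mem, ← Ideal.jacobson_bot, Ideal.mem_jacobson_iff] at hj
  -- With the factor -1, the membership criterion for the radical yields z (-1) j + z = 1, that is,
  -- z (1 - j) = 1.
  obtain ⟨z, hz⟩ := hj (-1)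
  refine ⟨z, ?_⟩
  rw [Ideal.mem_bot, sub_eq_zero] at hz
  have : z * (1 - j) = z * -1 * j + z := by
    rw [mul_neg, mul_one, neg_mul, mul_sub, mul_one]
    abel
  rw [this, hz]

variable (O) in
/-- Cancellation of summands. -/
theorem IdemLE.of_add [Module.Finite O E] {e f g : E} (he : IsIdempotentElem e) (hf : IsIdempotentElem f)
    (hg : IsIdempotentElem g) (heg : e * g = 0) (hge : g * e = 0) (hfg : f * g = 0)
    (hgf : g * f = 0) (h : IdemLE (e + g) (f + g)) : IdemLE e f := by
  refine idemLE_of_toSemisimpleQuotient (O := O) he ?_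
  have h' := h.map (toSemisimpleQuotient O E)
  set φ := toSemisimpleQuotient O E
  refine idemLE_of_finrank_le (k := ResidueField O) (he.map φ) (hf.map φ) fun T => ?_
  intro _ _ _ _ _
  -- For orthogonal idempotents the space (x + y) T is the direct sum of x T and y T. The dimension
  -- of g T then cancels from the inequality for e + g and f + g.
  have key (x y : E) (hx : IsIdempotentElem x) (hy : IsIdempotentElem y) (hxy : x * y = 0)
      (hyx : y * x = 0) :
      Module.finrank (ResidueField O)
        (LinearMap.range (Algebra.lsmul (ResidueField O) (ResidueField O) T (φ (x + y)))) =
      Module.finrank (ResidueField O)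
        (LinearMap.range (Algebra.lsmul (ResidueField O) (ResidueField O) T (φ x))) +
      Module.finrank (ResidueField O)
        (LinearMap.range (Algebra.lsmul (ResidueField O) (ResidueField O) T (φ y))) := by
    set X := Algebra.lsmul (ResidueField O) (ResidueField O) T (φ x) with hX
    set Y := Algebra.lsmul (ResidueField O) (ResidueField O) T (φ y) with hY
    have hXY (t) : X (Y t) = 0 := by
      rw [← Module.End.mul_apply, hX, hY, ← map_mul, ← map_mul, hxy, map_zero, map_zero]; rfl
    have hYX (t) : Y (X t) = 0 := by
      rw [← Module.End.mul_apply, hX, hY, ← map_mul, ← map_mul, hyx, map_zero, map_zero]; rfl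
    have hXX (t) : X (X t) = X t := by
      rw [← Module.End.mul_apply, hX, ← map_mul, ← map_mul, hx]
    have hYY (t) : Y (Y t) = Y t := by
      rw [← Module.End.mul_apply, hY, ← map_mul, ← map_mul, hy]
    rw [map_add, map_add, ← hX, ← hY, ← Module.finrank_prod]
    symm
    refine LinearEquiv.finrank_eq
      { toFun := fun p => ⟨p.1.1 + p.2.1, p.1.1 + p.2.1, ?_⟩
        map_add' := fun p q => Subtype.ext (by simp; abel)
        map_smul' := fun c p => Subtype.ext (by simp)
        invFun := fun z => (⟨X z, _, rfl⟩, ⟨Y z, _, rfl⟩)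
        left_inv := ?_
        right_inv := ?_ }
    · obtain ⟨⟨_, p, rfl⟩, ⟨_, q, rfl⟩⟩ := p
      simp [hXY, hYX, hXX, hYY]
    · rintro ⟨⟨_, p, rfl⟩, ⟨_, q, rfl⟩⟩
      simp [hXY, hYX, hXX, hYY]
    · rintro ⟨_, p, rfl⟩
      simp [hXY, hYX, hXX, hYY]
  have hle : Module.finrank (ResidueField O)
        (LinearMap.range (Algebra.lsmul (ResidueField O) (ResidueField O) T (φ (e + g)))) ≤
      Module.finrank (ResidueField O)
        (LinearMap.range (Algebra.lsmul (ResidueField O) (ResidueField O) T (φ (f + g)))) := by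
    obtain ⟨a, b, hab⟩ := h'.map
      (Algebra.lsmul (ResidueField O) (ResidueField O) T)
    exact finrank_range_le_of_mul_eq hab
  rw [key e g he hg heg hge, key f g hf hg hfg hgf] at hle
  omega

variable {O' : Type u} [CommRing O'] [IsLocalRing O'] [Algebra O O']
  [IsLocalHom (algebraMap O O')]

/-- A finite algebra, extended to `O'`, acts on the extension of its semisimple quotient. -/
def baseChangeToSemisimpleQuotient :
    O' ⊗[O] E →ₐ[O] ResidueField O' ⊗[ResidueField O] SemisimpleQuotient O E :=
  Algebra.TensorProduct.lift
    ((Algebra.TensorProduct.includeLeft : ResidueField O' →ₐ[ResidueField O]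
      ResidueField O' ⊗[ResidueField O] SemisimpleQuotient O E).restrictScalars O |>.comp
        (IsScalarTower.toAlgHom O O' (ResidueField O')))
    (((Algebra.TensorProduct.includeRight : SemisimpleQuotient O E →ₐ[ResidueField O]
      ResidueField O' ⊗[ResidueField O] SemisimpleQuotient O E).restrictScalars O).comp
        (toSemisimpleQuotient O E))
    fun c x => by
      change (_ ⊗ₜ _) * (_ ⊗ₜ _) = (_ ⊗ₜ _) * (_ ⊗ₜ _)
      simp

theorem baseChangeToSemisimpleQuotient_tmul (x : E) :
    baseChangeToSemisimpleQuotient (O := O) ((1 : O') ⊗ₜ[O] x) =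
      (1 : ResidueField O') ⊗ₜ toSemisimpleQuotient O E x := by
  unfold baseChangeToSemisimpleQuotient
  rw [Algebra.TensorProduct.lift_tmul, map_one, one_mul]
  rfl

/-- The action of `k' ⊗ S` on `k' ⊗ T`. -/
def extendedAct (k k' S T : Type u) [Field k] [Field k'] [Algebra k k'] [Ring S] [Algebra k S]
    [AddCommGroup T] [Module k T] [Module S T] [IsScalarTower k S T] :
    k' ⊗[k] S →ₐ[k'] Module.End k' (k' ⊗[k] T) :=
  Algebra.TensorProduct.lift (Algebra.ofId k' _)
    ((Module.End.baseChangeHom k k' T).comp (Algebra.lsmul k k T))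
    fun c _ => Algebra.commutes c _

theorem extendedAct_one_tmul (k k' S T : Type u) [Field k] [Field k'] [Algebra k k'] [Ring S]
    [Algebra k S] [AddCommGroup T] [Module k T] [Module S T] [IsScalarTower k S T] (x : S) :
    extendedAct k k' S T (1 ⊗ₜ x) = (Algebra.lsmul k k T x).baseChange k' :=
  one_smul k' ((Algebra.lsmul k k T x).baseChange k')

/-- In the factorization of f through its range, the surjection stays surjective and, by flatness,
the inclusion stays injective. -/
theorem finrank_range_baseChange {k k' T : Type u} [Field k] [Field k'] [Algebra k k']
    [AddCommGroup T] [Module k T] (f : T →ₗ[k] T) :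
    Module.finrank k' (LinearMap.range (f.baseChange k')) =
      Module.finrank k (LinearMap.range f) := by
  have h : f.baseChange k' = (LinearMap.range f).subtype.baseChange k' ∘ₗ
      f.rangeRestrict.baseChange k' := by
    rw [← LinearMap.baseChange_comp]
    rfl
  have hs : Function.Surjective (f.rangeRestrict.baseChange k') :=
    LinearMap.lTensor_surjective k' f.surjective_rangeRestrict
  have hi : Function.Injective ((LinearMap.range f).subtype.baseChange k') :=
    Module.Flat.lTensor_preserves_injective_linearMap _ Subtype.val_injective
  rw [h, LinearMap.range_comp_of_range_eq_top _ (LinearMap.range_eq_top.2 hs),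
    LinearMap.finrank_range_of_inj hi, Module.finrank_baseChange]

/-- Comparison of idempotents descends along extension of scalars. -/
theorem IdemLE.of_one_tmul [Module.Finite O E] {e f : E} (he : IsIdempotentElem e)
    (hf : IsIdempotentElem f) (h : IdemLE ((1 : O') ⊗ₜ[O] e) ((1 : O') ⊗ₜ[O] f)) : IdemLE e f := by
  refine idemLE_of_toSemisimpleQuotient (O := O) he ?_
  -- Reduce the comparison over O' to k' ⊗ S, with S the semisimple quotient over k. Acting on k' ⊗
  -- T it bounds ranks over k', which equal the dimensions of e T and f T over k.
  have h' := h.map (baseChangeToSemisimpleQuotient (O := O) (O' := O') (E := E))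
  change IdemLE (baseChangeToSemisimpleQuotient ((1 : O') ⊗ₜ[O] e))
    (baseChangeToSemisimpleQuotient ((1 : O') ⊗ₜ[O] f)) at h'
  rw [baseChangeToSemisimpleQuotient_tmul, baseChangeToSemisimpleQuotient_tmul] at h'
  set φ := toSemisimpleQuotient O E
  refine idemLE_of_finrank_le (k := ResidueField O) (he.map φ) (hf.map φ) fun T => ?_
  intro _ _ _ _ _
  obtain ⟨a, b, hab⟩ := h'.map (extendedAct (ResidueField O) (ResidueField O')
    (SemisimpleQuotient O E) T)
  have := finrank_range_le_of_mul_eq hab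
  change Module.finrank _ (LinearMap.range (extendedAct _ _ _ _ (1 ⊗ₜ φ e))) ≤
    Module.finrank _ (LinearMap.range (extendedAct _ _ _ _ (1 ⊗ₜ φ f))) at this
  rwa [extendedAct_one_tmul, extendedAct_one_tmul, finrank_range_baseChange,
    finrank_range_baseChange] at this

end Local

/-! ### Retracts and idempotents -/

section Retracts

variable {C : Type*} [Category C]

/-- The idempotent endomorphism with image a given retract. -/
def retractIdem {P Z : C} (r : Retract P Z) : End Z := r.r ≫ r.i

theorem isIdempotentElem_retractIdem {P Z : C} (r : Retract P Z) :
    IsIdempotentElem (retractIdem r) := by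
  unfold IsIdempotentElem
  rw [End.mul_def]
  unfold retractIdem
  simp

/-- This replaces the summand relation inside a common object Z by an equation in the ring End Z,
the form in which it can be reduced modulo radicals and extended to O'. -/
theorem idemLE_retractIdem_iff {P Q Z : C} (r : Retract P Z) (s : Retract Q Z) :
    IdemLE (retractIdem r) (retractIdem s) ↔ Nonempty (Retract P Q) := by
  constructor
  · rintro ⟨a, b, h⟩
    simp only [End.mul_def, retractIdem] at h
    -- Products in `End Z` are compositions in reverse order, so b precedes a.
    refine ⟨⟨r.i ≫ b ≫ s.r, s.i ≫ a ≫ r.r, ?_⟩⟩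
    have := congrArg (fun f : Z ⟶ Z => r.i ≫ f ≫ r.r) h
    simpa using this
  · rintro ⟨t⟩
    refine ⟨s.r ≫ t.r ≫ r.i, r.r ≫ t.i ≫ s.i, ?_⟩
    simp [End.mul_def, retractIdem]

end Retracts

/-! ### Mutual retracts and cancellation in linear categories -/

section Linear

variable {O : Type u} [CommRing O] {C : Type*} [Category.{u} C] [Preadditive C] [Linear O C]

variable (O) in
theorem finite_hom_of_retract [IsNoetherianRing O] {X Y Z : C} [Module.Finite O (End Z)]
    (r : Retract X Z) (s : Retract Y Z) : Module.Finite O (X ⟶ Y) := by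
  have : IsNoetherian O (End Z) := isNoetherian_of_isNoetherianRing_of_finite O _
  refine Module.Finite.of_injective (N := End Z)
    (Linear.leftComp O _ r.r ∘ₗ Linear.rightComp O _ s.i) fun f g h => ?_
  have h : r.r ≫ f ≫ s.i = r.r ≫ g ≫ s.i := h
  have := congrArg (fun f => r.i ≫ f ≫ s.r) h
  simpa using this

variable (O) in
-- Composing the retracts makes P a summand of itself through Q. As End P is a noetherian ring,
-- one-sided inverses in it are two-sided, and this forces `r.r ≫ r.i` to be the identity of Q.
theorem nonempty_iso_of_retract [IsNoetherianRing O] {P Q : C} [Module.Finite O (End P)]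
    (r : Retract P Q) (s : Retract Q P) : Nonempty (P ≅ Q) := by
  have : IsNoetherianRing (End P) :=
    have := isNoetherian_of_isNoetherianRing_of_finite O (End P)
    isNoetherian_of_tower O inferInstance
  have ht : (r.i ≫ s.i) ≫ s.r ≫ r.r = 𝟙 P := by simp
  have hr : (s.r ≫ r.r) ≫ r.i ≫ s.i = 𝟙 P :=
    
    mul_eq_one_symm (a := (show End P from s.r ≫ r.r)) (b := (show End P from r.i ≫ s.i)) ht
  -- Sandwiching `hr` between `s.i` and `s.r` removes the outer factors, because `s.i ≫ s.r` is the
  -- identity of Q.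
  refine ⟨⟨r.i, r.r, r.retract, ?_⟩⟩
  have h4 := congrArg (fun f => s.i ≫ f ≫ s.r) hr
  simpa using h4

variable [HasBinaryBiproducts C]

theorem finite_hom_biprod_left [IsNoetherianRing O] {X Y Z : C} [Module.Finite O (X ⟶ Z)]
    [Module.Finite O (Y ⟶ Z)] : Module.Finite O (X ⊞ Y ⟶ Z) := by
  have := isNoetherian_of_isNoetherianRing_of_finite O (X ⟶ Z)
  have := isNoetherian_of_isNoetherianRing_of_finite O (Y ⟶ Z)
  refine Module.Finite.of_injective (N := (X ⟶ Z) × (Y ⟶ Z))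
    ((Linear.leftComp O Z biprod.inl).prod (Linear.leftComp O Z biprod.inr)) fun f g h => ?_
  obtain ⟨h1, h2⟩ := Prod.mk.inj h
  exact biprod.hom_ext' _ _ (by simpa using h1) (by simpa using h2)

theorem finite_hom_biprod_right [IsNoetherianRing O] {X Y Z : C} [Module.Finite O (Z ⟶ X)]
    [Module.Finite O (Z ⟶ Y)] : Module.Finite O (Z ⟶ X ⊞ Y) := by
  have := isNoetherian_of_isNoetherianRing_of_finite O (Z ⟶ X)
  have := isNoetherian_of_isNoetherianRing_of_finite O (Z ⟶ Y)
  refine Module.Finite.of_injective (N := (Z ⟶ X) × (Z ⟶ Y))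
    ((Linear.rightComp O Z biprod.fst).prod (Linear.rightComp O Z biprod.snd)) fun f g h => ?_
  obtain ⟨h1, h2⟩ := Prod.mk.inj h
  exact biprod.hom_ext _ _ (by simpa using h1) (by simpa using h2)

theorem finite_end_biprod [IsNoetherianRing O] {X Y : C} [Module.Finite O (X ⟶ X)]
    [Module.Finite O (X ⟶ Y)] [Module.Finite O (Y ⟶ X)] [Module.Finite O (Y ⟶ Y)] :
    Module.Finite O (End (X ⊞ Y)) :=
  have : Module.Finite O (X ⟶ X ⊞ Y) := finite_hom_biprod_right
  have : Module.Finite O (Y ⟶ X ⊞ Y) := finite_hom_biprod_right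
  finite_hom_biprod_left (Z := X ⊞ Y)

def retractInl (X Y : C) : Retract X (X ⊞ Y) := ⟨biprod.inl, biprod.fst, biprod.inl_fst⟩

def retractInr (X Y : C) : Retract Y (X ⊞ Y) := ⟨biprod.inr, biprod.snd, biprod.inr_snd⟩

/-- The map of biproducts induced by retracts. -/
def Retract.biprodMap {X Y X' Y' : C} (r : Retract X X') (s : Retract Y Y') :
    Retract (X ⊞ Y) (X' ⊞ Y') :=
  ⟨biprod.map r.i s.i, biprod.map r.r s.r, by ext <;> simp⟩

variable (O) in
/-- Summands can be cancelled from retracts. -/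
theorem retract_of_biprod_retract [IsLocalRing O] {P Q R : C}
    [Module.Finite O (End ((P ⊞ Q) ⊞ R))] (h : Nonempty (Retract (P ⊞ R) (Q ⊞ R))) :
    Nonempty (Retract P Q) := by
  -- Inside (P ⊞ Q) ⊞ R the idempotents e, f, g of P, Q, R are orthogonal, and e + g, f + g are the
  -- idempotents of P ⊞ R and Q ⊞ R. Cancelling R thus becomes cancelling g.
  let e := (retractInl P Q).trans (retractInl (P ⊞ Q) R)
  let f := (retractInr P Q).trans (retractInl (P ⊞ Q) R)
  let g := retractInr (P ⊞ Q) R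
  let eg := Retract.biprodMap (retractInl P Q) (Retract.refl R)
  let fg := Retract.biprodMap (retractInr P Q) (Retract.refl R)
  rw [← idemLE_retractIdem_iff eg fg] at h
  have h1 : retractIdem eg = retractIdem e + retractIdem g := by
    change eg.r ≫ eg.i = e.r ≫ e.i + g.r ≫ g.i
    apply biprod.hom_ext' <;> apply biprod.hom_ext <;>
      simp [eg, e, g, Retract.biprodMap, retractInl, retractInr, Retract.refl]
  have h2 : retractIdem fg = retractIdem f + retractIdem g := by
    change fg.r ≫ fg.i = f.r ≫ f.i + g.r ≫ g.i
    apply biprod.hom_ext' <;> apply biprod.hom_ext <;>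
      simp [fg, f, g, Retract.biprodMap, retractInl, retractInr, Retract.refl]
  rw [h1, h2] at h
  rw [← idemLE_retractIdem_iff e f]
  refine IdemLE.of_add O (isIdempotentElem_retractIdem e) (isIdempotentElem_retractIdem f)
    (isIdempotentElem_retractIdem g) ?_ ?_ ?_ ?_ h
  all_goals
    rw [End.mul_def]
    simp [e, f, g, retractIdem, retractInl, retractInr]

variable (O) in
/-- Summands can be cancelled. -/
theorem nonempty_iso_of_biprod_iso [IsNoetherianRing O] [IsLocalRing O] {P Q R : C}
    [hfin : Module.Finite O (End ((P ⊞ Q) ⊞ R))] (e : P ⊞ R ≅ Q ⊞ R) : Nonempty (P ≅ Q) := by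
  obtain ⟨r⟩ := retract_of_biprod_retract O ⟨Retract.ofIso e⟩
  have : Module.Finite O (End ((Q ⊞ P) ⊞ R)) := by
    let i : (Q ⊞ P) ⊞ R ≅ (P ⊞ Q) ⊞ R := biprod.mapIso (biprod.braiding Q P) (Iso.refl R)
    exact finite_hom_of_retract O (Retract.ofIso i) (Retract.ofIso i)
  obtain ⟨s⟩ := retract_of_biprod_retract O ⟨Retract.ofIso e.symm⟩
  let t := (retractInl P Q).trans (retractInl (P ⊞ Q) R)
  have : Module.Finite O (End P) := finite_hom_of_retract O t t
  exact nonempty_iso_of_retract O r s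

end Linear

/-! ### Base change of modules of homomorphisms -/

section BaseChangeHom

variable (O : Type*) [CommRing O] (O' : Type*) [CommRing O'] [Algebra O O']

/-- The map `φ : H → H'` extends to an isomorphism `O' ⊗ H ≅ H'`. -/
def IsExtension {H H' : Type*} [AddCommGroup H] [Module O H] [AddCommGroup H'] [Module O' H']
    (φ : H → H') : Prop :=
  ∃ θ : O' ⊗[O] H →ₗ[O'] H', Function.Bijective θ ∧ ∀ x, θ (1 ⊗ₜ x) = φ x

end BaseChangeHom

section EndMap

variable {O : Type u} [CommRing O] {O' : Type u} [CommRing O'] [Algebra O O']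
  {C : Type*} [Category.{u} C] [Preadditive C] [Linear O C]
  {D : Type*} [Category.{u} D] [Preadditive D] [Linear O' D]
  (F : C ⥤ D)

theorem finite_end_map {Z : C} [Module.Finite O (End Z)]
    (hZ : IsExtension O O' (fun f : Z ⟶ Z => F.map f)) : Module.Finite O' (End (F.obj Z)) := by
  obtain ⟨θ, hθ, -⟩ := hZ
  exact Module.Finite.of_surjective (M := O' ⊗[O] (End Z)) θ hθ.surjective

end EndMap

/-! ### Descent of direct summands and isomorphisms (Noether–Deuring) -/

section NoetherDeuring

variable {O : Type u} [CommRing O] [IsLocalRing O] {O' : Type u} [CommRing O'] [IsLocalRing O']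
  [Algebra O O'] [IsLocalHom (algebraMap O O')]
  {C : Type*} [Category.{u} C] [Preadditive C] [Linear O C]
  {D : Type*} [Category.{u} D] [Preadditive D] [Linear O' D]
  (F : C ⥤ D)

/-- Being a retract descends along extension of scalars. -/
theorem retract_of_map_retract {P Q Z : C} (r : Retract P Z) (s : Retract Q Z)
    [Module.Finite O (End Z)] (hZ : IsExtension O O' (fun f : Z ⟶ Z => F.map f))
    (h : Nonempty (Retract (F.obj P) (F.obj Q))) : Nonempty (Retract P Q) := by
  rw [← idemLE_retractIdem_iff (r.map F) (s.map F)] at h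
  rw [← idemLE_retractIdem_iff r s]
  obtain ⟨θ, hθ, hθF⟩ := hZ
  let θ : O' ⊗[O] (End Z) →ₗ[O'] End (F.obj Z) := θ
  have hθF (x : End Z) : θ (1 ⊗ₜ x) = F.map x := hθF x
  have hθF' (c : O') (x : End Z) : θ (c ⊗ₜ x) = c • F.map x := by
    rw [← hθF, ← map_smul, smul_tmul', smul_eq_mul, mul_one]
  -- Functoriality of F makes the linear extension θ multiplicative. Being bijective, it transports
  -- the comparison of idempotents from the endomorphisms of `F.obj Z` to O' ⊗ End Z.
  have hmul (x y : O' ⊗[O] (End Z)) : θ (x * y) = θ x * θ y := by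
    induction x with
    | zero => simp
    | add x x' hx hx' => rw [add_mul, map_add, hx, hx', map_add, add_mul]
    | tmul c x =>
      induction y with
      | zero => simp
      | add y y' hy hy' => rw [mul_add, map_add, hy, hy', map_add, mul_add]
      | tmul d y =>
        rw [Algebra.TensorProduct.tmul_mul_tmul, hθF', hθF', hθF', End.mul_def, End.mul_def,
          F.map_comp, Linear.smul_comp, Linear.comp_smul, smul_smul, _root_.mul_comm c d]
  refine IdemLE.of_one_tmul (O := O) (O' := O') (isIdempotentElem_retractIdem r)
    (isIdempotentElem_retractIdem s) ?_
  let ψ : O' ⊗[O] (End Z) ≃* End (F.obj Z) := MulEquiv.ofBijective (⟨θ, hmul⟩ : _ →ₙ* _) hθ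
  have h := h.map ψ.symm
  have hr : ψ.symm (retractIdem (r.map F)) = 1 ⊗ₜ retractIdem r := by
    rw [MulEquiv.symm_apply_eq]
    change _ = θ _
    rw [hθF]
    simp [retractIdem]
  have hs : ψ.symm (retractIdem (s.map F)) = 1 ⊗ₜ retractIdem s := by
    rw [MulEquiv.symm_apply_eq]
    change _ = θ _
    rw [hθF]
    simp [retractIdem]
  rwa [hr, hs] at h

/-- An isomorphism is a retract in both directions. Both descend, and mutual retracts with
noetherian endomorphism ring are isomorphic. -/
theorem nonempty_iso_of_map_iso [IsNoetherianRing O] {P Q Z : C} (r : Retract P Z)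
    (s : Retract Q Z) [Module.Finite O (End Z)] (hZ : IsExtension O O' (fun f : Z ⟶ Z => F.map f))
    (e : F.obj P ≅ F.obj Q) : Nonempty (P ≅ Q) := by
  obtain ⟨t⟩ := retract_of_map_retract F r s hZ ⟨Retract.ofIso e⟩
  obtain ⟨t'⟩ := retract_of_map_retract F s r hZ ⟨Retract.ofIso e.symm⟩
  have : Module.Finite O (End P) := finite_hom_of_retract O r r
  exact nonempty_iso_of_retract (P := P) O t t'

theorem exists_biprod_iso_of_retract {C : Type*} [Category C] [Abelian C] {P Q : C}
    (r : Retract P Q) : ∃ Y, Nonempty (Q ≅ P ⊞ Y) := by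
  have : IsSplitEpi r.r := ⟨⟨⟨r.i, r.retract⟩⟩⟩
  exact ⟨_, ⟨biprod.uniqueUpToIso _ _
    (isBilimitBinaryBiconeOfIsSplitEpiOfKernel (kernelIsKernel r.r)) ≪≫ biprod.braiding _ _⟩⟩

end NoetherDeuring

section NoetherDeuringAbelian

variable {O : Type u} [CommRing O] [IsLocalRing O]
  {O' : Type u} [CommRing O'] [IsLocalRing O'] [IsNoetherianRing O']
  [Algebra O O'] [IsLocalHom (algebraMap O O')]
  {C : Type*} [Category.{u} C] [Abelian C] [Linear O C]
  {D : Type*} [Category.{u} D] [Abelian D] [Linear O' D]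
  (F : C ⥤ D) [F.Additive]

/-- If `Q'` is isomorphic to `P' ⊕ R`, then `Q` is isomorphic to `P ⊕ Y` with `Y' ≅ R`. -/
theorem exists_biprod_iso_of_map_iso {P Q Z : C} (r : Retract P Z)
    (s : Retract Q Z) [Module.Finite O (End Z)] (hZ : IsExtension O O' (fun f : Z ⟶ Z => F.map f))
    {R : D} (e : F.obj Q ≅ F.obj P ⊞ R) :
    ∃ Y, Nonempty (Q ≅ P ⊞ Y) ∧ Nonempty (F.obj Y ≅ R) := by
  have : PreservesBinaryBiproducts F := preservesBinaryBiproducts_of_preservesBiproducts F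
  obtain ⟨t⟩ := retract_of_map_retract F r s hZ
    ⟨(retractInl _ R).trans (Retract.ofIso e.symm)⟩
  obtain ⟨Y, ⟨i⟩⟩ := exists_biprod_iso_of_retract t
  refine ⟨Y, ⟨i⟩, ?_⟩
  -- It remains to cancel F P from F P ⊕ F Y ≅ F Q ≅ F P ⊕ R over O'. Cancellation needs finite
  -- endomorphism modules; these are available because F Y, R and F P are all retracts of F Z.
  have hfin := finite_end_map F hZ
  let rY : Retract (F.obj Y) (F.obj Z) :=
    (((retractInr P Y).trans (Retract.ofIso i.symm)).trans s).map F
  let rP : Retract (F.obj P) (F.obj Z) := r.map F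
  let rR : Retract R (F.obj Z) := ((retractInr _ R).trans (Retract.ofIso e.symm)).trans (s.map F)
  have := finite_hom_of_retract O' rY rY
  have := finite_hom_of_retract O' rY rR
  have := finite_hom_of_retract O' rY rP
  have := finite_hom_of_retract O' rR rY
  have := finite_hom_of_retract O' rR rR
  have := finite_hom_of_retract O' rR rP
  have := finite_hom_of_retract O' rP rY
  have := finite_hom_of_retract O' rP rR
  have := finite_hom_of_retract O' rP rP
  have : Module.Finite O' (F.obj Y ⊞ R ⟶ F.obj Y ⊞ R) := finite_end_biprod
  have : Module.Finite O' (F.obj Y ⊞ R ⟶ F.obj P) := finite_hom_biprod_left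
  have : Module.Finite O' (F.obj P ⟶ F.obj Y ⊞ R) := finite_hom_biprod_right
  have : Module.Finite O' (End ((F.obj Y ⊞ R) ⊞ F.obj P)) := finite_end_biprod
  exact nonempty_iso_of_biprod_iso O' (R := F.obj P)
    (biprod.braiding _ _ ≪≫ (F.mapBiprod P Y).symm ≪≫ F.mapIso i.symm ≪≫ e ≪≫ biprod.braiding _ _)

end NoetherDeuringAbelian

/-! ### Extension of scalars for modules of homomorphisms -/

section IsExtension

variable {O O' : Type*} [CommRing O] [CommRing O'] [Algebra O O']

/-- Flatness makes O' ⊗ H the kernel of O' ⊗ V → O' ⊗ W, while H' is the kernel of D'. The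
isomorphisms given for V and W identify the two kernels. -/
theorem IsExtension.of_exact [Module.Flat O O'] {H V W H' V' W' : Type*}
    [AddCommGroup H] [Module O H] [AddCommGroup V] [Module O V] [AddCommGroup W] [Module O W]
    [AddCommGroup H'] [Module O' H'] [AddCommGroup V'] [Module O' V'] [AddCommGroup W']
    [Module O' W'] (j : H →ₗ[O] V) (D : V →ₗ[O] W) (j' : H' →ₗ[O'] V') (D' : V' →ₗ[O'] W')
    (hj : Function.Injective j) (hj' : Function.Injective j') (h : Function.Exact j D)
    (h' : Function.Exact j' D') {φ : H → H'} {φV : V → V'} {φW : W → W'}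
    (hV : IsExtension O O' φV) (hW : IsExtension O O' φW) (hφ : ∀ x, j' (φ x) = φV (j x))
    (hD : ∀ x, D' (φV x) = φW (D x)) : IsExtension O O' φ := by
  obtain ⟨θV, hθV, hθV'⟩ := hV
  obtain ⟨θW, hθW, hθW'⟩ := hW
  have hcomm' (z : O' ⊗[O] V) : D' (θV z) = θW (D.baseChange O' z) := by
    induction z with
    | zero => simp
    | add x y hx hy => simp only [map_add, hx, hy]
    | tmul c x =>
      have : c ⊗ₜ[O] x = c • ((1 : O') ⊗ₜ[O] x) := by rw [smul_tmul', smul_eq_mul, mul_one]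
      rw [this, map_smul, map_smul, map_smul, map_smul, LinearMap.baseChange_tmul, hθV', hθW', hD]
  have hex : Function.Exact (j.baseChange O') (D.baseChange O') := Module.Flat.lTensor_exact O' h
  have hinj : Function.Injective (j.baseChange O') :=
    Module.Flat.lTensor_preserves_injective_linearMap j hj
  have hker (z : O' ⊗[O] H) : θV (j.baseChange O' z) ∈ LinearMap.range j' := by
    refine (h' _).1 ?_
    rw [hcomm', hex.apply_apply_eq_zero, map_zero]
  let e := LinearEquiv.ofInjective j' hj'
  have he (x : LinearMap.range j') : j' (e.symm x) = x :=
    congrArg Subtype.val (e.apply_symm_apply x)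
  let θ : O' ⊗[O] H →ₗ[O'] H' := e.symm.toLinearMap ∘ₗ
    LinearMap.codRestrict _ (θV ∘ₗ j.baseChange O') hker
  have hθ (z : O' ⊗[O] H) : j' (θ z) = θV (j.baseChange O' z) := he _
  refine ⟨θ, ⟨fun x y hxy => ?_, fun y => ?_⟩, fun x => hj' ?_⟩
  · exact hinj (hθV.injective (by rw [← hθ, ← hθ, hxy]))
  · obtain ⟨v, hv⟩ := hθV.surjective (j' y)
    obtain ⟨x, rfl⟩ := (hex v).1 (hθW.injective (by
      rw [← hcomm', hv, h'.apply_apply_eq_zero, map_zero]))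
    exact ⟨x, hj' (by rw [hθ, hv])⟩
  · rw [hθ, hφ, LinearMap.baseChange_tmul, hθV']

theorem IsExtension.congr {H V H' V' : Type*} [AddCommGroup H] [Module O H] [AddCommGroup V]
    [Module O V] [AddCommGroup H'] [Module O' H'] [AddCommGroup V'] [Module O' V']
    (j : H ≃ₗ[O] V) (j' : H' ≃ₗ[O'] V') {φ : H → H'} {φV : V → V'} (hV : IsExtension O O' φV)
    (hφ : ∀ x, j' (φ x) = φV (j x)) : IsExtension O O' φ := by
  obtain ⟨θ, hθ, hθ'⟩ := hV
  refine ⟨j'.symm.toLinearMap ∘ₗ θ ∘ₗ j.toLinearMap.baseChange O', ?_, fun x => ?_⟩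
  · exact (j'.symm.bijective.comp hθ).comp (LinearEquiv.baseChange O O' _ _ j).bijective
  · simp [hθ', ← hφ]

theorem IsExtension.pi {ι : Type*} [Finite ι] {H H' : ι → Type*} [∀ i, AddCommGroup (H i)]
    [∀ i, Module O (H i)] [∀ i, AddCommGroup (H' i)] [∀ i, Module O' (H' i)]
    {φ : ∀ i, H i → H' i} (h : ∀ i, IsExtension O O' (φ i)) :
    IsExtension O O' (fun (f : ∀ i, H i) i => φ i (f i)) := by
  classical
  have := Fintype.ofFinite ι
  choose θ hθ hθ' using h
  refine ⟨LinearMap.pi (fun i => θ i ∘ₗ LinearMap.proj i) ∘ₗ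
    (TensorProduct.piRight O O' O' H).toLinearMap, ?_, fun x => ?_⟩
  · exact (Function.Bijective.piMap hθ).comp (TensorProduct.piRight O O' O' H).bijective
  · ext i
    simp [hθ']

/-- The restriction of a family to an index set outside which it has to vanish. -/
def piRestrictEquiv (R : Type*) [CommRing R] {ι : Type*} {H : ι → Type*}
    [∀ i, AddCommGroup (H i)] [∀ i, Module R (H i)] (s : Set ι)
    (hs : ∀ i ∉ s, Subsingleton (H i)) : (∀ i, H i) ≃ₗ[R] ∀ i : s, H i :=
  LinearEquiv.ofBijective (LinearMap.pi fun i : s => LinearMap.proj i.1) <| by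
    classical
    refine ⟨fun f g h => funext fun i => ?_, fun f => ⟨fun i => if hi : i ∈ s then f ⟨i, hi⟩ else 0, ?_⟩⟩
    · by_cases hi : i ∈ s
      · exact congrFun h ⟨i, hi⟩
      · exact @Subsingleton.elim _ (hs i hi) _ _
    · ext ⟨i, hi⟩
      simp [hi]

/-- Bounded complexes lead to products over all of ℤ. The factors outside a finite set vanish on
both sides, those of H' as images of O' ⊗ 0, so only a finite product has to commute with O' ⊗ -. -/
theorem IsExtension.pi_of_finite {ι : Type*} {H H' : ι → Type*} [∀ i, AddCommGroup (H i)]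
    [∀ i, Module O (H i)] [∀ i, AddCommGroup (H' i)] [∀ i, Module O' (H' i)]
    {φ : ∀ i, H i → H' i} (h : ∀ i, IsExtension O O' (φ i)) {s : Set ι} (hs : s.Finite)
    (hH : ∀ i ∉ s, Subsingleton (H i)) :
    IsExtension O O' (fun (f : ∀ i, H i) i => φ i (f i)) := by
  have : Finite s := hs
  have hH' (i) (hi : i ∉ s) : Subsingleton (H' i) := by
    obtain ⟨θ, hθ, -⟩ := h i
    have := hH i hi
    exact hθ.surjective.subsingleton
  exact IsExtension.congr (piRestrictEquiv O s hH) (piRestrictEquiv O' s hH')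
    (IsExtension.pi fun i : s => h i) fun f => rfl

theorem finite_pi_of_finite {ι : Type*} {H : ι → Type*} [∀ i, AddCommGroup (H i)]
    [∀ i, Module O (H i)] [∀ i, Module.Finite O (H i)] {s : Set ι} (hs : s.Finite)
    (hH : ∀ i ∉ s, Subsingleton (H i)) : Module.Finite O (∀ i, H i) :=
  have : Finite s := hs
  Module.Finite.equiv (piRestrictEquiv O s hH).symm

variable (O') in
-- For M finite free, Hom(M, N) is a finite power of N, and so is compatible with extension of
-- scalars.
theorem isExtension_baseChange {M N : Type*} [AddCommGroup M] [Module O M] [AddCommGroup N]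
    [Module O N] [Module.Finite O M] [Module.Free O M] :
    IsExtension O O' (LinearMap.baseChange O' : (M →ₗ[O] N) → _) := by
  have h := (TensorProduct.isBaseChange O M O').linearMapLeftRight
    (TensorProduct.isBaseChange O N O')
  refine ⟨h.equiv.toLinearMap, h.equiv.bijective, fun f => ?_⟩
  refine TensorProduct.AlgebraTensorModule.ext fun c x => ?_
  have : c ⊗ₜ[O] x = c • ((1 : O') ⊗ₜ[O] x) := by rw [smul_tmul', smul_eq_mul, mul_one]
  rw [this, map_smul, map_smul]
  congr 1
  change h.equiv _ _ = _
  rw [IsBaseChange.equiv_tmul, one_smul]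
  change IsBaseChange.linearMapLeftRightHom _ _ f (TensorProduct.mk O O' M 1 x) = _
  rw [IsBaseChange.linearMapLeftRightHom_comp_apply]
  rfl

/-- The linear map `f ↦ f S - T f`. -/
def commutator {R M N : Type*} [CommRing R] [AddCommGroup M] [Module R M] [AddCommGroup N]
    [Module R N] (S : M →ₗ[R] M) (T : N →ₗ[R] N) : (M →ₗ[R] N) →ₗ[R] M →ₗ[R] N where
  toFun f := f ∘ₗ S - T ∘ₗ f
  map_add' f g := by
    rw [LinearMap.add_comp, LinearMap.comp_add]
    abel
  map_smul' c f := by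
    rw [LinearMap.smul_comp, LinearMap.comp_smul, RingHom.id_apply, smul_sub]

/-- Linear maps intertwining two finite families of endomorphisms. -/
theorem IsExtension.intertwining [Module.Flat O O'] {ι M N H H' : Type*} [Finite ι]
    [AddCommGroup M]
    [Module O M] [AddCommGroup N] [Module O N] [Module.Finite O M] [Module.Free O M]
    [AddCommGroup H] [Module O H] [AddCommGroup H'] [Module O' H']
    (S : ι → Module.End O M) (T : ι → Module.End O N) (j : H →ₗ[O] M →ₗ[O] N)
    (j' : H' →ₗ[O'] O' ⊗[O] M →ₗ[O'] O' ⊗[O] N) (hj : Function.Injective j)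
    (hj' : Function.Injective j') (h : ∀ f, f ∈ Set.range j ↔ ∀ i, f ∘ₗ S i = T i ∘ₗ f)
    (h' : ∀ f, f ∈ Set.range j' ↔
      ∀ i, f ∘ₗ (S i).baseChange O' = (T i).baseChange O' ∘ₗ f) {φ : H → H'}
    (hφ : ∀ x, j' (φ x) = (j x).baseChange O') : IsExtension O O' φ := by
  -- The intertwining maps are the kernel of f ↦ (f Sᵢ - Tᵢ f)ᵢ. Finiteness of the family keeps the
  -- target a finite product.
  let D : (M →ₗ[O] N) →ₗ[O] ι → M →ₗ[O] N :=
    LinearMap.pi fun i => commutator (S i) (T i)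
  let D' : (O' ⊗[O] M →ₗ[O'] O' ⊗[O] N) →ₗ[O'] ι → O' ⊗[O] M →ₗ[O'] O' ⊗[O] N :=
    LinearMap.pi fun i => commutator ((S i).baseChange O') ((T i).baseChange O')
  refine IsExtension.of_exact j D j' D'
    hj hj' ?_ ?_ (φV := LinearMap.baseChange O')
    (φW := fun (f : ι → M →ₗ[O] N) i => LinearMap.baseChange O' (f i)) (isExtension_baseChange O')
    (IsExtension.pi (H := fun _ : ι => M →ₗ[O] N) (H' := fun _ : ι => O' ⊗[O] M →ₗ[O'] O' ⊗[O] N)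
      fun i : ι => isExtension_baseChange O') hφ ?_
  · intro f
    rw [h, funext_iff]
    exact forall_congr' fun i => sub_eq_zero
  · intro f
    rw [h', funext_iff]
    exact forall_congr' fun i => sub_eq_zero (a := f ∘ₗ (S i).baseChange O')
  · intro f
    ext i : 1
    change f.baseChange O' ∘ₗ (S i).baseChange O' - (T i).baseChange O' ∘ₗ f.baseChange O' =
      LinearMap.baseChange O' (f ∘ₗ S i - T i ∘ₗ f)
    rw [LinearMap.baseChange_sub, LinearMap.baseChange_comp, LinearMap.baseChange_comp]

end IsExtension

/-! ### Homomorphisms of modules given by actions -/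

section Actions

variable {O : Type u} [CommRing O] {Λ : Type u} [Ring Λ] [Algebra O Λ]

attribute [local instance] moduleO isScalarTowerO

instance linearModuleCat : Linear O (ModuleCat.{u} Λ) where
  homModule _ _ := inferInstance

theorem finite_hom [IsNoetherianRing O] [Module.Finite O Λ] (V W : ModuleCat.{u} Λ)
    [Module.Finite Λ V] [Module.Finite Λ W] : Module.Finite O (V ⟶ W) := by
  have := finiteO (O := O) V
  have := finiteO (O := O) W
  have := finite_linearMap O Λ V W
  exact Module.Finite.equiv ((ModuleCat.homLinearEquiv (S := O) (M := V) (N := W)).symm)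

variable {V W : Type u} [AddCommGroup V] [Module O V] [AddCommGroup W] [Module O W]

/-- The scalar action through Λ and the original one on V agree by `AlgHom.commutes`, but not
definitionally; this bridges the two structures. -/
theorem algebraMap_smul_ofAction (ρ : Λ →ₐ[O] Module.End O V) (c : O) (v : ofAction ρ) :
    c • v = (c • (show V from v) : V) := by
  change ρ (algebraMap O Λ c) _ = _
  rw [AlgHom.commutes]
  rfl

/-- The linear map underlying a homomorphism between modules given by actions. -/
def ofActionHomO (ρ : Λ →ₐ[O] Module.End O V) (σ : Λ →ₐ[O] Module.End O W) :
    (ofAction ρ ⟶ ofAction σ) →ₗ[O] V →ₗ[O] W where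
  toFun f :=
    { toFun := fun v => f.hom v
      map_add' := fun v w => f.hom.map_add v w
      map_smul' := fun c v => by
        have h := (homO (O := O) f).map_smul c (show ofAction ρ from v)
        rw [algebraMap_smul_ofAction] at h
        exact h.trans (algebraMap_smul_ofAction σ c _) }
  map_add' _ _ := rfl
  map_smul' c f := by
    ext v
    exact algebraMap_smul_ofAction σ c (f.hom v)

theorem ofActionHomO_injective (ρ : Λ →ₐ[O] Module.End O V) (σ : Λ →ₐ[O] Module.End O W) :
    Function.Injective (ofActionHomO ρ σ) := fun f g h => by
  ext v
  exact LinearMap.congr_fun h v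

theorem mem_range_ofActionHomO {ρ : Λ →ₐ[O] Module.End O V} {σ : Λ →ₐ[O] Module.End O W}
    (f : V →ₗ[O] W) : f ∈ Set.range (ofActionHomO ρ σ) ↔ ∀ a, f ∘ₗ ρ a = σ a ∘ₗ f := by
  constructor
  · rintro ⟨f, rfl⟩ a
    ext v
    exact f.hom.map_smul a v
  · intro h
    exact ⟨ofActionHom f fun a v => LinearMap.congr_fun (h a) v, rfl⟩

/-- Commuting with the action of a is an O-linear condition on a. For a finite algebra finitely many
conditions therefore suffice, as required by `IsExtension.intertwining`. -/
theorem intertwining_of_span {ρ : Λ →ₐ[O] Module.End O V} {σ : Λ →ₐ[O] Module.End O W}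
    {f : V →ₗ[O] W} {s : Set Λ} (hs : Submodule.span O s = ⊤) (h : ∀ a ∈ s, f ∘ₗ ρ a = σ a ∘ₗ f)
    (a : Λ) : f ∘ₗ ρ a = σ a ∘ₗ f := by
  have ha : a ∈ Submodule.span O s := hs ▸ Submodule.mem_top
  induction ha using Submodule.span_induction with
  | mem a ha => exact h a ha
  | zero => simp
  | add a b _ _ ha hb => rw [map_add, map_add, LinearMap.comp_add, LinearMap.add_comp, ha, hb]
  | smul c a _ ha => rw [map_smul, map_smul, LinearMap.comp_smul, LinearMap.smul_comp, ha]

end Actions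

/-! ### Bimodule homomorphisms under extension of scalars -/

section BimoduleHoms

variable {O : Type u} [CommRing O]
variable {A : Type u} [Ring A] [Algebra O A] {B : Type u} [Ring B] [Algebra O B]

attribute [local instance] moduleO isScalarTowerO

/-- The linear map underlying a homomorphism, as a linear map. -/
def homOLinear (M N : BimodCat O A B) : (M ⟶ N) →ₗ[O] M →ₗ[O] N where
  toFun f := homO f
  map_add' _ _ := rfl
  map_smul' _ _ := rfl

theorem homOLinear_injective (M N : BimodCat O A B) : Function.Injective (homOLinear M N) :=
  fun f g h => by
    ext v
    exact LinearMap.congr_fun h v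

theorem mem_range_homOLinear {M N : BimodCat O A B} (f : M →ₗ[O] N) :
    f ∈ Set.range (homOLinear M N) ↔ (∀ a, f ∘ₗ leftAct M a = leftAct N a ∘ₗ f) ∧
      ∀ b, f ∘ₗ rightAct M b = rightAct N b ∘ₗ f := by
  constructor
  · rintro ⟨f, rfl⟩
    exact ⟨fun a => LinearMap.ext fun v => homO_leftAct f a v,
      fun a => LinearMap.ext fun v => homO_rightAct f a v⟩
  · rintro ⟨hl, hr⟩
    refine ⟨ModuleCat.ofHom ⟨⟨f, map_add f⟩, fun x v => ?_⟩, rfl⟩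
    change f (x • v) = x • f v
    induction x with
    | zero =>
      exact (congrArg f (zero_smul (A ⊗[O] Bᵐᵒᵖ) v)).trans
        ((map_zero f).trans (zero_smul (A ⊗[O] Bᵐᵒᵖ) (f v)).symm)
    | add x y hx hy => rw [add_smul, add_smul, map_add, hx, hy]
    | tmul a b =>
      have h1 := LinearMap.congr_fun (hl a) (rightAct M b v)
      have h2 := LinearMap.congr_fun (hr b) v
      simp only [LinearMap.comp_apply] at h1 h2
      rw [smul_eq, smul_eq, h1, h2]

theorem mem_range_ofActionHomO_lift {V W : Type u} [AddCommGroup V] [Module O V] [AddCommGroup W]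
    [Module O W] {l : A →ₐ[O] Module.End O V} {r : Bᵐᵒᵖ →ₐ[O] Module.End O V}
    {h : ∀ a b, Commute (l a) (r b)} {l' : A →ₐ[O] Module.End O W}
    {r' : Bᵐᵒᵖ →ₐ[O] Module.End O W} {h' : ∀ a b, Commute (l' a) (r' b)} (f : V →ₗ[O] W) :
    f ∈ Set.range (ofActionHomO (Algebra.TensorProduct.lift l r h)
      (Algebra.TensorProduct.lift l' r' h')) ↔
      (∀ a, f ∘ₗ l a = l' a ∘ₗ f) ∧ ∀ b, f ∘ₗ r b = r' b ∘ₗ f := by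
  rw [mem_range_ofActionHomO]
  constructor
  · intro hf
    exact ⟨fun a => by simpa using hf (a ⊗ₜ 1), fun b => by simpa using hf (1 ⊗ₜ b)⟩
  · rintro ⟨hl, hr⟩ x
    induction x with
    | zero => simp
    | add x y hx hy => rw [map_add, map_add, LinearMap.comp_add, LinearMap.add_comp, hx, hy]
    | tmul a b =>
      rw [Algebra.TensorProduct.lift_tmul, Algebra.TensorProduct.lift_tmul, Module.End.mul_eq_comp,
        Module.End.mul_eq_comp, ← LinearMap.comp_assoc, hl, LinearMap.comp_assoc, hr,
        LinearMap.comp_assoc]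

variable (O' : Type u) [CommRing O'] [Algebra O O']

theorem baseChangeLeftAct_one_tmul (M : BimodCat O A B) (a : A) :
    baseChangeLeftAct O' M (1 ⊗ₜ a) = (leftAct M a).baseChange O' :=
  one_smul O' ((leftAct M a).baseChange O')

theorem baseChangeRightAct_one_tmul (M : BimodCat O A B) (b : B) :
    baseChangeRightAct O' M (op (1 ⊗ₜ b)) = (rightAct M (op b)).baseChange O' := by
  refine TensorProduct.AlgebraTensorModule.ext fun d m => ?_
  rw [baseChangeRightAct_tmul, one_mul, LinearMap.baseChange_tmul]

theorem span_one_tmul {A : Type u} [AddCommGroup A] [Module O A] {s : Set A}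
    (hs : Submodule.span O s = ⊤) :
    Submodule.span O' ((fun a => (1 : O') ⊗ₜ[O] a) '' s) = ⊤ := by
  rw [← Submodule.baseChange_top, ← hs, Submodule.baseChange_span]
  rfl

/-- A bimodule homomorphism is an O-linear map intertwining finitely many O-module generators of A
and of Bᵐᵒᵖ. The images 1 ⊗ a and 1 ⊗ b of these generators define the homomorphisms over O' by the
same equations. -/
theorem isExtension_baseChangeMap [Module.Flat O O'] [Module.Finite O A] [Module.Finite O B]
    (M N : BimodCat O A B)
    [Module.Finite O M] [Module.Free O M] :
    IsExtension O O' (fun f : M ⟶ N => baseChangeMap O' f) := by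
  obtain ⟨n, s, hs⟩ := Module.Finite.exists_fin (R := O) (M := A)
  obtain ⟨m, t, ht⟩ := Module.Finite.exists_fin (R := O) (M := Bᵐᵒᵖ)
  have comm {R V W Λ : Type u} [CommRing R] [Ring Λ] [Algebra R Λ] [AddCommGroup V] [Module R V]
      [AddCommGroup W] [Module R W] (ρ : Λ →ₐ[R] Module.End R V) (σ : Λ →ₐ[R] Module.End R W)
      (f : V →ₗ[R] W) (s : Set Λ) (hs : Submodule.span R s = ⊤) :
      (∀ a, f ∘ₗ ρ a = σ a ∘ₗ f) ↔ ∀ a ∈ s, f ∘ₗ ρ a = σ a ∘ₗ f :=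
    ⟨fun h a _ => h a, intertwining_of_span hs⟩
  refine IsExtension.intertwining (ι := Fin n ⊕ Fin m)
    (Sum.elim (fun i => leftAct M (s i)) (fun i => rightAct M (t i)))
    (Sum.elim (fun i => leftAct N (s i)) (fun i => rightAct N (t i)))
    (homOLinear M N) (ofActionHomO _ _) (homOLinear_injective M N) (ofActionHomO_injective _ _)
    (fun f => ?_) (fun f => ?_) (fun f => rfl)
  · rw [mem_range_homOLinear, comm (leftAct M) (leftAct N) f _ hs,
      comm (rightAct M) (rightAct N) f _ ht, Set.forall_mem_range, Set.forall_mem_range, Sum.forall]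
    rfl
  · have ht' : Submodule.span O' ((fun b : Bᵐᵒᵖ => op ((1 : O') ⊗ₜ[O] b.unop)) '' Set.range t) = ⊤ := by
      have ht2 : Submodule.span O (unop '' Set.range t) = ⊤ := by
        have := congrArg (Submodule.map (opLinearEquiv O (M := B)).symm.toLinearMap) ht
        rw [Submodule.map_span, Submodule.map_top, LinearMap.range_eq_top.2
          (opLinearEquiv O (M := B)).symm.surjective] at this
        exact this
      have := congrArg (Submodule.map (opLinearEquiv O' (M := O' ⊗[O] B)).toLinearMap)
        (span_one_tmul O' ht2)
      rw [Submodule.map_span, Submodule.map_top, LinearMap.range_eq_top.2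
          (opLinearEquiv O' (M := O' ⊗[O] B)).surjective, Set.image_image, Set.image_image] at this
      exact this
    refine (mem_range_ofActionHomO_lift f).trans ?_
    rw [comm _ _ f _ (span_one_tmul O' hs), comm _ _ f _ ht', Set.forall_mem_image, Set.forall_mem_image, Set.forall_mem_range,
      Set.forall_mem_range, Sum.forall]
    simp only [baseChangeLeftAct_one_tmul, baseChangeRightAct_one_tmul, op_unop, Sum.elim_inl,
      Sum.elim_inr]

end BimoduleHoms

/-! ### Homomorphisms of complexes -/

section ComplexHoms

variable {O : Type u} [CommRing O] {Λ : Type u} [Ring Λ] [Algebra O Λ]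

variable (O) in
/-- The components of a homomorphism of complexes. -/
def componentsLinear (X Y : CochainComplex (ModuleCat.{u} Λ) ℤ) :
    (X ⟶ Y) →ₗ[O] ∀ i, X.X i ⟶ Y.X i where
  toFun f := f.f
  map_add' _ _ := rfl
  map_smul' _ _ := rfl

theorem componentsLinear_injective (X Y : CochainComplex (ModuleCat.{u} Λ) ℤ) :
    Function.Injective (componentsLinear O X Y) :=
  fun _ _ h => HomologicalComplex.hom_ext _ _ fun i => congrFun h i

variable (O) in
/-- The obstruction for a family of maps to be a homomorphism of complexes. -/
def commDefect (X Y : CochainComplex (ModuleCat.{u} Λ) ℤ) :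
    (∀ i, X.X i ⟶ Y.X i) →ₗ[O] ∀ i, X.X i ⟶ Y.X (i + 1) where
  toFun f i := f i ≫ Y.d i (i + 1) - X.d i (i + 1) ≫ f (i + 1)
  map_add' f g := by
    ext i : 1
    simp only [Pi.add_apply, Preadditive.add_comp, Preadditive.comp_add]
    abel
  map_smul' c f := by
    ext i : 1
    simp only [Pi.smul_apply, Linear.smul_comp, Linear.comp_smul, RingHom.id_apply, smul_sub]

theorem exact_componentsLinear (X Y : CochainComplex (ModuleCat.{u} Λ) ℤ) :
    Function.Exact (componentsLinear O X Y) (commDefect O X Y) := by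
  intro f
  constructor
  · intro h
    refine ⟨{ f := f, comm' := ?_ }, rfl⟩
    rintro i _ rfl
    exact sub_eq_zero.1 (congrFun h i)
  · rintro ⟨f, rfl⟩
    ext i : 1
    exact sub_eq_zero.2 (f.comm i (i + 1))

theorem subsingleton_hom_of_isZero {C : Type*} [Category C] {X Y : C}
    (h : IsZero X) : Subsingleton (X ⟶ Y) := ⟨fun f g => h.eq_of_src f g⟩

theorem finite_complexHom [IsNoetherianRing O] [Module.Finite O Λ]
    (X Y : CochainComplex (ModuleCat.{u} Λ) ℤ) (hX : IsBounded X)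
    [∀ i, Module.Finite Λ (X.X i)] [∀ i, Module.Finite Λ (Y.X i)] : Module.Finite O (X ⟶ Y) := by
  have (i : ℤ) : Module.Finite O (X.X i ⟶ Y.X i) := finite_hom _ _
  have : Module.Finite O (∀ i, X.X i ⟶ Y.X i) := finite_pi_of_finite hX fun i hi =>
    subsingleton_hom_of_isZero (not_not.1 hi)
  have := isNoetherian_of_isNoetherianRing_of_finite O (∀ i, X.X i ⟶ Y.X i)
  exact Module.Finite.of_injective (componentsLinear O X Y) (componentsLinear_injective X Y)

attribute [local instance] moduleO isScalarTowerO

variable {A : Type u} [Ring A] [Algebra O A] {B : Type u} [Ring B] [Algebra O B]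
  (O' : Type u) [CommRing O'] [Algebra O O'] [Module.Flat O O'] [Module.Finite O A]
  [Module.Finite O B]

/-- Chain maps are the kernel of the commutation defect between products of Hom-modules, and
boundedness of X makes these products finite. -/
theorem isExtension_baseChangeComplexMap (X Y : CochainComplex (BimodCat O A B) ℤ)
    (hX : IsBounded X) [∀ i, Module.Finite O (X.X i)] [∀ i, Module.Free O (X.X i)] :
    IsExtension O O' (fun f : X ⟶ Y =>
      ((baseChangeFunctor O A B O').mapHomologicalComplex (ComplexShape.up ℤ)).map f) := by
  have sub (F : ℤ → BimodCat O A B) (i : ℤ) (hi : i ∉ {n | ¬ IsZero (X.X n)}) :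
      Subsingleton (X.X i ⟶ F i) := subsingleton_hom_of_isZero (not_not.1 hi)
  refine IsExtension.of_exact (componentsLinear O X Y) (commDefect O X Y)
    (componentsLinear O' (baseChangeComplex O' X) (baseChangeComplex O' Y))
    (commDefect O' (baseChangeComplex O' X) (baseChangeComplex O' Y))
    (componentsLinear_injective _ _) (componentsLinear_injective _ _) (exact_componentsLinear _ _)
    (exact_componentsLinear _ _)
    (IsExtension.pi_of_finite (fun i => isExtension_baseChangeMap O' (X.X i) (Y.X i)) hX
      (sub fun i => Y.X i))
    (IsExtension.pi_of_finite (fun i => isExtension_baseChangeMap O' (X.X i) (Y.X (i + 1))) hX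
      (sub fun i => Y.X (i + 1)))
    (fun f => rfl) fun f => ?_
  ext i : 1
  change (baseChangeFunctor O A B O').map _ ≫ (baseChangeFunctor O A B O').map _ -
    (baseChangeFunctor O A B O').map _ ≫ (baseChangeFunctor O A B O').map _ =
    (baseChangeFunctor O A B O').map (_ - _)
  rw [Functor.map_sub, Functor.map_comp, Functor.map_comp]

end ComplexHoms

section Constructions

variable {O : Type u} [CommRing O]
variable {A : Type u} [Ring A] [Algebra O A] {B : Type u} [Ring B] [Algebra O B]
variable {C : Type u} [Ring C] [Algebra O C]

attribute [local instance] moduleO isScalarTowerO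

/-! ### Constructing homomorphisms of bimodules -/

/-- An additive map commuting with left and right actions. -/
def homOfAdd {M N : BimodCat O A B} (f : M →+ N)
    (hl : ∀ a m, f (leftAct M a m) = leftAct N a (f m))
    (hr : ∀ b m, f (rightAct M (op b) m) = rightAct N (op b) (f m)) : M ⟶ N :=
  ModuleCat.ofHom
    { toFun := f
      map_add' := map_add f
      map_smul' := fun x m => by
        change f (x • m) = x • f m
        induction x with
        | zero =>
          exact (congrArg f (zero_smul (A ⊗[O] Bᵐᵒᵖ) m)).trans
            ((map_zero f).trans (zero_smul (A ⊗[O] Bᵐᵒᵖ) (f m)).symm)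
        | add x y hx hy => rw [add_smul, add_smul, map_add, hx, hy]
        | tmul a b =>
          obtain ⟨b, rfl⟩ := op_surjective b
          rw [smul_eq, smul_eq, hl, hr] }

/-- A bimodule homomorphism which is bijective is an isomorphism. -/
def isoOfBijective {Λ : Type u} [Ring Λ] {M N : ModuleCat.{u} Λ} (f : M ⟶ N)
    (hf : Function.Bijective f.hom) : M ≅ N :=
  (LinearEquiv.ofBijective f.hom hf).toModuleIso

theorem leftAct_ofActions {V : Type u} [AddCommGroup V] [Module O V] (l : A →ₐ[O] Module.End O V)
    (r : Bᵐᵒᵖ →ₐ[O] Module.End O V) (h : ∀ a b, Commute (l a) (r b)) (a : A)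
    (v : ofActions l r h) : leftAct (ofActions l r h) a v = (l a (show V from v) : V) := by
  change Algebra.TensorProduct.lift l r h (a ⊗ₜ 1) _ = _
  rw [Algebra.TensorProduct.lift_tmul, map_one, mul_one]

theorem rightAct_ofActions {V : Type u} [AddCommGroup V] [Module O V] (l : A →ₐ[O] Module.End O V)
    (r : Bᵐᵒᵖ →ₐ[O] Module.End O V) (h : ∀ a b, Commute (l a) (r b)) (b : Bᵐᵒᵖ)
    (v : ofActions l r h) : rightAct (ofActions l r h) b v = (r b (show V from v) : V) := by
  change Algebra.TensorProduct.lift l r h (1 ⊗ₜ b) _ = _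
  rw [Algebra.TensorProduct.lift_tmul, map_one, one_mul]

theorem leftAct_regular (a x : A) : leftAct (regular O A) a x = (a * x : A) :=
  leftAct_ofActions _ _ _ a (show regular O A from x)

theorem rightAct_regular (a x : A) : rightAct (regular O A) (op a) x = (x * a : A) :=
  rightAct_ofActions _ _ _ (op a) (show regular O A from x)

theorem leftAct_dual (M : BimodCat O A B) (b : B) (f : Module.Dual O M) :
    leftAct (dual M) b f = LinearMap.dualMap (rightAct M (op b)) f :=
  leftAct_ofActions _ _ _ b (show dual M from f)

theorem rightAct_dual (M : BimodCat O A B) (a : A) (f : Module.Dual O M) :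
    rightAct (dual M) (op a) f = LinearMap.dualMap (leftAct M a) f :=
  rightAct_ofActions _ _ _ (op a) (show dual M from f)

/-! ### Maps out of tensor products -/

theorem btmul_balanced {Λ : Type u} [Ring Λ] [Algebra O Λ] {M N : Type u} [AddCommGroup M]
    [Module O M] [AddCommGroup N] [Module O N] {r : Bᵐᵒᵖ →ₐ[O] Module.End O M}
    {l : B →ₐ[O] Module.End O N} {ρ : Λ →ₐ[O] Module.End O (M ⊗[O] N)} (m : M) (b : B) (n : N) :
    btmul r l ρ (r (op b) m) n = btmul r l ρ m (l b n) :=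
  (Submodule.Quotient.eq (balancedRel r l ρ)).2 (Submodule.subset_span ⟨m, b, n, rfl⟩)

/-- The class map `M ⊗[O] N → M ⊗_B N`. -/
def tensorMk (M : BimodCat O A B) (N : BimodCat O B C) : M ⊗[O] N →ₗ[O] tensor M N where
  toFun z := (balancedRel (rightAct M) (leftAct N) (outerAct M N)).mkQ z
  map_add' x y := map_add (balancedRel (rightAct M) (leftAct N) (outerAct M N)).mkQ x y
  map_smul' c x := by
    have := (balancedRel (rightAct M) (leftAct N) (outerAct M N)).mkQ.map_smul
      (algebraMap O (A ⊗[O] Cᵐᵒᵖ) c) x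
    exact (congrArg (balancedRel (rightAct M) (leftAct N) (outerAct M N)).mkQ
      (algebraMap_smul_ofAction (outerAct M N) c x).symm).trans this

/-- The class of `m ⊗ n` in `M ⊗_B N`. -/
def tmk (M : BimodCat O A B) (N : BimodCat O B C) (m : M) (n : N) : tensor M N :=
  btmul (rightAct M) (leftAct N) (outerAct M N) m n

theorem tensorMk_tmul (M : BimodCat O A B) (N : BimodCat O B C) (m : M) (n : N) :
    tensorMk M N (m ⊗ₜ n) = tmk M N m n := rfl

theorem tensor_induction {M : BimodCat O A B} {N : BimodCat O B C} {p : tensor M N → Prop}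
    (h0 : p 0) (ht : ∀ m n, p (tmk M N m n)) (ha : ∀ x y, p x → p y → p (x + y)) (z) : p z :=
  balanced_induction h0 ht ha z

theorem tmk_balanced (M : BimodCat O A B) (N : BimodCat O B C) (m : M) (b : B) (n : N) :
    tmk M N (rightAct M (op b) m) n = tmk M N m (leftAct N b n) :=
  btmul_balanced m b n

theorem leftAct_tmk (M : BimodCat O A B) (N : BimodCat O B C) (a : A) (m : M) (n : N) :
    leftAct (tensor M N) a (tmk M N m n) = tmk M N (leftAct M a m) n := by
  have h : outerAct M N (a ⊗ₜ 1) (m ⊗ₜ n) = leftAct M a m ⊗ₜ n := by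
    rw [outerAct_tmul, map_one]; rfl
  change tensorMk M N (outerAct M N (a ⊗ₜ 1) (m ⊗ₜ n)) = _
  rw [h]
  rfl

theorem rightAct_tmk (M : BimodCat O A B) (N : BimodCat O B C) (c : Cᵐᵒᵖ) (m : M) (n : N) :
    rightAct (tensor M N) c (tmk M N m n) = tmk M N m (rightAct N c n) := by
  have h : outerAct M N (1 ⊗ₜ c) (m ⊗ₜ n) = m ⊗ₜ rightAct N c n := by
    rw [outerAct_tmul, map_one]; rfl
  change tensorMk M N (outerAct M N (1 ⊗ₜ c) (m ⊗ₜ n)) = _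
  rw [h]
  rfl

theorem tmk_add_left (M : BimodCat O A B) (N : BimodCat O B C) (m m' : M) (n : N) :
    tmk M N (m + m') n = tmk M N m n + tmk M N m' n := btmul_add_left m m' n

theorem tmk_add_right (M : BimodCat O A B) (N : BimodCat O B C) (m : M) (n n' : N) :
    tmk M N m (n + n') = tmk M N m n + tmk M N m n' := btmul_add_right m n n'

theorem tmk_smul_left (M : BimodCat O A B) (N : BimodCat O B C) (c : O) (m : M) (n : N) :
    tmk M N (c • m) n = c • tmk M N m n := (tensorMk M N).map_smul c (m ⊗ₜ n)

theorem tmk_smul_right (M : BimodCat O A B) (N : BimodCat O B C) (c : O) (m : M) (n : N) :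
    tmk M N m (c • n) = c • tmk M N m n := by
  rw [← tmk_smul_left, ← tensorMk_tmul, ← tensorMk_tmul, TensorProduct.smul_tmul]

theorem leftAct_algebraMap (M : BimodCat O A B) (c : O) (m : M) :
    leftAct M (algebraMap O A c) m = c • m := by
  rw [AlgHom.commutes]; rfl

theorem rightAct_algebraMap (M : BimodCat O A B) (c : O) (m : M) :
    rightAct M (op (algebraMap O B c)) m = c • m := by
  change rightAct M (algebraMap O Bᵐᵒᵖ c) m = _
  rw [AlgHom.commutes]; rfl

section Lift

variable {Λ : Type u} [Ring Λ] [Algebra O Λ] {M N : Type u} [AddCommGroup M] [Module O M]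
  [AddCommGroup N] [Module O N] (r : Bᵐᵒᵖ →ₐ[O] Module.End O M) (l : B →ₐ[O] Module.End O N)
  (ρ : Λ →ₐ[O] Module.End O (M ⊗[O] N)) {G : Type*} [AddCommGroup G]

/-- A biadditive map which is balanced over `B` factors through `M ⊗_B N`. -/
def balancedLift
    (hρ : ∀ x m b n, ρ x (r (op b) m ⊗ₜ[O] n - m ⊗ₜ[O] l b n) ∈ AddSubgroup.closure
      {z | ∃ (m : M) (b : B) (n : N), z = r (op b) m ⊗ₜ[O] n - m ⊗ₜ[O] l b n})
    (f : M →+ N →+ G) (hb : ∀ m b n, f (r (op b) m) n = f m (l b n)) : balanced r l ρ →+ G :=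
  QuotientAddGroup.lift (balancedRel r l ρ).toAddSubgroup
    -- Balancedness over O is the special case b = c · 1 of balancedness over B.
    (TensorProduct.liftAddHom f fun c m n => by
      have h := hb m (algebraMap O B c) n
      have h1 : r (op (algebraMap O B c)) m = c • m := by
        change r (algebraMap O Bᵐᵒᵖ c) m = _
        rw [AlgHom.commutes]; rfl
      have h2 : l (algebraMap O B c) n = c • n := by rw [AlgHom.commutes]; rfl
      rwa [h1, h2] at h) <| by
    intro z hz
    -- By `hρ` the additive subgroup generated by the relations is stable under Λ, so it contains
    -- their Λ-span. Hence f needs to be additive only, without any Λ-linearity.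
    have hz' : (show M ⊗[O] N from z) ∈ AddSubgroup.closure
        {z | ∃ (m : M) (b : B) (n : N), z = r (op b) m ⊗ₜ[O] n - m ⊗ₜ[O] l b n} := by
      refine Submodule.span_induction (R := Λ) (M := ofAction ρ) (p := fun z _ => (show M ⊗[O] N from z) ∈
        AddSubgroup.closure
          {z | ∃ (m : M) (b : B) (n : N), z = r (op b) m ⊗ₜ[O] n - m ⊗ₜ[O] l b n})
        (fun z hz => AddSubgroup.subset_closure hz) (zero_mem _) (fun x y _ _ hx hy => add_mem hx hy)
        (fun a x _ hx => ?_) hz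
      change ρ a (show M ⊗[O] N from x) ∈ _
      refine AddSubgroup.closure_induction (p := fun z _ => ρ a z ∈ AddSubgroup.closure
          {z | ∃ (m : M) (b : B) (n : N), z = r (op b) m ⊗ₜ[O] n - m ⊗ₜ[O] l b n})
        ?_ ?_ ?_ ?_ hx
      · rintro _ ⟨m, b, n, rfl⟩
        exact hρ a m b n
      · rw [map_zero]; exact zero_mem _
      · intro x y _ _ hx hy
        rw [map_add]; exact add_mem hx hy
      · intro x _ hx
        rw [map_neg]; exact neg_mem hx
    refine AddSubgroup.closure_induction (p := fun z _ => TensorProduct.liftAddHom f _ z = 0)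
      ?_ ?_ ?_ ?_ hz'
    · rintro _ ⟨m, b, n, rfl⟩
      rw [map_sub, TensorProduct.liftAddHom_tmul, TensorProduct.liftAddHom_tmul, hb, sub_self]
    · exact map_zero _
    · intro x y _ _ hx hy
      rw [map_add, hx, hy, add_zero]
    · intro x _ hx
      rw [map_neg, hx, neg_zero]

end Lift

/-- A biadditive map which is balanced over `B` factors through `M ⊗_B N`. -/
def tensorLift {M : BimodCat O A B} {N : BimodCat O B C} {G : Type*} [AddCommGroup G]
    (f : M →+ N →+ G) (hb : ∀ m b n, f (rightAct M (op b) m) n = f m (leftAct N b n)) :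
    tensor M N →+ G :=
  balancedLift _ _ _ (fun x m b n => by
    induction x with
    | zero => rw [map_zero]; exact zero_mem _
    | add x y hx hy => rw [map_add]; exact add_mem hx hy
    | tmul a c =>
      refine AddSubgroup.subset_closure ⟨leftAct M a m, b, rightAct N c n, ?_⟩
      rw [map_sub, outerAct_tmul, outerAct_tmul]
      have h1 : leftAct M a (rightAct M (op b) m) = rightAct M (op b) (leftAct M a m) :=
        LinearMap.congr_fun (commute_act M a (op b)).eq m
      have h2 : rightAct N c (leftAct N b n) = leftAct N b (rightAct N c n) :=
        (LinearMap.congr_fun (commute_act N b c).eq n).symm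
      rw [h1, h2]) f hb

theorem tensorLift_tmk {M : BimodCat O A B} {N : BimodCat O B C} {G : Type*} [AddCommGroup G]
    (f : M →+ N →+ G) (hb) (m : M) (n : N) : tensorLift f hb (tmk M N m n) = f m n := rfl

/-- A biadditive map on `M × V` which is balanced over `B` factors through `M ⊗_B V`. -/
def tensorFunctorLift {M : BimodCat O A B} {V : ModuleCat.{u} B} {G : Type*} [AddCommGroup G]
    (f : M →+ V →+ G) (hb : ∀ m (b : B) v, f (rightAct M (op b) m) v = f m (b • v)) :
    (tensorFunctor M).obj V →+ G :=
  balancedLift _ _ _ (fun a m b v => by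
    refine AddSubgroup.subset_closure ⟨leftAct M a m, b, v, ?_⟩
    rw [map_sub]
    have h1 : leftAct M a (rightAct M (op b) m) = rightAct M (op b) (leftAct M a m) :=
      LinearMap.congr_fun (commute_act M a (op b)).eq m
    change leftAct M a (rightAct M (op b) m) ⊗ₜ[O] v - leftAct M a m ⊗ₜ[O] act (O := O) V b v = _
    rw [h1]) f hb

end Constructions

section BaseChange

variable {O : Type u} [CommRing O]
variable {A : Type u} [Ring A] [Algebra O A] {B : Type u} [Ring B] [Algebra O B]
variable {C : Type u} [Ring C] [Algebra O C]
variable (O' : Type u) [CommRing O'] [Algebra O O']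

attribute [local instance] moduleO isScalarTowerO

/-! ### Homomorphisms out of an extension of scalars -/

/-- The element `c ⊗ m` of `M'`. -/
def bmk (M : BimodCat O A B) (c : O') (m : M) : baseChange O' M := (c ⊗ₜ[O] m : O' ⊗[O] M)

variable {O'}

theorem leftAct_baseChange (M : BimodCat O A B) (x : O' ⊗[O] A) (z : O' ⊗[O] M) :
    leftAct (baseChange O' M) x z = baseChangeLeftAct O' M x z :=
  leftAct_ofActions _ _ _ x (show baseChange O' M from z)

theorem rightAct_baseChange (M : BimodCat O A B) (x : (O' ⊗[O] B)ᵐᵒᵖ) (z : O' ⊗[O] M) :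
    rightAct (baseChange O' M) x z = baseChangeRightAct O' M x z :=
  rightAct_ofActions _ _ _ x (show baseChange O' M from z)

theorem leftAct_bmk (M : BimodCat O A B) (c d : O') (a : A) (m : M) :
    leftAct (baseChange O' M) (c ⊗ₜ a) (bmk O' M d m) = bmk O' M (c * d) (leftAct M a m) := by
  unfold bmk
  rw [leftAct_baseChange]
  exact baseChangeLeftAct_tmul O' M c d a m

theorem rightAct_bmk (M : BimodCat O A B) (c d : O') (b : B) (m : M) :
    rightAct (baseChange O' M) (op (c ⊗ₜ b)) (bmk O' M d m) =
      bmk O' M (c * d) (rightAct M (op b) m) := by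
  unfold bmk
  rw [rightAct_baseChange]
  exact baseChangeRightAct_tmul O' M c d b m

theorem smul_bmk (M : BimodCat O A B) (c d : O') (m : M) :
    c • bmk O' M d m = bmk O' M (c * d) m :=
  (algebraMap_smul_ofAction _ c (bmk O' M d m)).trans
    ((TensorProduct.smul_tmul' c d m).trans rfl)

theorem bmk_add (M : BimodCat O A B) (c : O') (m n : M) :
    bmk O' M c (m + n) = bmk O' M c m + bmk O' M c n := TensorProduct.tmul_add c m n

theorem baseChange_induction {M : BimodCat O A B} {p : baseChange O' M → Prop} (h0 : p 0)
    (ht : ∀ c m, p (bmk O' M c m)) (ha : ∀ x y, p x → p y → p (x + y)) (z) : p z :=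
  TensorProduct.induction_on (motive := p) z h0 ht ha

/-- Two additive maps out of `M'` agree if they agree on the elements `c ⊗ m`. -/
theorem baseChange_add_hom_ext {M : BimodCat O A B} {G : Type*} [AddCommGroup G]
    {f g : baseChange O' M →+ G} (h : ∀ c m, f (bmk O' M c m) = g (bmk O' M c m)) : f = g := by
  ext z
  refine baseChange_induction (p := fun z => f z = g z) (by rw [map_zero, map_zero]) h
    (fun x y hx hy => by rw [map_add, map_add, hx, hy]) z

theorem homO_smul {Λ : Type u} [Ring Λ] [Algebra O Λ] {V W : ModuleCat.{u} Λ} (f : V ⟶ W) (c : O)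
    (v : V) : f.hom (c • v) = c • f.hom v := (homO (O := O) f).map_smul c v

theorem baseChange_hom_ext {M : BimodCat O A B} {N : BimodCat O' (O' ⊗[O] A) (O' ⊗[O] B)}
    {f g : baseChange O' M ⟶ N} (h : ∀ m, f.hom (bmk O' M 1 m) = g.hom (bmk O' M 1 m)) :
    f = g := by
  ext z
  refine baseChange_induction (p := fun z => f.hom z = g.hom z) (by rw [map_zero, map_zero])
    (fun c m => ?_) (fun x y hx hy => by rw [map_add, map_add, hx, hy]) z
  have : bmk O' M c m = c • bmk O' M 1 m := by rw [smul_bmk, mul_one]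
  rw [this, homO_smul, homO_smul, h]

theorem leftAct_smul (M : BimodCat O A B) (c : O) (a : A) (m : M) :
    leftAct M (c • a) m = c • leftAct M a m := by rw [map_smul]; rfl

theorem rightAct_smul (M : BimodCat O A B) (c : O) (b : Bᵐᵒᵖ) (m : M) :
    rightAct M (c • b) m = c • rightAct M b m := by rw [map_smul]; rfl

/-- Extension of scalars is left adjoint to restriction of scalars. -/
def baseChangeLift {M : BimodCat O A B} {N : BimodCat O' (O' ⊗[O] A) (O' ⊗[O] B)} (g : M →+ N)
    (hl : ∀ a m, g (leftAct M a m) = leftAct N (1 ⊗ₜ a) (g m))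
    (hr : ∀ b m, g (rightAct M (op b) m) = rightAct N (op (1 ⊗ₜ b)) (g m)) :
    baseChange O' M ⟶ N :=
  let f : O' ⊗[O] M →+ N := TensorProduct.liftAddHom
    { toFun := fun c => (DistribSMul.toAddMonoidHom N c).comp g
      map_zero' := by ext m; exact zero_smul O' (g m)
      map_add' := fun c d => by ext m; exact add_smul c d (g m) } fun r c m => by
        change (r • c) • g m = c • g (r • m)
        -- O-balancedness comes from left linearity alone: a scalar r acts on M as the element r of
        -- A, and 1 ⊗ r acts on N as the image of r in O'.
        have h1 : (1 : O') ⊗ₜ[O] algebraMap O A r = algebraMap O' (O' ⊗[O] A) (algebraMap O O' r) := by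
          rw [Algebra.TensorProduct.algebraMap_apply, Algebra.algebraMap_self, RingHom.id_apply,
            Algebra.algebraMap_eq_smul_one, Algebra.algebraMap_eq_smul_one, TensorProduct.smul_tmul]
        rw [← leftAct_algebraMap M, hl, h1, leftAct_algebraMap N, smul_smul, Algebra.smul_def,
          _root_.mul_comm]
  have hf (c : O') (m : M) : f (bmk O' M c m) = c • g m := rfl
  homOfAdd (M := baseChange O' M) f
    (fun x z => by
      refine baseChange_induction (p := fun z => f (leftAct (baseChange O' M) x z) =
        leftAct N x (f z)) ?_ (fun d m => ?_) (fun z z' hz hz' => ?_) z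
      · rw [map_zero]
        exact (map_zero f).trans (((congrArg (leftAct N x) (map_zero f)).trans (map_zero _)).symm)
      · induction x with
        | zero =>
          rw [map_zero, map_zero]
          exact map_zero f
        | add x y hx hy =>
          rw [map_add, map_add]
          exact (map_add f _ _).trans (congrArg₂ _ hx hy)
        | tmul c a =>
          have : c ⊗ₜ[O] a = c • ((1 : O') ⊗ₜ[O] a) := by rw [smul_tmul', smul_eq_mul, mul_one]
          rw [leftAct_bmk, hf, hf, hl, this, leftAct_smul, map_smul, mul_smul]
      · rw [map_add]
        refine (map_add f _ _).trans ?_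
        rw [hz, hz', ← map_add]
        exact congrArg _ (map_add f _ _).symm)
    (fun x z => by
      refine baseChange_induction (p := fun z => f (rightAct (baseChange O' M) (op x) z) =
        rightAct N (op x) (f z)) ?_ (fun d m => ?_) (fun z z' hz hz' => ?_) z
      · rw [map_zero]
        exact (map_zero f).trans (((congrArg (rightAct N (op x)) (map_zero f)).trans
          (map_zero _)).symm)
      · induction x with
        | zero =>
          rw [MulOpposite.op_zero, map_zero, map_zero]
          exact map_zero f
        | add x y hx hy =>
          rw [MulOpposite.op_add, map_add, map_add]
          exact (map_add f _ _).trans (congrArg₂ _ hx hy)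
        | tmul c a =>
          have : op (c ⊗ₜ[O] a) = c • op ((1 : O') ⊗ₜ[O] a) := by
            rw [← op_smul, smul_tmul', smul_eq_mul, mul_one]
          rw [rightAct_bmk, hf, hf, hr, this, rightAct_smul, map_smul, mul_smul]
      · rw [map_add]
        refine (map_add f _ _).trans ?_
        rw [hz, hz', ← map_add]
        exact congrArg _ (map_add f _ _).symm)

theorem baseChangeLift_bmk {M : BimodCat O A B} {N : BimodCat O' (O' ⊗[O] A) (O' ⊗[O] B)}
    (g : M →+ N) (hl hr) (c : O') (m : M) :
    (baseChangeLift g hl hr).hom (bmk O' M c m) = c • g m := rfl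

theorem baseChangeMap_bmk {M N : BimodCat O A B} (f : M ⟶ N) (c : O') (m : M) :
    (baseChangeMap O' f).hom (bmk O' M c m) = bmk O' N c (f.hom m) := rfl

/-! ### Extension of scalars and the regular bimodule -/

variable (O A) in
/-- The `O`-module underlying the regular bimodule. -/
def regularEquiv : regular O A ≃ₗ[O] A where
  toFun x := x
  invFun x := x
  map_add' _ _ := rfl
  map_smul' c x := algebraMap_smul_ofAction _ c x
  left_inv _ := rfl
  right_inv _ := rfl

variable (O' O A) in
/-- The extension of scalars of the regular bimodule, as an additive group. -/
def baseChangeRegularEquiv : baseChange O' (regular O A) ≃+ regular O' (O' ⊗[O] A) :=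
  (TensorProduct.congr (LinearEquiv.refl O O') (regularEquiv O A)).toAddEquiv

variable (O' O A) in
/-- The extension of scalars of the regular bimodule is the regular bimodule. -/
def baseChangeRegular : baseChange O' (regular O A) ≅ regular O' (O' ⊗[O] A) :=
  isoOfBijective (homOfAdd (baseChangeRegularEquiv O A O').toAddMonoidHom
      (fun x z => by
        change baseChangeRegularEquiv O A O' _ = leftAct _ _ (baseChangeRegularEquiv O A O' z)
        refine baseChange_induction (p := fun z =>
          baseChangeRegularEquiv O A O' (leftAct (baseChange O' (regular O A)) x z) =
            leftAct (regular O' (O' ⊗[O] A)) x (baseChangeRegularEquiv O A O' z))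
          ?_ (fun d m => ?_) (fun z z' hz hz' => ?_) z
        · rw [map_zero, map_zero, map_zero]
        · induction x with
          | zero => rw [map_zero, map_zero, LinearMap.zero_apply, LinearMap.zero_apply, map_zero]
          | add x y hx hy =>
            rw [map_add, map_add, LinearMap.add_apply, LinearMap.add_apply, map_add, hx, hy]
          | tmul c a =>
            rw [leftAct_bmk]
            refine (congrArg (fun y => baseChangeRegularEquiv O A O' (bmk O' _ (c * d) y))
              (leftAct_regular (O := O) a m)).trans ?_
            refine Eq.trans ?_ (leftAct_regular (O := O') (c ⊗ₜ[O] a) (d ⊗ₜ[O] m)).symm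
            exact (Algebra.TensorProduct.tmul_mul_tmul c d a m).symm
        · rw [map_add, map_add, map_add, map_add, hz, hz'])
      (fun x z => by
        change baseChangeRegularEquiv O A O' _ = rightAct _ _ (baseChangeRegularEquiv O A O' z)
        refine baseChange_induction (p := fun z =>
          baseChangeRegularEquiv O A O' (rightAct (baseChange O' (regular O A)) (op x) z) =
            rightAct (regular O' (O' ⊗[O] A)) (op x) (baseChangeRegularEquiv O A O' z))
          ?_ (fun d m => ?_) (fun z z' hz hz' => ?_) z
        · rw [map_zero, map_zero, map_zero]
        · induction x with
          | zero =>
            rw [MulOpposite.op_zero, map_zero, map_zero, LinearMap.zero_apply,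
              LinearMap.zero_apply, map_zero]
          | add x y hx hy =>
            rw [MulOpposite.op_add, map_add, map_add, LinearMap.add_apply, LinearMap.add_apply,
              map_add, hx, hy]
          | tmul c a =>
            rw [rightAct_bmk]
            refine (congrArg (fun y => baseChangeRegularEquiv O A O' (bmk O' _ (c * d) y))
              (rightAct_regular (O := O) a m)).trans ?_
            refine Eq.trans ?_ (rightAct_regular (O := O') (c ⊗ₜ[O] a) (d ⊗ₜ[O] m)).symm
            refine Eq.trans ?_ (Algebra.TensorProduct.tmul_mul_tmul d c (show A from m) a).symm
            rw [_root_.mul_comm d c]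
            rfl
        · rw [map_add, map_add, map_add, map_add, hz, hz']))
    (baseChangeRegularEquiv O A O').bijective

end BaseChange

section BaseChangeTensor

variable {O : Type u} [CommRing O]
variable {A : Type u} [Ring A] [Algebra O A] {B : Type u} [Ring B] [Algebra O B]
variable {C : Type u} [Ring C] [Algebra O C]
variable (O' : Type u) [CommRing O'] [Algebra O O']

attribute [local instance] moduleO isScalarTowerO

/-! ### Extension of scalars and tensor products -/

/-- The biadditive map `(c ⊗ m, d ⊗ n) ↦ c d ⊗ (m ⊗ n)`. -/
def baseChangeTensorBilin (M : BimodCat O A B) (N : BimodCat O B C) :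
    baseChange O' M →+ baseChange O' N →+ baseChange O' (tensor M N) :=
  let L : O' ⊗[O] M →ₗ[O] O' ⊗[O] N →ₗ[O] O' ⊗[O] tensor M N :=
    -- Interchange the middle factors of (O' ⊗ M) ⊗ (O' ⊗ N), then multiply in O' and project to M
    -- ⊗_B N.
    TensorProduct.curry ((TensorProduct.map (LinearMap.mul' O O') (tensorMk M N)) ∘ₗ
      (TensorProduct.tensorTensorTensorComm O O' M O' N).toLinearMap)
  (LinearMap.toAddMonoidHom'.comp L.toAddMonoidHom : O' ⊗[O] M →+ O' ⊗[O] N →+ O' ⊗[O] tensor M N)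

variable {O'}

theorem baseChangeTensorBilin_bmk (M : BimodCat O A B) (N : BimodCat O B C) (c d : O') (m : M)
    (n : N) : baseChangeTensorBilin O' M N (bmk O' M c m) (bmk O' N d n) =
      bmk O' (tensor M N) (c * d) (tmk M N m n) := rfl

/-- Induction on a pair of elements of `M'` and `N'`. -/
theorem baseChange_biadd_induction {M : BimodCat O A B} {N : BimodCat O B C}
    {p : baseChange O' M → baseChange O' N → Prop} (h0 : ∀ w, p 0 w) (h0' : ∀ z, p z 0)
    (ha : ∀ z z' w, p z w → p z' w → p (z + z') w)
    (ha' : ∀ z w w', p z w → p z w' → p z (w + w'))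
    (h : ∀ c m d n, p (bmk O' M c m) (bmk O' N d n)) (z w) : p z w :=
  baseChange_induction (p := fun z => p z w) (h0 w)
    (fun c m => baseChange_induction (p := fun w => p (bmk O' M c m) w) (h0' _) (fun d n => h c m d n)
      (fun _ _ => ha' _ _ _) w) (fun _ _ => ha _ _ _) z

theorem baseChangeTensorBilin_balanced (M : BimodCat O A B) (N : BimodCat O B C)
    (z : baseChange O' M) (x : O' ⊗[O] B) (w : baseChange O' N) :
    baseChangeTensorBilin O' M N (rightAct (baseChange O' M) (op x) z) w =
      baseChangeTensorBilin O' M N z (leftAct (baseChange O' N) x w) := by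
  induction x with
  | zero =>
    rw [MulOpposite.op_zero, map_zero, map_zero, LinearMap.zero_apply, LinearMap.zero_apply,
      map_zero, map_zero]
    rfl
  | add x y hx hy =>
    rw [MulOpposite.op_add, map_add, map_add, LinearMap.add_apply, LinearMap.add_apply, map_add,
      map_add, AddMonoidHom.add_apply, hx, hy]
  | tmul e b =>
    refine baseChange_biadd_induction (p := fun z w =>
      baseChangeTensorBilin O' M N (rightAct (baseChange O' M) (op (e ⊗ₜ b)) z) w =
      baseChangeTensorBilin O' M N z (leftAct (baseChange O' N) (e ⊗ₜ b) w))
      (fun w => ?_) (fun z => ?_) (fun z z' w h h' => ?_) (fun z w w' h h' => ?_)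
      (fun c m d n => ?_) z w
    · rw [map_zero, map_zero]; rfl
    · rw [map_zero, map_zero, map_zero]
    · rw [map_add, map_add, map_add, AddMonoidHom.add_apply, AddMonoidHom.add_apply, h, h']
    · rw [map_add, map_add, map_add, h, h']
    · rw [rightAct_bmk, leftAct_bmk, baseChangeTensorBilin_bmk, baseChangeTensorBilin_bmk,
        tmk_balanced]
      congr 1
      ring

theorem baseChangeTensorBilin_leftAct (M : BimodCat O A B) (N : BimodCat O B C)
    (x : O' ⊗[O] A) (z : baseChange O' M) (w : baseChange O' N) :
    baseChangeTensorBilin O' M N (leftAct (baseChange O' M) x z) w =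
      leftAct (baseChange O' (tensor M N)) x (baseChangeTensorBilin O' M N z w) := by
  induction x with
  | zero =>
    rw [map_zero, map_zero, LinearMap.zero_apply, LinearMap.zero_apply, map_zero]
    rfl
  | add x y hx hy =>
    rw [map_add, map_add, LinearMap.add_apply, LinearMap.add_apply, map_add,
      AddMonoidHom.add_apply, hx, hy]
  | tmul e a =>
    refine baseChange_biadd_induction (p := fun z w =>
      baseChangeTensorBilin O' M N (leftAct (baseChange O' M) (e ⊗ₜ a) z) w =
      leftAct (baseChange O' (tensor M N)) (e ⊗ₜ a) (baseChangeTensorBilin O' M N z w))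
      (fun w => ?_) (fun z => ?_) (fun z z' w h h' => ?_) (fun z w w' h h' => ?_)
      (fun c m d n => ?_) z w
    · rw [map_zero, map_zero, AddMonoidHom.zero_apply, map_zero]
    · rw [map_zero, map_zero, map_zero]
    · rw [map_add, map_add, map_add, AddMonoidHom.add_apply, AddMonoidHom.add_apply, h, h', map_add]
    · rw [map_add, map_add, map_add, h, h']
    · rw [leftAct_bmk, baseChangeTensorBilin_bmk, baseChangeTensorBilin_bmk, leftAct_bmk,
        leftAct_tmk, mul_assoc]

theorem baseChangeTensorBilin_rightAct (M : BimodCat O A B) (N : BimodCat O B C)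
    (x : O' ⊗[O] C) (z : baseChange O' M) (w : baseChange O' N) :
    baseChangeTensorBilin O' M N z (rightAct (baseChange O' N) (op x) w) =
      rightAct (baseChange O' (tensor M N)) (op x) (baseChangeTensorBilin O' M N z w) := by
  induction x with
  | zero =>
    rw [MulOpposite.op_zero, map_zero, map_zero, LinearMap.zero_apply, LinearMap.zero_apply,
      map_zero]
  | add x y hx hy =>
    rw [MulOpposite.op_add, map_add, map_add, LinearMap.add_apply, LinearMap.add_apply,
      map_add, hx, hy]
  | tmul e a =>
    refine baseChange_biadd_induction (p := fun z w =>
      baseChangeTensorBilin O' M N z (rightAct (baseChange O' N) (op (e ⊗ₜ a)) w) =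
      rightAct (baseChange O' (tensor M N)) (op (e ⊗ₜ a)) (baseChangeTensorBilin O' M N z w))
      (fun w => ?_) (fun z => ?_) (fun z z' w h h' => ?_) (fun z w w' h h' => ?_)
      (fun c m d n => ?_) z w
    · rw [map_zero, AddMonoidHom.zero_apply, AddMonoidHom.zero_apply, map_zero]
    · rw [map_zero, map_zero, map_zero]
    · rw [map_add, AddMonoidHom.add_apply, AddMonoidHom.add_apply, h, h', map_add]
    · rw [map_add, map_add, map_add, map_add, h, h']
    · rw [rightAct_bmk, baseChangeTensorBilin_bmk, baseChangeTensorBilin_bmk, rightAct_bmk,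
        rightAct_tmk]
      congr 1
      ring

/-- The homomorphism out of `M ⊗_B N` given by a biadditive map. -/
def tensorHomLift {M : BimodCat O A B} {N : BimodCat O B C} {P : BimodCat O A C}
    (f : M →+ N →+ P) (hb : ∀ m b n, f (rightAct M (op b) m) n = f m (leftAct N b n))
    (hl : ∀ a m n, f (leftAct M a m) n = leftAct P a (f m n))
    (hr : ∀ c m n, f m (rightAct N (op c) n) = rightAct P (op c) (f m n)) : tensor M N ⟶ P :=
  homOfAdd (tensorLift f hb)
    (fun a z => by
      refine tensor_induction (p := fun z => tensorLift f hb (leftAct _ a z) =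
        leftAct _ a (tensorLift f hb z)) ?_ ?_ ?_ z
      · rw [map_zero, map_zero, map_zero]
      · intro m n
        rw [leftAct_tmk, tensorLift_tmk, tensorLift_tmk, hl]
      · intro x y hx hy
        rw [map_add, map_add, map_add, map_add, hx, hy])
    (fun a z => by
      refine tensor_induction (p := fun z => tensorLift f hb (rightAct _ (op a) z) =
        rightAct _ (op a) (tensorLift f hb z)) ?_ ?_ ?_ z
      · rw [map_zero, map_zero, map_zero]
      · intro m n
        rw [rightAct_tmk, tensorLift_tmk, tensorLift_tmk, hr]
      · intro x y hx hy
        rw [map_add, map_add, map_add, map_add, hx, hy])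

/-- The universal biadditive map `M × N → M ⊗_B N`. -/
def tmkHom (M : BimodCat O A B) (N : BimodCat O B C) : M →+ N →+ tensor M N :=
  AddMonoidHom.mk' (fun m => AddMonoidHom.mk' (tmk M N m) (tmk_add_right M N m))
    fun m m' => AddMonoidHom.ext fun n => tmk_add_left M N m m' n

theorem tmkHom_apply (M : BimodCat O A B) (N : BimodCat O B C) (m : M) (n : N) :
    tmkHom M N m n = tmk M N m n := rfl

variable (O') in
/-- The additive map `m ↦ 1 ⊗ m`. -/
def bmkHom (M : BimodCat O A B) : M →+ baseChange O' M :=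
  AddMonoidHom.mk' (bmk O' M 1) (bmk_add M 1)

theorem bmkHom_apply (M : BimodCat O A B) (m : M) : bmkHom O' M m = bmk O' M 1 m := rfl

theorem bmkHom_leftAct (M : BimodCat O A B) (a : A) (m : M) :
    bmkHom O' M (leftAct M a m) = leftAct (baseChange O' M) (1 ⊗ₜ a) (bmkHom O' M m) := by
  rw [bmkHom_apply, bmkHom_apply, leftAct_bmk, mul_one]

theorem bmkHom_rightAct (M : BimodCat O A B) (b : B) (m : M) :
    bmkHom O' M (rightAct M (op b) m) =
      rightAct (baseChange O' M) (op (1 ⊗ₜ b)) (bmkHom O' M m) := by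
  rw [bmkHom_apply, bmkHom_apply, rightAct_bmk, mul_one]

variable (O') in
/-- The homomorphism `M' ⊗_B' N' → (M ⊗_B N)'`. -/
def tensorBaseChangeHom (M : BimodCat O A B) (N : BimodCat O B C) :
    tensor (baseChange O' M) (baseChange O' N) ⟶ baseChange O' (tensor M N) :=
  tensorHomLift (baseChangeTensorBilin O' M N) (baseChangeTensorBilin_balanced M N)
    (baseChangeTensorBilin_leftAct M N) (baseChangeTensorBilin_rightAct M N)

theorem tensorBaseChangeHom_tmk (M : BimodCat O A B) (N : BimodCat O B C) (c d : O') (m : M)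
    (n : N) : (tensorBaseChangeHom O' M N).hom (tmk _ _ (bmk O' M c m) (bmk O' N d n)) =
      bmk O' (tensor M N) (c * d) (tmk M N m n) := rfl

variable (O') in
/-- The biadditive map `(m, n) ↦ (1 ⊗ m) ⊗ (1 ⊗ n)`. -/
def tmkBaseChange (M : BimodCat O A B) (N : BimodCat O B C) :
    M →+ N →+ tensor (baseChange O' M) (baseChange O' N) :=
  ((tmkHom (baseChange O' M) (baseChange O' N)).comp (bmkHom O' M)).compl₂ (bmkHom O' N)

theorem tmkBaseChange_apply (M : BimodCat O A B) (N : BimodCat O B C) (m : M) (n : N) :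
    tmkBaseChange O' M N m n = tmk _ _ (bmkHom O' M m) (bmkHom O' N n) := rfl

theorem tmkBaseChange_balanced (M : BimodCat O A B) (N : BimodCat O B C) (m : M) (b : B) (n : N) :
    tmkBaseChange O' M N (rightAct M (op b) m) n = tmkBaseChange O' M N m (leftAct N b n) := by
  rw [tmkBaseChange_apply, tmkBaseChange_apply, bmkHom_rightAct, bmkHom_leftAct, tmk_balanced]

variable (O') in
/-- The homomorphism `(M ⊗_B N)' → M' ⊗_B' N'`. -/
def tensorBaseChangeInv (M : BimodCat O A B) (N : BimodCat O B C) :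
    baseChange O' (tensor M N) ⟶ tensor (baseChange O' M) (baseChange O' N) :=
  baseChangeLift (tensorLift (tmkBaseChange O' M N) (tmkBaseChange_balanced M N))
    (fun a z => by
      refine tensor_induction (p := fun z =>
        tensorLift (tmkBaseChange O' M N) (tmkBaseChange_balanced M N) (leftAct _ a z) =
        leftAct _ (1 ⊗ₜ a) (tensorLift (tmkBaseChange O' M N) (tmkBaseChange_balanced M N) z))
        ?_ ?_ ?_ z
      · rw [map_zero, map_zero, map_zero]
      · intro m n
        rw [leftAct_tmk, tensorLift_tmk, tensorLift_tmk, tmkBaseChange_apply, bmkHom_leftAct,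
          tmkBaseChange_apply, leftAct_tmk]
      · intro x y hx hy
        rw [map_add, map_add, map_add, map_add, hx, hy])
    (fun a z => by
      refine tensor_induction (p := fun z =>
        tensorLift (tmkBaseChange O' M N) (tmkBaseChange_balanced M N) (rightAct _ (op a) z) =
        rightAct _ (op (1 ⊗ₜ a))
          (tensorLift (tmkBaseChange O' M N) (tmkBaseChange_balanced M N) z)) ?_ ?_ ?_ z
      · rw [map_zero, map_zero, map_zero]
      · intro m n
        rw [rightAct_tmk, tensorLift_tmk, tensorLift_tmk, tmkBaseChange_apply, bmkHom_rightAct,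
          tmkBaseChange_apply, rightAct_tmk]
      · intro x y hx hy
        rw [map_add, map_add, map_add, map_add, hx, hy])

theorem tensorBaseChangeInv_bmk (M : BimodCat O A B) (N : BimodCat O B C) (c : O') (m : M)
    (n : N) : (tensorBaseChangeInv O' M N).hom (bmk O' (tensor M N) c (tmk M N m n)) =
      c • tmk _ _ (bmk O' M 1 m) (bmk O' N 1 n) := rfl

/-- Two homomorphisms out of `(M ⊗_B N)'` agree if they agree on the elements `1 ⊗ (m ⊗ n)`. -/
theorem baseChange_tensor_hom_ext {M : BimodCat O A B} {N : BimodCat O B C}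
    {P : BimodCat O' (O' ⊗[O] A) (O' ⊗[O] C)} {f g : baseChange O' (tensor M N) ⟶ P}
    (h : ∀ m n, f.hom (bmk O' (tensor M N) 1 (tmk M N m n)) =
      g.hom (bmk O' (tensor M N) 1 (tmk M N m n))) : f = g := by
  refine baseChange_hom_ext fun z => ?_
  refine tensor_induction (p := fun z => f.hom (bmk O' (tensor M N) 1 z) =
      g.hom (bmk O' (tensor M N) 1 z)) ?_ h ?_ z
  · have : bmk O' (tensor M N) 1 0 = 0 := TensorProduct.tmul_zero _ _
    rw [this, map_zero, map_zero]
  · intro x y hx hy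
    rw [bmk_add, map_add, map_add, hx, hy]

variable (O') in
/-- Extension of scalars commutes with tensor products. -/
def tensorBaseChange (M : BimodCat O A B) (N : BimodCat O B C) :
    tensor (baseChange O' M) (baseChange O' N) ≅ baseChange O' (tensor M N) where
  hom := tensorBaseChangeHom O' M N
  inv := tensorBaseChangeInv O' M N
  hom_inv_id := by
    refine balanced_hom_ext fun z w => ?_
    change (tensorBaseChangeInv O' M N).hom ((tensorBaseChangeHom O' M N).hom (tmk _ _ z w)) = tmk _ _ z w
    simp only [← tmkHom_apply]
    refine baseChange_biadd_induction (p := fun z w => (tensorBaseChangeInv O' M N).hom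
      ((tensorBaseChangeHom O' M N).hom (tmkHom _ _ z w)) = tmkHom _ _ z w)
      (fun w => ?_) (fun z => ?_) (fun z z' w h h' => ?_) (fun z w w' h h' => ?_)
      (fun c m d n => ?_) z w
    · rw [map_zero, AddMonoidHom.zero_apply, map_zero, map_zero]
    · rw [map_zero, map_zero, map_zero]
    · rw [map_add, AddMonoidHom.add_apply, map_add, map_add, h, h']
    · rw [map_add, map_add, map_add, h, h']
    rw [tmkHom_apply]
    rw [tensorBaseChangeHom_tmk, tensorBaseChangeInv_bmk]
    have h1 : bmk O' M c m = c • bmk O' M 1 m := by rw [smul_bmk, mul_one]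
    have h2 : bmk O' N d n = d • bmk O' N 1 n := by rw [smul_bmk, mul_one]
    rw [h1, h2, tmk_smul_left, tmk_smul_right, mul_smul]
  inv_hom_id := by
    refine baseChange_tensor_hom_ext fun m n => ?_
    change (tensorBaseChangeHom O' M N).hom ((tensorBaseChangeInv O' M N).hom
      (bmk O' (tensor M N) 1 (tmk M N m n))) = bmk O' (tensor M N) 1 (tmk M N m n)
    rw [tensorBaseChangeInv_bmk, one_smul, tensorBaseChangeHom_tmk, mul_one]

theorem tensorBaseChange_naturality {M M₁ : BimodCat O A B} {N N₁ : BimodCat O B C} (f : M ⟶ M₁)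
    (g : N ⟶ N₁) : tensorMap (baseChangeMap O' f) (baseChangeMap O' g) ≫
      (tensorBaseChange O' M₁ N₁).hom =
      (tensorBaseChange O' M N).hom ≫ baseChangeMap O' (tensorMap f g) := by
  -- Passing to inverses turns the source into (M ⊗_B N)', where it is enough to test elements 1 ⊗
  -- (m ⊗ n).
  rw [← Iso.inv_comp_eq, ← Category.assoc, ← Iso.eq_comp_inv]
  refine baseChange_tensor_hom_ext fun m n => ?_
  change (tensorMap (baseChangeMap O' f) (baseChangeMap O' g)).hom
    ((tensorBaseChangeInv O' M N).hom (bmk O' (tensor M N) 1 (tmk M N m n))) =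
    (tensorBaseChangeInv O' M₁ N₁).hom
      ((baseChangeMap O' (tensorMap f g)).hom (bmk O' (tensor M N) 1 (tmk M N m n)))
  rw [tensorBaseChangeInv_bmk, baseChangeMap_bmk, one_smul]
  change _ = (tensorBaseChangeInv O' M₁ N₁).hom (bmk O' (tensor M₁ N₁) 1 (tmk M₁ N₁ (f.hom m) (g.hom n)))
  rw [tensorBaseChangeInv_bmk, one_smul]
  rfl

end BaseChangeTensor

section BaseChangeDual

variable {O : Type u} [CommRing O]
variable {A : Type u} [Ring A] [Algebra O A] {B : Type u} [Ring B] [Algebra O B]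
variable {O' : Type u} [CommRing O'] [Algebra O O']

attribute [local instance] moduleO isScalarTowerO

/-! ### Extension of scalars and duals -/

/-- The `O`-module underlying the dual of a bimodule. -/
def dualEquiv (M : BimodCat O A B) : dual M ≃ₗ[O] Module.Dual O M where
  toFun x := x
  invFun x := x
  map_add' _ _ := rfl
  map_smul' c x := algebraMap_smul_ofAction _ c x
  left_inv _ := rfl
  right_inv _ := rfl

/-- The `O'`-module underlying an extension of scalars. -/
def baseChangeEquiv (M : BimodCat O A B) : baseChange O' M ≃ₗ[O'] O' ⊗[O] M where
  toFun x := x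
  invFun x := x
  map_add' _ _ := rfl
  map_smul' c x := algebraMap_smul_ofAction _ c x
  left_inv _ := rfl
  right_inv _ := rfl

theorem dual_ext {M : BimodCat O A B} {f g : dual M} (h : ∀ m, dualEquiv M f m = dualEquiv M g m) :
    f = g := LinearMap.ext h

/-- An element of `(M')^∨` is determined by its values on `1 ⊗ m`. -/
theorem dual_baseChange_ext {M : BimodCat O A B} {f g : dual (baseChange O' M)}
    (h : ∀ m, dualEquiv _ f (bmk O' M 1 m) = dualEquiv _ g (bmk O' M 1 m)) : f = g := by
  refine dual_ext fun z => ?_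
  refine baseChange_induction (p := fun z => dualEquiv _ f z = dualEquiv _ g z)
    (by rw [map_zero, map_zero]) (fun c m => ?_)
    (fun x y hx hy => by rw [map_add, map_add, hx, hy]) z
  have : bmk O' M c m = c • bmk O' M 1 m := by rw [smul_bmk, mul_one]
  rw [this, map_smul, map_smul, h]

theorem dualEquiv_leftAct (M : BimodCat O A B) (b : B) (f : dual M) (m : M) :
    dualEquiv M (leftAct (dual M) b f) m = dualEquiv M f (rightAct M (op b) m) := by
  have := leftAct_dual M b (dualEquiv M f)
  exact LinearMap.congr_fun this m

theorem dualEquiv_rightAct (M : BimodCat O A B) (a : A) (f : dual M) (m : M) :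
    dualEquiv M (rightAct (dual M) (op a) f) m = dualEquiv M f (leftAct M a m) := by
  have := rightAct_dual M a (dualEquiv M f)
  exact LinearMap.congr_fun this m

variable (O') in
/-- The additive map `M^∨ → (M')^∨`. -/
def dualBaseChangeAdd (M : BimodCat O A B) : dual M →+ dual (baseChange O' M) :=
  AddMonoidHom.mk' (fun f => (dualEquiv (baseChange O' M)).symm
      (((Algebra.linearMap O O' ∘ₗ dualEquiv M f).liftBaseChange O') ∘ₗ
        (baseChangeEquiv M).toLinearMap))
    fun f g => by
      rw [map_add, LinearMap.comp_add, ← map_add]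
      congr 1
      rw [← LinearMap.add_comp]
      congr 1
      exact map_add (LinearMap.liftBaseChangeEquiv O') _ _

theorem dualBaseChangeAdd_bmk (M : BimodCat O A B) (f : dual M) (c : O') (m : M) :
    dualEquiv _ (dualBaseChangeAdd O' M f) (bmk O' M c m) =
      c * algebraMap O O' (dualEquiv M f m) := rfl

variable (O') in
/-- The homomorphism `(M^∨)' → (M')^∨`. -/
def dualBaseChangeHom (M : BimodCat O A B) :
    baseChange O' (dual M) ⟶ dual (baseChange O' M) :=
  baseChangeLift (dualBaseChangeAdd O' M)
    (fun b f => by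
      refine dual_baseChange_ext fun m => ?_
      rw [dualEquiv_leftAct, rightAct_bmk, dualBaseChangeAdd_bmk, dualBaseChangeAdd_bmk,
        dualEquiv_leftAct, mul_one])
    (fun a f => by
      refine dual_baseChange_ext fun m => ?_
      rw [dualEquiv_rightAct, leftAct_bmk, dualBaseChangeAdd_bmk, dualBaseChangeAdd_bmk,
        dualEquiv_rightAct, mul_one])

theorem dualBaseChangeHom_bmk (M : BimodCat O A B) (c : O') (f : dual M) :
    (dualBaseChangeHom O' M).hom (bmk O' (dual M) c f) = c • dualBaseChangeAdd O' M f := rfl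

/-- For M finite free this is the isomorphism O' ⊗ Hom(M, O) ≅ Hom(O' ⊗ M, O' ⊗ O), followed by O' ⊗
O ≅ O'. The composite F is bijective and agrees with the explicit homomorphism on the elements c ⊗
f. -/
theorem dualBaseChangeHom_bijective (M : BimodCat O A B) [Module.Finite O M] [Module.Free O M] :
    Function.Bijective (dualBaseChangeHom O' M).hom := by
  obtain ⟨θ, hθ, hθ'⟩ := isExtension_baseChange (O := O) O' (M := M) (N := O)
  let e : (O' ⊗[O] M →ₗ[O'] O' ⊗[O] O) ≃ₗ[O'] dual (baseChange O' M) :=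
    (LinearEquiv.congrRight (TensorProduct.AlgebraTensorModule.rid O O' O')).trans
      (((baseChangeEquiv M).symm.congrLeft O' O').trans
      (dualEquiv (baseChange O' M)).symm)
  let F : baseChange O' (dual M) →+ dual (baseChange O' M) :=
    ((e.toLinearMap ∘ₗ θ ∘ₗ ((dualEquiv M).baseChange O O' _ _).toLinearMap ∘ₗ
      (baseChangeEquiv (dual M)).toLinearMap)).toAddMonoidHom
  have hF : Function.Bijective F :=
    e.bijective.comp (hθ.comp ((((dualEquiv M).baseChange O O' _ _)).bijective.comp
      (baseChangeEquiv (dual M)).bijective))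
  have h : F = (dualBaseChangeHom O' M).hom.toAddMonoidHom := by
    refine baseChange_add_hom_ext fun c f => ?_
    have h1 : F (bmk O' (dual M) c f) = e (θ (c ⊗ₜ dualEquiv M f)) := rfl
    have h2 : c ⊗ₜ[O] dualEquiv M f = c • ((1 : O') ⊗ₜ[O] dualEquiv M f) := by
      rw [smul_tmul', smul_eq_mul, mul_one]
    refine h1.trans ((?_ : _ = _).trans (dualBaseChangeHom_bmk M c f).symm)
    rw [h2, map_smul, map_smul, hθ']
    congr 1
    refine dual_baseChange_ext fun m => ?_
    rw [dualBaseChangeAdd_bmk, one_mul]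
    change TensorProduct.AlgebraTensorModule.rid O O' O' ((1 : O') ⊗ₜ[O] dualEquiv M f m) = _
    rw [TensorProduct.AlgebraTensorModule.rid_tmul, Algebra.algebraMap_eq_smul_one]
  rw [h] at hF
  exact hF

variable (O') in
/-- Extension of scalars commutes with duals. -/
def dualBaseChange (M : BimodCat O A B) [Module.Finite O M] [Module.Free O M] :
    baseChange O' (dual M) ≅ dual (baseChange O' M) :=
  isoOfBijective (dualBaseChangeHom O' M) (dualBaseChangeHom_bijective M)

theorem dualBaseChangeHom_naturality {M N : BimodCat O A B} (f : M ⟶ N) :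
    baseChangeMap O' (dualMap f) ≫ dualBaseChangeHom O' M =
      dualBaseChangeHom O' N ≫ dualMap (baseChangeMap O' f) := by
  refine baseChange_hom_ext fun g => ?_
  change (dualBaseChangeHom O' M).hom ((baseChangeMap O' (dualMap f)).hom (bmk O' (dual N) 1 g)) =
    (dualMap (baseChangeMap O' f)).hom ((dualBaseChangeHom O' N).hom (bmk O' (dual N) 1 g))
  rw [baseChangeMap_bmk, dualBaseChangeHom_bmk, dualBaseChangeHom_bmk, one_smul, one_smul]
  refine dual_baseChange_ext fun m => ?_
  rfl

/-! ### Extension of scalars, dual and regular complexes -/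

variable (O') in
/-- Extension of scalars commutes with duals of complexes. -/
def dualBaseChangeComplex (X : CochainComplex (BimodCat O A B) ℤ)
    (hX : ∀ i, Module.Finite O (X.X i)) (hX' : ∀ i, Module.Free O (X.X i)) :
    baseChangeComplex O' (dualComplex X) ≅ dualComplex (baseChangeComplex O' X) :=
  HomologicalComplex.Hom.isoOfComponents
    (fun i => have := hX (-i); have := hX' (-i); dualBaseChange O' (X.X (-i)))
    fun i j _ => (dualBaseChangeHom_naturality (X.d (-j) (-i))).symm

variable (O O' A) in
/-- Extension of scalars of the regular complex. -/
def baseChangeRegularComplex :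
    baseChangeComplex O' (regularComplex O A) ≅ regularComplex O' (O' ⊗[O] A) :=
  (HomologicalComplex.singleMapHomologicalComplex (baseChangeFunctor O A A O')
    (ComplexShape.up ℤ) 0).app (regular O A) ≪≫
    (HomologicalComplex.single _ (ComplexShape.up ℤ) 0).mapIso (baseChangeRegular O A O')

end BaseChangeDual

section MapBifunctor

/-! ### Additive functors and total complexes of bifunctors -/

open HomologicalComplex

variable {C₁ C₂ D C₁' C₂' D' : Type*} [Category* C₁] [Category* C₂] [Category* D] [Category* C₁']
  [Category* C₂'] [Category* D'] [Preadditive C₁] [Preadditive C₂] [Preadditive D]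
  [Preadditive C₁'] [Preadditive C₂'] [Preadditive D']
  (T : C₁ ⥤ C₂ ⥤ D) [T.Additive] (X : CochainComplex C₁ ℤ) (Y : CochainComplex C₂ ℤ)

theorem isZero_mapBifunctor_left {i j : ℤ} (hi : IsZero (X.X i)) :
    IsZero ((T.obj (X.X i)).obj (Y.X j)) := by
  rw [IsZero.iff_id_eq_zero, ← NatTrans.id_app, ← T.map_id, (IsZero.iff_id_eq_zero _).1 hi,
    T.map_zero, zero_app]

variable [∀ M, (T.obj M).Additive] (T' : C₁' ⥤ C₂' ⥤ D') [T'.Additive] [∀ M, (T'.obj M).Additive]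
  [HasMapBifunctor X Y T (ComplexShape.up ℤ)]

/-- The projection of a total complex to one of its summands. -/
def mapBifunctorProj (n i j : ℤ) (h : i + j = n) :
    (mapBifunctor X Y T (ComplexShape.up ℤ)).X n ⟶ (T.obj (X.X i)).obj (Y.X j) :=
  mapBifunctorDesc fun i' j' h' => if hi : i' = i then
    eqToHom (by
      have : j' = j := by change i' + j' = n at h'; omega
      rw [hi, this]) else 0

theorem ι_mapBifunctorProj_self (n i j : ℤ) (h : i + j = n) :
    ιMapBifunctor X Y T (ComplexShape.up ℤ) i j n h ≫ mapBifunctorProj T X Y n i j h = 𝟙 _ := by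
  unfold mapBifunctorProj
  rw [ι_mapBifunctorDesc, dif_pos rfl, eqToHom_refl]

theorem ι_mapBifunctorProj_of_ne (n i j i' j' : ℤ) (h : i + j = n) (h' : i' + j' = n)
    (hi : i ≠ i') : ιMapBifunctor X Y T (ComplexShape.up ℤ) i j n h ≫
      mapBifunctorProj T X Y n i' j' h' = 0 := by
  unfold mapBifunctorProj
  rw [ι_mapBifunctorDesc, dif_neg hi]

/-- When X has finite support, each degree of the total complex is a finite direct sum. Written as a
decomposition of the identity, this is preserved by any additive functor, with no assumption on
infinite coproducts. -/
theorem sum_proj_ι (s : Finset ℤ) (hs : ∀ i ∉ s, IsZero (X.X i)) (n : ℤ) :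
    ∑ i ∈ s, mapBifunctorProj T X Y n i (n - i) (by omega) ≫
      ιMapBifunctor X Y T (ComplexShape.up ℤ) i (n - i) n (add_sub_cancel i n) = 𝟙 _ := by
  refine mapBifunctor.hom_ext fun i j h => ?_
  by_cases hi : i ∈ s
  · obtain rfl : j = n - i := by change i + j = n at h; omega
    rw [Preadditive.comp_sum, Finset.sum_eq_single i, ← Category.assoc, ι_mapBifunctorProj_self,
      Category.id_comp, Category.comp_id]
    · intro k _ hk
      rw [← Category.assoc, ι_mapBifunctorProj_of_ne _ _ _ _ _ _ _ _ _ _ hk.symm, zero_comp]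
    · exact fun h => absurd hi h
  · exact (isZero_mapBifunctor_left T X Y (hs i hi)).eq_of_src _ _

variable {T T'} (X' : CochainComplex C₁' ℤ) (Y' : CochainComplex C₂' ℤ)
  [HasMapBifunctor X' Y' T' (ComplexShape.up ℤ)] (H : D ⥤ D')
  (e : ∀ i j, (T'.obj (X'.X i)).obj (Y'.X j) ≅ H.obj ((T.obj (X.X i)).obj (Y.X j)))

/-- The comparison of `T'(X', Y')` and `H (T(X, Y))` in a single degree. -/
def mapBifunctorComparison (n : ℤ) :
    (mapBifunctor X' Y' T' (ComplexShape.up ℤ)).X n ⟶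
    H.obj ((mapBifunctor X Y T (ComplexShape.up ℤ)).X n) :=
  mapBifunctorDesc fun i j h => (e i j).hom ≫
    H.map (ιMapBifunctor X Y T (ComplexShape.up ℤ) i j n h)

theorem ι_mapBifunctorComparison (n i j : ℤ) (h : i + j = n) :
    ιMapBifunctor X' Y' T' (ComplexShape.up ℤ) i j n h ≫
      mapBifunctorComparison X Y X' Y' H e n = (e i j).hom ≫
      H.map (ιMapBifunctor X Y T (ComplexShape.up ℤ) i j n h) := by
  unfold mapBifunctorComparison
  rw [ι_mapBifunctorDesc]

variable [H.Additive]

/-- On each summand the differential splits into a part from X and a signed part from Y. Naturality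
in each variable handles one part, and additive functors respect the signs. -/
theorem mapBifunctorComparison_comm
    (he₁ : ∀ i i' j, (T'.map (X'.d i i')).app (Y'.X j) ≫ (e i' j).hom =
      (e i j).hom ≫ H.map ((T.map (X.d i i')).app (Y.X j)))
    (he₂ : ∀ i j j', (T'.obj (X'.X i)).map (Y'.d j j') ≫ (e i j').hom =
      (e i j).hom ≫ H.map ((T.obj (X.X i)).map (Y.d j j'))) (n n' : ℤ) (hn : n + 1 = n') :
    mapBifunctorComparison X Y X' Y' H e n ≫
      H.map ((mapBifunctor X Y T (ComplexShape.up ℤ)).d n n') =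
    (mapBifunctor X' Y' T' (ComplexShape.up ℤ)).d n n' ≫
      mapBifunctorComparison X Y X' Y' H e n' := by
  refine mapBifunctor.hom_ext fun i j h => ?_
  have h' : i + j = n := h
  have h1 : i + 1 + j = n' := by omega
  have h2 : i + (j + 1) = n' := by omega
  rw [← Category.assoc, ι_mapBifunctorComparison, Category.assoc, ← H.map_comp, mapBifunctor.d_eq,
    mapBifunctor.d_eq, Preadditive.comp_add, mapBifunctor.ι_D₁, mapBifunctor.ι_D₂,
    ← Category.assoc, Preadditive.comp_add, mapBifunctor.ι_D₁, mapBifunctor.ι_D₂,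
    mapBifunctor.d₁_eq X Y T (ComplexShape.up ℤ) (rfl : i + 1 = i + 1) j n' h1,
    mapBifunctor.d₂_eq X Y T (ComplexShape.up ℤ) i (rfl : j + 1 = j + 1) n' h2,
    mapBifunctor.d₁_eq X' Y' T' (ComplexShape.up ℤ) (rfl : i + 1 = i + 1) j n' h1,
    mapBifunctor.d₂_eq X' Y' T' (ComplexShape.up ℤ) i (rfl : j + 1 = j + 1) n' h2,
    Preadditive.add_comp, H.map_add, Preadditive.comp_add, Functor.map_units_smul,
    Functor.map_units_smul, Linear.comp_units_smul, Linear.comp_units_smul,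
    Linear.units_smul_comp, Linear.units_smul_comp, Category.assoc, Category.assoc,
    ι_mapBifunctorComparison _ _ _ _ _ _ _ _ _ h1, ι_mapBifunctorComparison _ _ _ _ _ _ _ _ _ h2,
    H.map_comp, H.map_comp, ← Category.assoc, ← he₁, ← Category.assoc (e i j).hom, ← he₂,
    Category.assoc, Category.assoc]

/-- The comparison of `T'(X', Y')` and `H (T(X, Y))` is an isomorphism in each degree. -/
def mapBifunctorComparisonIso (s : Finset ℤ) (hs : ∀ i ∉ s, IsZero (X.X i)) (n : ℤ) :
    (mapBifunctor X' Y' T' (ComplexShape.up ℤ)).X n ≅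
    H.obj ((mapBifunctor X Y T (ComplexShape.up ℤ)).X n) where
  hom := mapBifunctorComparison X Y X' Y' H e n
  -- The inverse is assembled from the finitely many summands of the total complex with i in the
  -- support of X; the others are zero.
  inv := ∑ i ∈ s, H.map (mapBifunctorProj T X Y n i (n - i) (by omega)) ≫
      (e i (n - i)).inv ≫
        ιMapBifunctor X' Y' T' (ComplexShape.up ℤ) i (n - i) n (add_sub_cancel i n)
  hom_inv_id := by
    refine mapBifunctor.hom_ext fun i j h => ?_
    by_cases hi : i ∈ s
    · obtain rfl : j = n - i := by change i + j = n at h; omega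
      rw [← Category.assoc, ι_mapBifunctorComparison _ _ _ _ _ _ _ _ _ h, Preadditive.comp_sum,
        Finset.sum_eq_single i, Category.assoc, ← Category.assoc (H.map _), ← H.map_comp,
        ι_mapBifunctorProj_self, H.map_id, Category.id_comp, Iso.hom_inv_id_assoc, Category.comp_id]
      · intro k _ hk
        rw [Category.assoc, ← Category.assoc (H.map _), ← H.map_comp,
          ι_mapBifunctorProj_of_ne _ _ _ _ _ _ _ _ _ _ hk.symm, H.map_zero, zero_comp, comp_zero]
      · exact fun h => absurd hi h
    · exact ((H.map_isZero (isZero_mapBifunctor_left T X Y (hs i hi))).of_iso (e i j)).eq_of_src _ _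
  inv_hom_id := by
    have := congrArg H.map (sum_proj_ι T X Y s hs n)
    rw [H.map_sum, H.map_id] at this
    rw [Preadditive.sum_comp]
    refine (Finset.sum_congr rfl fun i _ => ?_).trans this
    rw [Category.assoc, Category.assoc, ι_mapBifunctorComparison _ _ _ _ _ _ _ _ _
      (add_sub_cancel i n), Iso.inv_hom_id_assoc, H.map_comp]

end MapBifunctor

/-! ### Extension of scalars and tensor products of complexes -/

section BaseChangeTensorComplex

variable {O : Type u} [CommRing O]
variable {A : Type u} [Ring A] [Algebra O A] {B : Type u} [Ring B] [Algebra O B]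
variable {C : Type u} [Ring C] [Algebra O C]
variable (O' : Type u) [CommRing O'] [Algebra O O']

/-- Extension of scalars commutes with tensor products of complexes. -/
def tensorBaseChangeComplex (X : CochainComplex (BimodCat O A B) ℤ)
    (Y : CochainComplex (BimodCat O B C) ℤ) (hX : IsBounded X) :
    tensorComplex (baseChangeComplex O' X) (baseChangeComplex O' Y) ≅
      baseChangeComplex O' (tensorComplex X Y) :=
  HomologicalComplex.Hom.isoOfComponents (fun n =>
    mapBifunctorComparisonIso (T := tensorBifunctor O A B C)
      (T' := tensorBifunctor O' (O' ⊗[O] A) (O' ⊗[O] B) (O' ⊗[O] C)) X Y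
      (baseChangeComplex O' X) (baseChangeComplex O' Y) (baseChangeFunctor O A C O')
      (fun i j => tensorBaseChange O' (X.X i) (Y.X j)) hX.toFinset
      (fun i hi => not_not.1 fun h => hi (hX.mem_toFinset.2 h)) n)
    fun n n' hn => mapBifunctorComparison_comm (T := tensorBifunctor O A B C)
      (T' := tensorBifunctor O' (O' ⊗[O] A) (O' ⊗[O] B) (O' ⊗[O] C)) X Y
      (baseChangeComplex O' X) (baseChangeComplex O' Y) (baseChangeFunctor O A C O')
      (fun i j => tensorBaseChange O' (X.X i) (Y.X j))
      (fun i i' j => by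
        have := tensorBaseChange_naturality (O' := O') (X.d i i') (𝟙 (Y.X j))
        have h := (baseChangeFunctor O B C O').map_id (Y.X j)
        change baseChangeMap O' (𝟙 (Y.X j)) = _ at h
        rw [h] at this
        exact this)
      (fun i j j' => by
        have := tensorBaseChange_naturality (O' := O') (𝟙 (X.X i)) (Y.d j j')
        have h := (baseChangeFunctor O A B O').map_id (X.X i)
        change baseChangeMap O' (𝟙 (X.X i)) = _ at h
        rw [h] at this
        exact this) n n' hn

end BaseChangeTensorComplex

/-! ### Dual bases -/

section DualBasis

variable {O : Type u} [CommRing O]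
variable {A : Type u} [Ring A] [Algebra O A] {B : Type u} [Ring B] [Algebra O B]
variable {C : Type u} [Ring C] [Algebra O C]

attribute [local instance] moduleO isScalarTowerO

/-- A finitely generated projective module has a finite dual basis. -/
theorem exists_dualBasis {R P : Type*} [Ring R] [AddCommGroup P] [Module R P]
    (hf : Module.Finite R P) (hp : Module.Projective R P) :
    ∃ (n : ℕ) (x : Fin n → P) (φ : Fin n → P →ₗ[R] R), ∀ p, ∑ i, φ i p • x i = p := by
  obtain ⟨n, f, hf⟩ := Module.Finite.exists_fin' R P
  obtain ⟨s, hs⟩ := Module.projective_lifting_property f LinearMap.id hf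
  refine ⟨n, fun i => f (Pi.single i 1), fun i => LinearMap.proj i ∘ₗ s, fun p => ?_⟩
  refine Eq.trans ?_ (LinearMap.congr_fun hs p)
  rw [LinearMap.comp_apply, LinearMap.pi_apply_eq_sum_univ f]
  refine Finset.sum_congr rfl fun i _ => congrArg (fun v => s p i • f v) ?_
  ext j
  simp [Pi.single_apply, eq_comm]

theorem projective_of_dualBasis {R P : Type*} [Ring R] [AddCommGroup P] [Module R P] {n : ℕ}
    (x : Fin n → P) (φ : Fin n → P →ₗ[R] R) (h : ∀ p, ∑ i, φ i p • x i = p) :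
    Module.Projective R P :=
  Module.Projective.of_split (LinearMap.pi φ) (Fintype.linearCombination R x) (LinearMap.ext h)

theorem projective_pi (R P : Type*) [Ring R] [AddCommGroup P] [Module R P]
    [Module.Projective R P] (n : ℕ) : Module.Projective R (Fin n → P) :=
  Module.Projective.of_equiv' (DirectSum.linearEquivFunOnFintype R (Fin n) fun _ => P)

/-- A dual basis of a bimodule as a left module. -/
structure LeftBasis (M : BimodCat O A B) (n : ℕ) where
  vec : Fin n → M
  coord : Fin n → M →+ A
  coord_leftAct : ∀ i a m, coord i (leftAct M a m) = a * coord i m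
  sum_eq : ∀ m, ∑ i, leftAct M (coord i m) (vec i) = m

/-- A dual basis of a bimodule as a right module. -/
structure RightBasis (M : BimodCat O A B) (n : ℕ) where
  vec : Fin n → M
  coord : Fin n → M →+ B
  coord_rightAct : ∀ i b m, coord i (rightAct M (op b) m) = coord i m * b
  sum_eq : ∀ m, ∑ i, rightAct M (op (coord i m)) (vec i) = m

theorem finite_leftModule [Module.Finite O A] [Module.Finite O B] {M : BimodCat O A B}
    (hM : Module.Finite (A ⊗[O] Bᵐᵒᵖ) M) : Module.Finite A (leftModule M) := by
  have : Module.Finite O M := finiteO M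
  have : Module.Finite O (leftModule M) := this
  exact Module.Finite.of_restrictScalars_finite O A (leftModule M)

theorem finite_rightModule [Module.Finite O A] [Module.Finite O B] {M : BimodCat O A B}
    (hM : Module.Finite (A ⊗[O] Bᵐᵒᵖ) M) : Module.Finite Bᵐᵒᵖ (rightModule M) := by
  have : Module.Finite O M := finiteO M
  obtain ⟨s, hs⟩ := this.fg_top
  refine ⟨s, eq_top_iff.2 fun m _ => ?_⟩
  have hm : (show M from m) ∈ Submodule.span O (s : Set M) := hs ▸ Submodule.mem_top
  refine Submodule.span_induction (p := fun (x : M) _ =>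
    (show rightModule M from x) ∈
      (Submodule.span Bᵐᵒᵖ (show Set (rightModule M) from (s : Set M))))
    (fun x hx => Submodule.subset_span hx) (Submodule.zero_mem _)
    (fun x y _ _ hx hy => Submodule.add_mem _ hx hy) (fun c x _ hx => ?_) hm
  have := Submodule.smul_mem _ (op (algebraMap O B c)) hx
  have h : (op (algebraMap O B c)) • (show rightModule M from x) = (c • x : M) :=
    rightAct_algebraMap M c x
  rw [h] at this
  exact this

/-- A dual basis encodes projectivity by finitely many vectors, coordinates and one identity. In
this form it passes to extensions of scalars and to duals by direct computation. -/
theorem IsBiprojective.exists_leftBasis [Module.Finite O A] [Module.Finite O B]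
    {M : BimodCat O A B} (hM : IsBiprojective M) : ∃ n, Nonempty (LeftBasis M n) := by
  obtain ⟨n, x, φ, h⟩ := exists_dualBasis (finite_leftModule hM.finite) hM.left
  exact ⟨n, ⟨x, fun i => (φ i).toAddMonoidHom, fun i a m => (φ i).map_smul a m, h⟩⟩

theorem IsBiprojective.exists_rightBasis [Module.Finite O A] [Module.Finite O B]
    {M : BimodCat O A B} (hM : IsBiprojective M) : ∃ n, Nonempty (RightBasis M n) := by
  obtain ⟨n, x, φ, h⟩ := exists_dualBasis (finite_rightModule hM.finite) hM.right
  exact ⟨n, ⟨x, fun i => ((opAddEquiv (α := B)).symm.toAddMonoidHom).comp (φ i).toAddMonoidHom,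
    fun i b m => congrArg unop ((φ i).map_smul (op b) m), h⟩⟩

theorem LeftBasis.projective {M : BimodCat O A B} {n : ℕ} (b : LeftBasis M n) :
    Module.Projective A (leftModule M) :=
  projective_of_dualBasis (P := leftModule M) b.vec (fun i =>
    { toFun := b.coord i
      map_add' := map_add (b.coord i)
      map_smul' := fun a m => b.coord_leftAct i a m }) b.sum_eq

theorem RightBasis.projective {M : BimodCat O A B} {n : ℕ} (b : RightBasis M n) :
    Module.Projective Bᵐᵒᵖ (rightModule M) :=
  projective_of_dualBasis (P := rightModule M) b.vec (fun i =>
    { toFun := fun m => op (b.coord i m)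
      map_add' := fun m m' => congrArg op (map_add (b.coord i) m m')
      map_smul' := fun a m => congrArg op (b.coord_rightAct i a.unop m) }) b.sum_eq

/-- The coordinates of a dual basis as linear maps over the base ring. -/
def LeftBasis.coordO {M : BimodCat O A B} {n : ℕ} (b : LeftBasis M n) (i : Fin n) : M →ₗ[O] A where
  toFun := b.coord i
  map_add' := map_add (b.coord i)
  map_smul' c m := by
    rw [← leftAct_algebraMap, b.coord_leftAct, RingHom.id_apply, Algebra.smul_def]

/-- The coordinates of a dual basis as linear maps over the base ring. -/
def RightBasis.coordO {M : BimodCat O A B} {n : ℕ} (b : RightBasis M n) (i : Fin n) :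
    M →ₗ[O] B where
  toFun := b.coord i
  map_add' := map_add (b.coord i)
  map_smul' c m := by
    rw [← rightAct_algebraMap, b.coord_rightAct, RingHom.id_apply, Algebra.smul_def,
      Algebra.commutes]

/-- The coordinates and the vectors exhibit M as a direct summand of Aⁿ over O. -/
theorem LeftBasis.projectiveO [Module.Projective O A] {M : BimodCat O A B} {n : ℕ}
    (b : LeftBasis M n) : Module.Projective O M := by
  have := projective_pi O A n
  refine Module.Projective.of_split (M := Fin n → A) (LinearMap.pi b.coordO)
    (∑ i, (LinearMap.flip (leftAct M).toLinearMap (b.vec i)) ∘ₗ LinearMap.proj i) ?_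
  ext m
  simp only [LinearMap.comp_apply, LinearMap.sum_apply]
  exact b.sum_eq m

theorem IsBiprojective.finiteO [Module.Finite O A] [Module.Finite O B]
    {M : BimodCat O A B} (hM : IsBiprojective M) : Module.Finite O M :=
  have := hM.finite
  SymAlg.finiteO M

theorem free_of_projective [IsLocalRing O] (V : Type*) [AddCommGroup V] [Module O V]
    [Module.Finite O V] [Module.Projective O V] : Module.Free O V :=
  Module.free_of_flat_of_isLocalRing

theorem IsBiprojective.freeO [IsLocalRing O] [Module.Finite O A] [Module.Finite O B]
    [Module.Free O A] {M : BimodCat O A B} (hM : IsBiprojective M) : Module.Free O M := by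
  obtain ⟨n, ⟨b⟩⟩ := hM.exists_leftBasis
  have := b.projectiveO
  have := hM.finiteO
  exact free_of_projective M

/-- If `M` is finitely generated projective as a right module, then `M ⊗_B N` is a direct summand
of a direct sum of copies of `N`. -/
theorem RightBasis.projectiveO_tensor {M : BimodCat O A B} {n : ℕ} (b : RightBasis M n)
    (N : BimodCat O B C) [Module.Projective O N] : Module.Projective O (tensor M N) := by
  let f (i : Fin n) : M →+ N →+ N := AddMonoidHom.mk' (fun m => (leftAct N (b.coord i m)).toAddMonoidHom)
    fun m m' => by
      ext x
      change leftAct N (b.coord i (m + m')) x = leftAct N (b.coord i m) x + leftAct N (b.coord i m') x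
      rw [map_add, map_add, LinearMap.add_apply]
  have hf (i : Fin n) (m : M) (x : N) : f i m x = leftAct N (b.coord i m) x := rfl
  -- The i-th map sends m ⊗ x to coordᵢ(m) x. It respects the relations because coordᵢ is right
  -- B-linear.
  let F (i : Fin n) : tensor M N →+ N := tensorLift (f i) fun m c x => by
    rw [hf, hf, b.coord_rightAct, map_mul]
    rfl
  have hF (i : Fin n) (m : M) (x : N) : F i (tmk M N m x) = leftAct N (b.coord i m) x := rfl
  let G (i : Fin n) : tensor M N →ₗ[O] N :=
    { toFun := F i
      map_add' := map_add (F i)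
      map_smul' := fun c z => by
        refine tensor_induction (p := fun z => F i (c • z) = c • F i z)
          (by rw [smul_zero, map_zero, smul_zero]) (fun m x => ?_)
          (fun x y hx hy => by rw [smul_add, map_add, map_add, smul_add, hx, hy]) z
        rw [← tmk_smul_right, hF, hF, map_smul] }
  let s (i : Fin n) : N →ₗ[O] tensor M N :=
    { toFun := tmk M N (b.vec i)
      map_add' := tmk_add_right M N (b.vec i)
      map_smul' := fun c x => tmk_smul_right M N c (b.vec i) x }
  have := projective_pi O N n
  refine Module.Projective.of_split (M := Fin n → N) (LinearMap.pi G)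
    (∑ i, s i ∘ₗ LinearMap.proj i) (LinearMap.ext fun z => ?_)
  have key (z : tensor M N) : ∑ i, tmk M N (b.vec i) (F i z) = z := by
    have (i : Fin n) (z : tensor M N) : tmk M N (b.vec i) (F i z) = s i (G i z) := rfl
    simp only [this]
    refine tensor_induction (p := fun z => ∑ i, s i (G i z) = z) ?_ (fun m x => ?_) (fun x y hx hy => ?_) z
    · simp only [map_zero, Finset.sum_const_zero]
    · have h (i : Fin n) : s i (G i (tmk M N m x)) =
        (tmkHom M N).flip x (rightAct M (op (b.coord i m)) (b.vec i)) :=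
        (tmk_balanced M N (b.vec i) (b.coord i m) x).symm
      simp only [h]
      rw [← map_sum, b.sum_eq]
      rfl
    · simp only [map_add, Finset.sum_add_distrib, hx, hy]
  simp only [LinearMap.comp_apply, LinearMap.sum_apply]
  exact key z

end DualBasis

/-! ### Dual bases of extensions of scalars and of duals -/

section BaseChangeBasis

variable {O : Type u} [CommRing O]
variable {A : Type u} [Ring A] [Algebra O A] {B : Type u} [Ring B] [Algebra O B]
variable (O' : Type u) [CommRing O'] [Algebra O O']

attribute [local instance] moduleO isScalarTowerO

/-- The extension of scalars of an additive map underlying an `O`-linear map. -/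
def baseChangeAdd {M : BimodCat O A B} {V : Type u} [AddCommGroup V] [Module O V]
    (f : M →ₗ[O] V) : baseChange O' M →+ O' ⊗[O] V :=
  (f.baseChange O' ∘ₗ (baseChangeEquiv M).toLinearMap).toAddMonoidHom

theorem baseChangeAdd_bmk {M : BimodCat O A B} {V : Type u} [AddCommGroup V] [Module O V]
    (f : M →ₗ[O] V) (c : O') (m : M) : baseChangeAdd O' f (bmk O' M c m) = c ⊗ₜ f m := rfl

theorem baseChangeAdd_leftAct {M : BimodCat O A B} (f : M →ₗ[O] A)
    (hf : ∀ a m, f (leftAct M a m) = a * f m) (x : O' ⊗[O] A) (z : baseChange O' M) :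
    baseChangeAdd O' f (leftAct (baseChange O' M) x z) = x * baseChangeAdd O' f z := by
  refine baseChange_induction (p := fun z => baseChangeAdd O' f (leftAct (baseChange O' M) x z) =
    x * baseChangeAdd O' f z) (by rw [map_zero, map_zero, mul_zero]) (fun d m => ?_)
    (fun z w hz hw => by rw [map_add, map_add, map_add, hz, hw, mul_add]) z
  induction x with
  | zero => rw [map_zero, LinearMap.zero_apply, map_zero, zero_mul]
  | add x y hx hy => rw [map_add, LinearMap.add_apply, map_add, hx, hy, add_mul]
  | tmul c a =>
    rw [leftAct_bmk, baseChangeAdd_bmk, baseChangeAdd_bmk, hf, Algebra.TensorProduct.tmul_mul_tmul]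

theorem baseChangeAdd_rightAct {M : BimodCat O A B} (f : M →ₗ[O] B)
    (hf : ∀ b m, f (rightAct M (op b) m) = f m * b) (x : O' ⊗[O] B) (z : baseChange O' M) :
    baseChangeAdd O' f (rightAct (baseChange O' M) (op x) z) = baseChangeAdd O' f z * x := by
  refine baseChange_induction (p := fun z =>
    baseChangeAdd O' f (rightAct (baseChange O' M) (op x) z) =
    baseChangeAdd O' f z * x) (by rw [map_zero, map_zero, zero_mul]) (fun d m => ?_)
    (fun z w hz hw => by rw [map_add, map_add, map_add, hz, hw, add_mul]) z
  induction x with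
  | zero => rw [MulOpposite.op_zero, map_zero, LinearMap.zero_apply, map_zero, mul_zero]
  | add x y hx hy => rw [MulOpposite.op_add, map_add, LinearMap.add_apply, map_add, hx, hy, mul_add]
  | tmul c a =>
    rw [rightAct_bmk, baseChangeAdd_bmk, baseChangeAdd_bmk, hf, Algebra.TensorProduct.tmul_mul_tmul,
      _root_.mul_comm c d]

/-- The extension of scalars of a dual basis. -/
def LeftBasis.baseChange {M : BimodCat O A B} {n : ℕ} (b : LeftBasis M n) :
    LeftBasis (SymAlg.baseChange O' M) n where
  vec i := bmk O' M 1 (b.vec i)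
  coord i := baseChangeAdd O' (b.coordO i)
  coord_leftAct i := baseChangeAdd_leftAct O' (b.coordO i) (b.coord_leftAct i)
  sum_eq z := by
    refine baseChange_induction (p := fun z => ∑ i, leftAct (SymAlg.baseChange O' M)
      (baseChangeAdd O' (b.coordO i) z) (bmk O' M 1 (b.vec i)) = z) ?_ (fun c m => ?_)
      (fun z w hz hw => ?_) z
    · simp only [map_zero, LinearMap.zero_apply, Finset.sum_const_zero]
    · simp only [baseChangeAdd_bmk, leftAct_bmk, mul_one]
      have h (x : M) : bmk O' M c x = c • bmkHom O' M x := by rw [bmkHom_apply, smul_bmk, mul_one]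
      simp only [h]
      rw [← Finset.smul_sum, ← map_sum]
      exact congrArg (fun x => c • bmkHom O' M x) (b.sum_eq m)
    · simp only [map_add, LinearMap.add_apply, Finset.sum_add_distrib, hz, hw]

/-- The extension of scalars of a dual basis. -/
def RightBasis.baseChange {M : BimodCat O A B} {n : ℕ} (b : RightBasis M n) :
    RightBasis (SymAlg.baseChange O' M) n where
  vec i := bmk O' M 1 (b.vec i)
  coord i := baseChangeAdd O' (b.coordO i)
  coord_rightAct i := baseChangeAdd_rightAct O' (b.coordO i) (b.coord_rightAct i)
  sum_eq z := by
    refine baseChange_induction (p := fun z => ∑ i, rightAct (SymAlg.baseChange O' M)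
      (op (baseChangeAdd O' (b.coordO i) z)) (bmk O' M 1 (b.vec i)) = z) ?_ (fun c m => ?_)
      (fun z w hz hw => ?_) z
    · simp only [map_zero, MulOpposite.op_zero, LinearMap.zero_apply, Finset.sum_const_zero]
    · simp only [baseChangeAdd_bmk, rightAct_bmk, mul_one]
      have h (x : M) : bmk O' M c x = c • bmkHom O' M x := by rw [bmkHom_apply, smul_bmk, mul_one]
      simp only [h]
      rw [← Finset.smul_sum, ← map_sum]
      exact congrArg (fun x => c • bmkHom O' M x) (b.sum_eq m)
    · simp only [map_add, MulOpposite.op_add, LinearMap.add_apply, Finset.sum_add_distrib, hz, hw]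

/-- Both dual bases extend termwise to O'. -/
theorem IsBiprojective.baseChange [Module.Finite O A] [Module.Finite O B] {M : BimodCat O A B}
    (hM : IsBiprojective M) : IsBiprojective (SymAlg.baseChange O' M) := by
  obtain ⟨n, ⟨b⟩⟩ := hM.exists_leftBasis
  obtain ⟨m, ⟨c⟩⟩ := hM.exists_rightBasis
  have := hM.finite
  exact ⟨inferInstance, (b.baseChange O').projective, (c.baseChange O').projective⟩

end BaseChangeBasis

/-! ### Symmetrizing forms and duals of biprojective bimodules -/

section DualBasis

variable {O : Type u} [CommRing O]
variable {A : Type u} [Ring A] [Algebra O A] {B : Type u} [Ring B] [Algebra O B]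

attribute [local instance] moduleO isScalarTowerO

/-- A nondegenerate symmetric bilinear form `(x, y) ↦ form (x y)` on `A`. -/
structure SymmetrizingForm (O A : Type u) [CommRing O] [Ring A] [Algebra O A] where
  form : A →ₗ[O] O
  form_comm : ∀ x y, form (x * y) = form (y * x)
  rep : (A →ₗ[O] O) →ₗ[O] A
  form_rep : ∀ f x, form (x * rep f) = f x
  rep_form : ∀ f a, (∀ x, f x = form (x * a)) → rep f = a

/-- The form is the image τ(1) of the unit under A ≅ A^∨. Left linearity gives τ(a)(x) = τ(1)(x a),
right linearity gives τ(a)(x) = τ(1)(a x). Comparing them yields symmetry, and the inverse of τ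
represents functionals. -/
theorem IsSymmetric.exists_form (h : IsSymmetric O A) : Nonempty (SymmetrizingForm O A) := by
  obtain ⟨σ⟩ := h
  let τ : A ≃ₗ[O] Module.Dual O (regular O A) := (regularEquiv O A).symm.trans
    ((σ.toLinearEquiv.restrictScalars O).trans (dualEquiv (regular O A)))
  let r := regularEquiv O A
  have el (a b : A) : leftAct (regular O A) a (r.symm b) = r.symm (a * b) := leftAct_regular a b
  have er (a b : A) : rightAct (regular O A) (op a) (r.symm b) = r.symm (b * a) :=
    rightAct_regular a b
  have hl (a b x : A) : τ (a * b) (r.symm x) = τ b (r.symm (x * a)) := by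
    have h1 := homO_leftAct (O := O) σ.hom a (r.symm b)
    rw [el] at h1
    have h2 := dualEquiv_leftAct (regular O A) a (homO (O := O) σ.hom (r.symm b)) (r.symm x)
    rw [er, ← h1] at h2
    exact h2
  have hr (a b x : A) : τ (b * a) (r.symm x) = τ b (r.symm (a * x)) := by
    have h1 := homO_rightAct (O := O) σ.hom (op a) (r.symm b)
    rw [er] at h1
    have h2 := dualEquiv_rightAct (regular O A) a (homO (O := O) σ.hom (r.symm b)) (r.symm x)
    rw [el, ← h1] at h2
    exact h2
  have h1 (a x : A) : τ a (r.symm x) = τ 1 (r.symm (x * a)) := by rw [← hl, mul_one]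
  refine ⟨⟨τ 1 ∘ₗ r.symm.toLinearMap, fun x y => ?_,
    τ.symm.toLinearMap ∘ₗ (r.congrLeft O O).symm.toLinearMap, fun f x => ?_, fun f a hf => ?_⟩⟩
  · change τ 1 (r.symm (x * y)) = τ 1 (r.symm (y * x))
    rw [← h1, ← hr, one_mul]
  · change τ 1 (r.symm (x * τ.symm (f ∘ₗ r.toLinearMap))) = f x
    rw [← h1, LinearEquiv.apply_symm_apply]
    rfl
  · change τ.symm (f ∘ₗ r.toLinearMap) = a
    rw [LinearEquiv.symm_apply_eq]
    ext x
    refine (hf (r x)).trans ?_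
    exact (h1 a (r x)).symm

/-- The dual of a right module with a dual basis has a dual basis. -/
def RightBasis.dual (s : SymmetrizingForm O B) {M : BimodCat O A B} {n : ℕ} (b : RightBasis M n) :
    LeftBasis (SymAlg.dual M) n where
  -- Composing coordᵢ with the form gives functionals on M, and the i-th coordinate of f represents
  -- x ↦ f(xᵢ x). The identity f(m) = ∑ f(xᵢ coordᵢ(m)) then shows that they form a dual basis.
  vec i := (dualEquiv M).symm (s.form ∘ₗ b.coordO i)
  coord i := (s.rep ∘ₗ (LinearMap.lcomp O O ((rightAct M).toLinearMap.flip (b.vec i) ∘ₗ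
      (opLinearEquiv O).toLinearMap)) ∘ₗ (dualEquiv M).toLinearMap).toAddMonoidHom
  coord_leftAct i a f := by
    refine s.rep_form _ _ fun x => ?_
    rw [← mul_assoc]
    refine Eq.trans ?_ (s.form_rep _ (x * a)).symm
    change dualEquiv M (leftAct _ a f) (rightAct M (op x) (b.vec i)) =
      dualEquiv M f (rightAct M (op (x * a)) (b.vec i))
    rw [dualEquiv_leftAct, op_mul, map_mul]
    rfl
  sum_eq f := by
    refine dual_ext fun m => ?_
    rw [map_sum, LinearMap.sum_apply]
    have h (i : Fin n) (c : B) : dualEquiv M (leftAct (SymAlg.dual M) c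
        ((dualEquiv M).symm (s.form ∘ₗ b.coordO i))) m = s.form (b.coord i m * c) := by
      rw [dualEquiv_leftAct, ← b.coord_rightAct]
      rfl
    simp only [h]
    refine (Finset.sum_congr rfl fun i _ => s.form_rep _ (b.coord i m)).trans ?_
    change ∑ i, dualEquiv M f (rightAct M (op (b.coord i m)) (b.vec i)) = _
    rw [← map_sum, b.sum_eq]

/-- The dual of a left module with a dual basis has a dual basis. -/
def LeftBasis.dual (s : SymmetrizingForm O A) {M : BimodCat O A B} {n : ℕ} (b : LeftBasis M n) :
    RightBasis (SymAlg.dual M) n where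
  vec i := (dualEquiv M).symm (s.form ∘ₗ b.coordO i)
  coord i := (s.rep ∘ₗ (LinearMap.lcomp O O ((leftAct M).toLinearMap.flip (b.vec i))) ∘ₗ
    (dualEquiv M).toLinearMap).toAddMonoidHom
  coord_rightAct i a f := by
    refine s.rep_form _ _ fun x => ?_
    rw [← mul_assoc, s.form_comm, ← mul_assoc]
    refine Eq.trans ?_ (s.form_rep _ (a * x)).symm
    change dualEquiv M (rightAct _ (op a) f) (leftAct M x (b.vec i)) =
      dualEquiv M f (leftAct M (a * x) (b.vec i))
    rw [dualEquiv_rightAct, map_mul]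
    rfl
  sum_eq f := by
    refine dual_ext fun m => ?_
    rw [map_sum, LinearMap.sum_apply]
    have h (i : Fin n) (c : A) : dualEquiv M (rightAct (SymAlg.dual M) (op c)
        ((dualEquiv M).symm (s.form ∘ₗ b.coordO i))) m = s.form (b.coord i m * c) := by
      rw [dualEquiv_rightAct, s.form_comm, ← b.coord_leftAct]
      rfl
    simp only [h]
    refine (Finset.sum_congr rfl fun i _ => s.form_rep _ (b.coord i m)).trans ?_
    change ∑ i, dualEquiv M f (leftAct M (b.coord i m) (b.vec i)) = _
    rw [← map_sum, b.sum_eq]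

/-- Dualizing exchanges the sides: the form on B turns the right dual basis of M into a left one of
M^∨, and the form on A turns the left one into a right one. Symmetry of the algebras enters the
descent through this step. -/
theorem IsBiprojective.dual [IsNoetherianRing O] [Module.Finite O A] [Module.Finite O B]
    (hA : IsSymmetric O A) (hB : IsSymmetric O B) {M : BimodCat O A B}
    (hM : IsBiprojective M) : IsBiprojective (SymAlg.dual M) := by
  obtain ⟨n, ⟨b⟩⟩ := hM.exists_leftBasis
  obtain ⟨m, ⟨c⟩⟩ := hM.exists_rightBasis
  obtain ⟨s⟩ := hA.exists_form
  obtain ⟨t⟩ := hB.exists_form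
  have := hM.finite
  exact ⟨inferInstance, (c.dual t).projective, (b.dual s).projective⟩

end DualBasis

attribute [local instance] moduleO isScalarTowerO

/-! ### Modules which are finitely generated projective over the base ring -/

section FiniteProj

variable (O : Type u) [CommRing O] {Λ : Type u} [Ring Λ] [Algebra O Λ]

/-- A module is finitely generated projective over the base ring `O`. -/
structure IsLattice (V : ModuleCat.{u} Λ) : Prop where
  finite : Module.Finite O V
  projective : Module.Projective O V

variable {O}

theorem IsLattice.free [IsLocalRing O] {V : ModuleCat.{u} Λ} (hV : IsLattice O V) :
    Module.Free O V :=
  have := hV.finite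
  have := hV.projective
  free_of_projective V

theorem IsLattice.finiteΛ {V : ModuleCat.{u} Λ} (hV : IsLattice O V) :
    Module.Finite Λ V :=
  have := hV.finite
  Module.Finite.of_restrictScalars_finite O Λ V

/-- A finite decomposition of the identity through the W i makes V an O-direct summand of their
product. Retracts, biproducts, zero objects and the terms of total complexes are all instances. -/
theorem IsLattice.of_sum {ι : Type*} (s : Finset ι) {V : ModuleCat.{u} Λ}
    {W : ι → ModuleCat.{u} Λ} (p : ∀ i, V ⟶ W i) (q : ∀ i, W i ⟶ V)
    (h : ∑ i ∈ s, p i ≫ q i = 𝟙 V) (hW : ∀ i, IsLattice O (W i)) : IsLattice O V := by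
  classical
  have hf (i : ι) := (hW i).finite
  have hp (i : ι) := (hW i).projective
  let i : V →ₗ[O] ∀ k : s, W k := LinearMap.pi fun k => homO (p k)
  let r : (∀ k : s, W k) →ₗ[O] V := ∑ k : s, homO (q k) ∘ₗ LinearMap.proj k
  have hri : r ∘ₗ i = LinearMap.id := by
    ext v
    refine Eq.trans ?_ (congrArg (fun f : V ⟶ V => f.hom v) h)
    rw [← Finset.sum_coe_sort s, ModuleCat.hom_sum, LinearMap.sum_apply, LinearMap.comp_apply,
      LinearMap.sum_apply]
    rfl
  have : Module.Projective O (∀ k : s, W k) :=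
    Module.Projective.of_equiv' (DirectSum.linearEquivFunOnFintype O s fun k => W k)
  exact ⟨Module.Finite.of_surjective r fun v => ⟨i v, LinearMap.congr_fun hri v⟩,
    Module.Projective.of_split i r hri⟩

theorem IsLattice.of_retract {V W : ModuleCat.{u} Λ} (r : Retract V W) (hW : IsLattice O W) :
    IsLattice O V :=
  .of_sum (Finset.univ : Finset Unit) (W := fun _ => W) (fun _ => r.i) (fun _ => r.r)
    (by simp) fun _ => hW

theorem IsLattice.of_add {V W₁ W₂ : ModuleCat.{u} Λ} (a : V ⟶ W₁) (b : W₁ ⟶ V) (c : V ⟶ W₂)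
    (d : W₂ ⟶ V) (h : a ≫ b + c ≫ d = 𝟙 V) (h₁ : IsLattice O W₁) (h₂ : IsLattice O W₂) :
    IsLattice O V :=
  .of_sum (Finset.univ : Finset Bool) (W := fun i => cond i W₁ W₂)
    (fun i => match i with | true => a | false => c) (fun i => match i with | true => b | false => d)
    (by rw [Fintype.sum_bool]; exact h) fun i => by cases i; exacts [h₂, h₁]

theorem IsLattice.biprod {V W : ModuleCat.{u} Λ} (hV : IsLattice O V) (hW : IsLattice O W) :
    IsLattice O (V ⊞ W) :=
  .of_add biprod.fst biprod.inl biprod.snd biprod.inr biprod.total hV hW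

theorem IsLattice.of_isZero {V : ModuleCat.{u} Λ} (hV : IsZero V) : IsLattice O V :=
  .of_sum (∅ : Finset Unit) (W := fun _ => V) (fun _ => 0) (fun _ => 0)
    (hV.eq_of_src _ _) (fun _ =>
      have : Subsingleton V := ModuleCat.subsingleton_of_isZero hV
      ⟨inferInstance, inferInstance⟩)

variable (O) in
/-- A bounded complex of modules which are finitely generated projective over `O`. -/
structure IsLatticeComplex (X : CochainComplex (ModuleCat.{u} Λ) ℤ) : Prop where
  bounded : IsBounded X
  term : ∀ i, IsLattice O (X.X i)

theorem isZero_of_add {C : Type*} [Category* C] [Preadditive C] {V W₁ W₂ : C} (a : V ⟶ W₁)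
    (b : W₁ ⟶ V) (c : V ⟶ W₂)
    (d : W₂ ⟶ V) (h : a ≫ b + c ≫ d = 𝟙 V) (h₁ : IsZero W₁) (h₂ : IsZero W₂) : IsZero V := by
  rw [IsZero.iff_id_eq_zero, ← h, h₁.eq_of_tgt a 0, h₂.eq_of_tgt c 0, zero_comp, zero_comp, add_zero]

theorem IsLatticeComplex.of_add {X Y Z : CochainComplex (ModuleCat.{u} Λ) ℤ} (a : X ⟶ Y)
    (b : Y ⟶ X) (c : X ⟶ Z) (d : Z ⟶ X) (h : a ≫ b + c ≫ d = 𝟙 X) (hY : IsLatticeComplex O Y)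
    (hZ : IsLatticeComplex O Z) : IsLatticeComplex O X := by
  have h' (i : ℤ) : a.f i ≫ b.f i + c.f i ≫ d.f i = 𝟙 (X.X i) := by
    rw [← HomologicalComplex.comp_f, ← HomologicalComplex.comp_f,
      ← HomologicalComplex.add_f_apply, h, HomologicalComplex.id_f]
  refine ⟨(hY.bounded.union hZ.bounded).subset fun i hi => ?_, fun i =>
    .of_add _ _ _ _ (h' i) (hY.term i) (hZ.term i)⟩
  by_contra hc
  rw [Set.mem_union, not_or] at hc
  exact hi (isZero_of_add _ _ _ _ (h' i) (not_not.1 hc.1) (not_not.1 hc.2))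

theorem IsLatticeComplex.biprod {X Y : CochainComplex (ModuleCat.{u} Λ) ℤ}
    (hX : IsLatticeComplex O X) (hY : IsLatticeComplex O Y) : IsLatticeComplex O (X ⊞ Y) :=
  .of_add biprod.fst biprod.inl biprod.snd biprod.inr biprod.total hX hY

theorem IsLatticeComplex.of_retract {X Y : CochainComplex (ModuleCat.{u} Λ) ℤ}
    (r : Retract X Y) (hY : IsLatticeComplex O Y) : IsLatticeComplex O X :=
  .of_add r.i r.r 0 (0 : Y ⟶ X) (by simp) hY hY

theorem IsLatticeComplex.single {V : ModuleCat.{u} Λ} (hV : IsLattice O V) :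
    IsLatticeComplex O ((HomologicalComplex.single _ (ComplexShape.up ℤ) 0).obj V) := by
  refine ⟨(Set.finite_singleton (0 : ℤ)).subset fun i hi => ?_, fun i => ?_⟩
  · by_contra h
    exact hi (HomologicalComplex.isZero_single_obj_X _ _ _ _ h)
  · by_cases h : i = 0
    · subst h
      exact .of_retract (Retract.ofIso (HomologicalComplex.singleObjXSelf _ _ _)) hV
    · exact .of_isZero (HomologicalComplex.isZero_single_obj_X _ _ _ _ h)

end FiniteProj

/-! ### Lattices among bimodules and their complexes -/

section Bimodules

variable {O : Type u} [CommRing O]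
variable {A : Type u} [Ring A] [Algebra O A] {B : Type u} [Ring B] [Algebra O B]
variable {C : Type u} [Ring C] [Algebra O C]

theorem IsLattice.of_dual_equiv {V : Type u} [AddCommGroup V] [Module O V] {W : ModuleCat.{u} A}
    (e : W ≃ₗ[O] V) [Module.Finite O V] [Module.Projective O V] : IsLattice O W :=
  ⟨Module.Finite.equiv e.symm, Module.Projective.of_equiv' e.symm⟩

theorem isLattice_regular [Module.Finite O A] [Module.Projective O A] :
    IsLattice O (regular O A) := .of_dual_equiv (regularEquiv O A)

theorem IsLattice.dual {M : BimodCat O A B} (hM : IsLattice O M) : IsLattice O (dual M) := by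
  have := hM.finite
  have := hM.projective
  exact .of_dual_equiv (dualEquiv M)

theorem IsBiprojective.isLattice [Module.Finite O A] [Module.Finite O B] [Module.Projective O A]
    {M : BimodCat O A B} (hM : IsBiprojective M) : IsLattice O M := by
  obtain ⟨n, ⟨b⟩⟩ := hM.exists_leftBasis
  exact ⟨hM.finiteO, b.projectiveO⟩

theorem IsBiprojective.isLattice_tensor [Module.Finite O A] [Module.Finite O B]
    [Module.Finite O C] {M : BimodCat O A B} (hM : IsBiprojective M) {N : BimodCat O B C}
    (hN : IsLattice O N) : IsLattice O (tensor M N) := by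
  obtain ⟨n, ⟨b⟩⟩ := hM.exists_rightBasis
  have := hM.finite
  have := hN.finiteΛ
  have := hN.projective
  exact ⟨SymAlg.finiteO (SymAlg.tensor M N), b.projectiveO_tensor N⟩

theorem isZero_dual {M : BimodCat O A B} (hM : IsZero M) : IsZero (dual M) := by
  rw [IsZero.iff_id_eq_zero, ← dualMap_id, hM.eq_of_src (𝟙 M) 0, dualMap_zero]

theorem IsLatticeComplex.dual {X : CochainComplex (BimodCat O A B) ℤ}
    (hX : IsLatticeComplex O X) : IsLatticeComplex O (dualComplex X) :=
  ⟨(hX.bounded.preimage (neg_injective (G := ℤ)).injOn).subset fun _ hi h => hi (isZero_dual h),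
    fun i => (hX.term (-i)).dual⟩

/-- Degree n is a finite sum of the Xⁱ ⊗_B Yⁿ⁻ⁱ, each a lattice because Xⁱ is finitely generated
projective on the right. It vanishes unless n is the sum of a degree in the support of X and one in
the support of Y. -/
theorem IsLatticeComplex.tensor [Module.Finite O A] [Module.Finite O B]
    [Module.Finite O C] {X : CochainComplex (BimodCat O A B) ℤ} (hXb : IsBounded X)
    (hX : ∀ i, IsBiprojective (X.X i)) {Y : CochainComplex (BimodCat O B C) ℤ}
    (hY : IsLatticeComplex O Y) : IsLatticeComplex O (tensorComplex X Y) := by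
  have key (n : ℤ) := sum_proj_ι (tensorBifunctor O A B C) X Y hXb.toFinset
    (fun i hi => not_not.1 fun h => hi (hXb.mem_toFinset.2 h)) n
  refine ⟨(Set.Finite.image2 (· + ·) hXb hY.bounded).subset fun n hn => ?_, fun n =>
    .of_sum _ _ _ (key n) fun i => (hX i).isLattice_tensor (hY.term (n - i))⟩
  by_contra h
  refine hn ((IsZero.iff_id_eq_zero _).2 ((key n).symm.trans (Finset.sum_eq_zero fun i hi => ?_)))
  have hi' : ¬ IsZero (X.X i) := hXb.mem_toFinset.1 hi
  have hj : IsZero (Y.X (n - i)) := by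
    by_contra hj
    exact h ⟨i, hi', n - i, hj, add_sub_cancel i n⟩
  have : IsZero (((tensorBifunctor O A B C).obj (X.X i)).obj (Y.X (n - i))) :=
    ((tensorBifunctor O A B C).obj (X.X i)).map_isZero hj
  rw [this.eq_of_tgt (mapBifunctorProj _ _ _ _ _ _ _) 0, zero_comp]

end Bimodules

attribute [local instance] moduleO isScalarTowerO

/-! ### Faithfully flat descent -/

section Descent

variable {O : Type u} [CommRing O] {O' : Type u} [CommRing O'] [Algebra O O']

/-- The class of x in K / L(H) dies in O' ⊗ (K / L(H)), and faithful flatness makes the map K / L(H)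
→ O' ⊗ (K / L(H)) injective. -/
theorem mem_range_of_baseChange [Module.FaithfullyFlat O O'] {H K : Type*} [AddCommGroup H]
    [Module O H] [AddCommGroup K] [Module O K] (L : H →ₗ[O] K) (x : K)
    (h : (1 : O') ⊗ₜ[O] x ∈ LinearMap.range (L.baseChange O')) : x ∈ LinearMap.range L := by
  rw [← Submodule.ker_mkQ (LinearMap.range L), LinearMap.mem_ker]
  refine Module.FaithfullyFlat.tensorProduct_mk_injective (A := O) (B := O') (K ⧸ LinearMap.range L) ?_
  obtain ⟨y, hy⟩ := h
  have hz : (LinearMap.range L).mkQ.baseChange O' (L.baseChange O' y) = 0 := by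
    rw [← LinearMap.comp_apply, ← LinearMap.baseChange_comp, LinearMap.range_mkQ_comp,
      LinearMap.baseChange_zero, LinearMap.zero_apply]
  rw [hy, LinearMap.baseChange_tmul] at hz
  change (1 : O') ⊗ₜ[O] (LinearMap.range L).mkQ x = 1 ⊗ₜ 0
  rw [hz, TensorProduct.tmul_zero]

/-- Solvability of linear equations descends along faithfully flat extensions. -/
theorem IsExtension.mem_range [Module.FaithfullyFlat O O'] {H K H' K' : Type*} [AddCommGroup H]
    [Module O H] [AddCommGroup K] [Module O K] [AddCommGroup H']
    [Module O' H'] [AddCommGroup K'] [Module O' K'] {φ : H → H'} {ψ : K → K'}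
    (hφ : IsExtension O O' φ) (hψ : IsExtension O O' ψ) (L : H →ₗ[O] K) (L' : H' →ₗ[O'] K')
    (hL : ∀ x, L' (φ x) = ψ (L x)) (x : K) (hx : ψ x ∈ LinearMap.range L') :
    x ∈ LinearMap.range L := by
  obtain ⟨θ, hθ, hθ'⟩ := hφ
  obtain ⟨η, hη, hη'⟩ := hψ
  refine mem_range_of_baseChange (O' := O') L x ?_
  have key : L' ∘ₗ θ = η ∘ₗ L.baseChange O' := by
    refine LinearMap.ext fun z => ?_
    induction z with
    | zero => rw [map_zero, map_zero]
    | add x y hx hy => rw [map_add, map_add, hx, hy]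
    | tmul c y =>
      have h : c ⊗ₜ[O] y = c • ((1 : O') ⊗ₜ[O] y) := by rw [smul_tmul', smul_eq_mul, mul_one]
      rw [h, map_smul, map_smul, LinearMap.comp_apply, LinearMap.comp_apply, hθ',
        LinearMap.baseChange_tmul, hη', hL]
  obtain ⟨y, hy⟩ := hx
  obtain ⟨z, rfl⟩ := hθ.surjective y
  refine ⟨z, hη.injective ?_⟩
  rw [hη', ← hy]
  exact (LinearMap.congr_fun key z).symm

end Descent

section Projectivity

variable {O : Type u} [CommRing O]
variable {A : Type u} [Ring A] [Algebra O A] {B : Type u} [Ring B] [Algebra O B]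
variable (O' : Type u) [CommRing O'] [Algebra O O']

/-! ### Projective bimodules and extension of scalars -/

theorem baseChangeMap_surjective {M N : BimodCat O A B} (p : M ⟶ N)
    (hp : Function.Surjective p.hom) : Function.Surjective (baseChangeMap O' p).hom :=
  LinearMap.lTensor_surjective (g := homO (O := O) p) O' hp

theorem exists_section_of_projective {Λ : Type u} [Ring Λ] {F Y : ModuleCat.{u} Λ} (p : F ⟶ Y)
    (hp : Function.Surjective p.hom) (h : Module.Projective Λ Y) : ∃ s : Y ⟶ F, s ≫ p = 𝟙 Y := by
  obtain ⟨s, hs⟩ := Module.projective_lifting_property p.hom LinearMap.id hp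
  exact ⟨ModuleCat.ofHom s, ModuleCat.hom_ext hs⟩

theorem moduleO_one_smul {Λ : Type u} [Ring Λ] [Algebra O Λ] (V : ModuleCat.{u} Λ) (v : V) :
    (1 : O) • v = v := one_smul O v

/-- A section of p is a solution s of the linear equation `s ≫ p = 𝟙 Y`. Projectivity of Y' solves
it over O', and solvability descends. -/
theorem exists_section_of_baseChange [Module.FaithfullyFlat O O'] [IsLocalRing O]
    [Module.Finite O A] [Module.Finite O B] {F Y : BimodCat O A B} (hY : IsLattice O Y) (p : F ⟶ Y)
    (hp : Function.Surjective p.hom)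
    (h : Module.Projective ((O' ⊗[O] A) ⊗[O'] (O' ⊗[O] B)ᵐᵒᵖ) (baseChange O' Y)) :
    ∃ s : Y ⟶ F, s ≫ p = 𝟙 Y := by
  have := hY.finite
  have := hY.free
  refine IsExtension.mem_range (isExtension_baseChangeMap O' Y F)
    (isExtension_baseChangeMap O' Y Y) (Linear.rightComp O Y p)
    (Linear.rightComp O' (baseChange O' Y) (baseChangeMap O' p))
    (fun s => ((baseChangeFunctor O A B O').map_comp s p).symm) (𝟙 Y) ?_
  obtain ⟨s, hs⟩ := exists_section_of_projective (baseChangeMap O' p)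
    (baseChangeMap_surjective O' p hp) h
  exact ⟨s, hs.trans ((baseChangeFunctor O A B O').map_id Y).symm⟩

/-- Projectivity of bimodules descends. -/
theorem projective_of_baseChange [Module.FaithfullyFlat O O'] [IsLocalRing O]
    [Module.Finite O A] [Module.Finite O B] {Y : BimodCat O A B} (hY : IsLattice O Y)
    (h : Module.Projective ((O' ⊗[O] A) ⊗[O'] (O' ⊗[O] B)ᵐᵒᵖ) (baseChange O' Y)) :
    Module.Projective (A ⊗[O] Bᵐᵒᵖ) Y := by
  have := hY.finiteΛ
  obtain ⟨n, f, hf⟩ := Module.Finite.exists_fin' (A ⊗[O] Bᵐᵒᵖ) Y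
  obtain ⟨s, hs⟩ := exists_section_of_baseChange O' hY (ModuleCat.ofHom f) hf h
  exact Module.Projective.of_split s.hom f (congrArg ModuleCat.Hom.hom hs)

variable (O A B) in
/-- The ring homomorphism `A ⊗ Bᵐᵒᵖ → A' ⊗ B'ᵐᵒᵖ`. -/
def envelopingMap : A ⊗[O] Bᵐᵒᵖ →ₐ[O] (O' ⊗[O] A) ⊗[O'] (O' ⊗[O] B)ᵐᵒᵖ :=
  Algebra.TensorProduct.lift
    ((Algebra.TensorProduct.includeLeft :
      O' ⊗[O] A →ₐ[O'] (O' ⊗[O] A) ⊗[O'] (O' ⊗[O] B)ᵐᵒᵖ).restrictScalars O |>.comp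
      Algebra.TensorProduct.includeRight)
    (((Algebra.TensorProduct.includeRight :
      (O' ⊗[O] B)ᵐᵒᵖ →ₐ[O'] (O' ⊗[O] A) ⊗[O'] (O' ⊗[O] B)ᵐᵒᵖ).restrictScalars O).comp
      (AlgHom.op Algebra.TensorProduct.includeRight))
    fun a b => by
      change (((1 : O') ⊗ₜ[O] a) ⊗ₜ[O'] (1 : (O' ⊗[O] B)ᵐᵒᵖ)) * _ =
        _ * (((1 : O') ⊗ₜ[O] a) ⊗ₜ[O'] (1 : (O' ⊗[O] B)ᵐᵒᵖ))
      change _ * ((1 : O' ⊗[O] A) ⊗ₜ[O'] (op ((1 : O') ⊗ₜ[O] b.unop))) =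
        ((1 : O' ⊗[O] A) ⊗ₜ[O'] (op ((1 : O') ⊗ₜ[O] b.unop))) * _
      simp only [Algebra.TensorProduct.tmul_mul_tmul, one_mul, mul_one]

theorem envelopingMap_left (a : A) : envelopingMap O A B O' (a ⊗ₜ 1) = (1 ⊗ₜ a) ⊗ₜ 1 := by
  refine (Algebra.TensorProduct.lift_tmul _ _ _ _ _).trans ?_
  rw [map_one, mul_one]
  rfl

theorem envelopingMap_right (b : B) :
    envelopingMap O A B O' (1 ⊗ₜ op b) = 1 ⊗ₜ op (1 ⊗ₜ b) := by
  refine (Algebra.TensorProduct.lift_tmul _ _ _ _ _).trans ?_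
  rw [map_one, one_mul]
  rfl

variable {O'}

/-- The `Λ`-action on `Y` and the `Λ'`-action on `Y'`. -/
theorem envelopingMap_smul_bmk (Y : BimodCat O A B) (x : A ⊗[O] Bᵐᵒᵖ) (y : Y) :
    envelopingMap O A B O' x • bmk O' Y 1 y = bmk O' Y 1 (x • y) := by
  induction x with
  | zero =>
    rw [map_zero]
    refine (zero_smul ((O' ⊗[O] A) ⊗[O'] (O' ⊗[O] B)ᵐᵒᵖ) (bmk O' Y 1 y)).trans ?_
    refine Eq.trans (map_zero (bmkHom O' Y)).symm ?_
    exact congrArg (bmk O' Y 1) (zero_smul (A ⊗[O] Bᵐᵒᵖ) y).symm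
  | add x x' hx hx' => rw [map_add, add_smul, add_smul, bmk_add, hx, hx']
  | tmul a b =>
    obtain ⟨b, rfl⟩ := op_surjective b
    have h : a ⊗ₜ[O] op b = (a ⊗ₜ[O] (1 : Bᵐᵒᵖ)) * ((1 : A) ⊗ₜ[O] op b) := by
      rw [Algebra.TensorProduct.tmul_mul_tmul, one_mul, mul_one]
    rw [h, map_mul, mul_smul, mul_smul, envelopingMap_left, envelopingMap_right]
    have h1 := rightAct_bmk (O' := O') Y 1 1 b y
    have h2 := leftAct_bmk (O' := O') Y 1 1 a (rightAct Y (op b) y)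
    rw [mul_one] at h1 h2
    refine (congrArg (fun z => leftAct (baseChange O' Y) (1 ⊗ₜ a) z) h1).trans h2

variable (O')

/-- Projectivity of bimodules is preserved by extension of scalars. -/
theorem projective_baseChange {Y : BimodCat O A B} (hf : Module.Finite (A ⊗[O] Bᵐᵒᵖ) Y)
    (h : Module.Projective (A ⊗[O] Bᵐᵒᵖ) Y) :
    Module.Projective ((O' ⊗[O] A) ⊗[O'] (O' ⊗[O] B)ᵐᵒᵖ) (baseChange O' Y) := by
  obtain ⟨n, x, φ, hx⟩ := exists_dualBasis hf h
  let N : BimodCat O' (O' ⊗[O] A) (O' ⊗[O] B) := ModuleCat.of _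
    ((O' ⊗[O] A) ⊗[O'] (O' ⊗[O] B)ᵐᵒᵖ)
  -- The extended dual basis: follow each coordinate by the map of enveloping algebras, then extend
  -- to Y' by adjunction. The vectors become 1 ⊗ xᵢ.
  let g (i : Fin n) : Y →+ N := (envelopingMap O A B O').toRingHom.toAddMonoidHom.comp
    (φ i).toAddMonoidHom
  have hg (i : Fin n) (z : A ⊗[O] Bᵐᵒᵖ) (y : Y) : g i (z • y) = envelopingMap O A B O' z • g i y := by
    change envelopingMap O A B O' (φ i (z • y)) = envelopingMap O A B O' z * envelopingMap O A B O' (φ i y)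
    rw [map_smul, smul_eq_mul, map_mul]
  let ψ (i : Fin n) : baseChange O' Y ⟶ N := baseChangeLift (g i)
    (fun a y => (hg i (a ⊗ₜ 1) y).trans (congrArg (· • g i y) (envelopingMap_left O' a)))
    (fun b y => (hg i (1 ⊗ₜ op b) y).trans (congrArg (· • g i y) (envelopingMap_right O' b)))
  refine projective_of_dualBasis (fun i => bmk O' Y 1 (x i)) (fun i => (ψ i).hom) fun z => ?_
  have key : ∑ i, ψ i ≫ ModuleCat.ofHom (LinearMap.toSpanSingleton _ _ (bmk O' Y 1 (x i))) = 𝟙 _ := by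
    refine baseChange_hom_ext fun y => ?_
    rw [ModuleCat.hom_sum, LinearMap.sum_apply]
    have h1 (i : Fin n) : (ψ i ≫ ModuleCat.ofHom (LinearMap.toSpanSingleton _ _
        (bmk O' Y 1 (x i)))).hom (bmk O' Y 1 y) = bmkHom O' Y (φ i y • x i) := by
      change (ψ i).hom (bmk O' Y 1 y) • bmk O' Y 1 (x i) = _
      have h2 : (ψ i).hom (bmk O' Y 1 y) = envelopingMap O A B O' (φ i y) :=
        (baseChangeLift_bmk (g i) _ _ 1 y).trans (moduleO_one_smul N (g i y))
      rw [h2]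
      exact envelopingMap_smul_bmk Y (φ i y) (x i)
    simp only [h1]
    rw [← map_sum, hx]
    rfl
  have := congrArg (fun f : baseChange O' Y ⟶ baseChange O' Y => f.hom z) key
  rw [ModuleCat.hom_sum, LinearMap.sum_apply] at this
  exact this

end Projectivity

/-! ### Contractibility under extension of scalars -/

section Contractibility

variable {O : Type u} [CommRing O] {Λ : Type u} [Ring Λ] [Algebra O Λ]

variable (O) in
/-- The boundary `h ↦ h d + d h` of a family of maps of degree `-1`. -/
def homotopyBoundary (Z : CochainComplex (ModuleCat.{u} Λ) ℤ) :
    (∀ i, Z.X (i + 1) ⟶ Z.X i) →ₗ[O] ∀ i, Z.X (i + 1) ⟶ Z.X (i + 1) where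
  toFun h i := h i ≫ Z.d i (i + 1) + Z.d (i + 1) (i + 1 + 1) ≫ h (i + 1)
  map_add' f g := by
    ext i : 1
    simp only [Pi.add_apply, Preadditive.add_comp, Preadditive.comp_add]
    abel
  map_smul' c f := by
    ext i : 1
    simp only [Pi.smul_apply, Linear.smul_comp, Linear.comp_smul, RingHom.id_apply, smul_add]

/-- A contraction is a solution of the linear equation h d + d h = 1. Indexing by the upper degree i
+ 1 gives h the components Z.X (i + 1) → Z.X i without transport along equalities of degrees. -/
theorem isContractible_iff (Z : CochainComplex (ModuleCat.{u} Λ) ℤ) :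
    IsContractible Z ↔ (fun i => 𝟙 (Z.X (i + 1))) ∈ LinearMap.range (homotopyBoundary O Z) := by
  constructor
  · rintro ⟨h⟩
    refine ⟨fun i => h.hom (i + 1) i, funext fun i => ?_⟩
    have := h.comm (i + 1)
    rw [dNext_eq h.hom (rfl : (i + 1) + 1 = (i + 1 + 1)), prevD_eq h.hom (rfl : i + 1 = i + 1)] at this
    change h.hom (i + 1) i ≫ Z.d i (i + 1) + _ = _
    rw [HomologicalComplex.zero_f, add_zero, HomologicalComplex.id_f] at this
    rw [this]
    exact add_comm _ _
  · rintro ⟨h, hh⟩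
    have hz (i : ℤ) : h i ≫ Z.d i (i + 1) + Z.d (i + 1) (i + 1 + 1) ≫ h (i + 1) = 𝟙 _ :=
      congrFun hh i
    -- A `Homotopy` has components for all pairs of degrees; those not lowering the degree by one
    -- are set to zero.
    let k (i j : ℤ) : Z.X i ⟶ Z.X j :=
      if e : j + 1 = i then eqToHom (congrArg Z.X e.symm) ≫ h j else 0
    have hk (j : ℤ) : k (j + 1) j = h j := by
      simp only [k, dif_pos, eqToHom_refl, Category.id_comp]
    refine ⟨⟨k, fun i j hij => dif_neg hij, fun i => ?_⟩⟩
    obtain ⟨i, rfl⟩ : ∃ j, i = j + 1 := ⟨i - 1, by omega⟩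
    rw [dNext_eq k (rfl : (i + 1) + 1 = (i + 1 + 1)), prevD_eq k (rfl : i + 1 = i + 1), hk, hk,
      HomologicalComplex.zero_f, add_zero, HomologicalComplex.id_f]
    exact (hz i).symm.trans (add_comm _ _)

variable {A : Type u} [Ring A] [Algebra O A] {B : Type u} [Ring B] [Algebra O B]
variable (O' : Type u) [CommRing O'] [Algebra O O']

theorem IsContractible.baseChange {Z : CochainComplex (BimodCat O A B) ℤ} (hZ : IsContractible Z) :
    IsContractible (baseChangeComplex O' Z) := by
  obtain ⟨h⟩ := hZ
  have := (baseChangeFunctor O A B O').mapHomotopy h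
  rw [CategoryTheory.Functor.map_id, Functor.map_zero] at this
  exact ⟨this⟩

/-- Contractibility of complexes descends. -/
theorem isContractible_of_baseChange [Module.FaithfullyFlat O O'] [IsLocalRing O]
    [Module.Finite O A] [Module.Finite O B] {Z : CochainComplex (BimodCat O A B) ℤ}
    (hZ : IsLatticeComplex O Z) (h : IsContractible (baseChangeComplex O' Z)) :
    IsContractible Z := by
  have (i : ℤ) := (hZ.term i).finite
  have (i : ℤ) := (hZ.term i).free
  have hb : {i : ℤ | ¬ IsZero (Z.X (i + 1))}.Finite :=
    hZ.bounded.preimage (add_left_injective (1 : ℤ)).injOn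
  rw [isContractible_iff (O := O)]
  rw [isContractible_iff (O := O')] at h
  -- All but finitely many sources Z.X (i + 1) vanish, so the products of Hom-modules extend to O'
  -- and the linear equation for h descends.
  refine IsExtension.mem_range
    (IsExtension.pi_of_finite (fun i => isExtension_baseChangeMap O' (Z.X (i + 1)) (Z.X i)) hb
      fun i hi => subsingleton_hom_of_isZero (not_not.1 hi))
    (IsExtension.pi_of_finite (fun i => isExtension_baseChangeMap O' (Z.X (i + 1)) (Z.X (i + 1))) hb
      fun i hi => subsingleton_hom_of_isZero (not_not.1 hi))
    (homotopyBoundary O Z) (homotopyBoundary O' (baseChangeComplex O' Z)) (fun k => ?_) _ ?_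
  · ext i : 1
    change (baseChangeFunctor O A B O').map _ ≫ (baseChangeFunctor O A B O').map _ +
      (baseChangeFunctor O A B O').map _ ≫ (baseChangeFunctor O A B O').map _ =
      (baseChangeFunctor O A B O').map (_ + _)
    rw [Functor.map_add, Functor.map_comp, Functor.map_comp]
  · have e : (fun i => baseChangeMap O' (𝟙 (Z.X (i + 1)))) =
        fun i => 𝟙 ((baseChangeComplex O' Z).X (i + 1)) :=
      funext fun i => (baseChangeFunctor O A B O').map_id (Z.X (i + 1))
    rw [e]
    exact h

end Contractibility

attribute [local instance] moduleO isScalarTowerO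

/-! ### Classes of biprojective bimodules -/

section ProjGroup

variable {O : Type u} [CommRing O]
variable {A : Type u} [Ring A] [Algebra O A] {B : Type u} [Ring B] [Algebra O B]

theorem sub_mem_projGroup {M N : BimodCat O A B} [Module.Finite (A ⊗[O] Bᵐᵒᵖ) M]
    [Module.Finite (A ⊗[O] Bᵐᵒᵖ) N] (hM : IsBiprojective M) (hN : IsBiprojective N) :
    cls M - cls N ∈ projGroup O A B :=
  sub_mem (AddSubgroup.subset_closure ⟨M, hM, rfl⟩) (AddSubgroup.subset_closure ⟨N, hN, rfl⟩)

theorem IsBiprojective.of_iso {M N : BimodCat O A B} (e : M ≅ N) (hM : IsBiprojective M) :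
    IsBiprojective N := by
  have := hM.finite
  have := hM.left
  have := hM.right
  exact ⟨finite_of_iso e,
    Module.Projective.of_equiv' ((ModuleCat.restrictScalars _).mapIso e).toLinearEquiv,
    Module.Projective.of_equiv' ((ModuleCat.restrictScalars _).mapIso e).toLinearEquiv⟩

end ProjGroup

section Equivalences

variable {O : Type u} [CommRing O] [IsLocalRing O] [IsNoetherianRing O]
variable {A : Type u} [Ring A] [Algebra O A] {B : Type u} [Ring B] [Algebra O B]
variable {C : Type u} [Ring C] [Algebra O C]
variable (O' : Type u) [CommRing O'] [IsLocalRing O'] [Algebra O O']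
  [IsLocalHom (algebraMap O O')] [Module.Flat O O']

/-! ### Direct summands of lattices -/

/-- Direct sum decompositions of lattices descend. -/
theorem IsLattice.exists_biprod_iso [IsNoetherianRing O'] [Module.Finite O A] [Module.Finite O B] {P Q : BimodCat O A B}
    (hP : IsLattice O P) (hQ : IsLattice O Q) {R : BimodCat O' (O' ⊗[O] A) (O' ⊗[O] B)}
    (e : SymAlg.baseChange O' Q ≅ SymAlg.baseChange O' P ⊞ R) :
    ∃ Y, Nonempty (Q ≅ P ⊞ Y) ∧ Nonempty (SymAlg.baseChange O' Y ≅ R) := by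
  -- The sum P ⊞ Q is the common object in whose endomorphism ring the idempotents of P and Q are
  -- compared.
  have hZ := hP.biprod hQ
  have := hZ.finite
  have := hZ.free
  have := hZ.finiteΛ
  have : Module.Finite O (End (P ⊞ Q)) := finite_hom _ _
  exact exists_biprod_iso_of_map_iso (baseChangeFunctor O A B O') (retractInl P Q) (retractInr P Q)
    (isExtension_baseChangeMap O' (P ⊞ Q) (P ⊞ Q)) e

/-- Isomorphy of lattices descends. -/
theorem IsLattice.nonempty_iso [Module.Finite O A] [Module.Finite O B] {P Q : BimodCat O A B}
    (hP : IsLattice O P) (hQ : IsLattice O Q) (e : SymAlg.baseChange O' P ≅ SymAlg.baseChange O' Q) :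
    Nonempty (P ≅ Q) := by
  have hZ := hP.biprod hQ
  have := hZ.finite
  have := hZ.free
  have := hZ.finiteΛ
  have : Module.Finite O (End (P ⊞ Q)) := finite_hom _ _
  exact nonempty_iso_of_map_iso (baseChangeFunctor O A B O') (retractInl P Q) (retractInr P Q)
    (isExtension_baseChangeMap O' (P ⊞ Q) (P ⊞ Q)) e

variable [IsNoetherianRing O']

/-- Direct sum decompositions of complexes of lattices descend. -/
theorem IsLatticeComplex.exists_biprod_iso [Module.Finite O A] [Module.Finite O B]
    {P Q : CochainComplex (BimodCat O A B) ℤ}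
    (hP : IsLatticeComplex O P) (hQ : IsLatticeComplex O Q)
    {R : CochainComplex (BimodCat O' (O' ⊗[O] A) (O' ⊗[O] B)) ℤ}
    (e : baseChangeComplex O' Q ≅ baseChangeComplex O' P ⊞ R) :
    ∃ Y, Nonempty (Q ≅ P ⊞ Y) ∧ Nonempty (baseChangeComplex O' Y ≅ R) := by
  have hZ := hP.biprod hQ
  have (i : ℤ) := (hZ.term i).finite
  have (i : ℤ) := (hZ.term i).free
  have (i : ℤ) := (hZ.term i).finiteΛ
  have : Module.Finite O (End (P ⊞ Q)) := finite_complexHom _ _ hZ.bounded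
  exact exists_biprod_iso_of_map_iso
    ((baseChangeFunctor O A B O').mapHomologicalComplex (ComplexShape.up ℤ))
    (retractInl P Q) (retractInr P Q)
    (isExtension_baseChangeComplexMap O' (P ⊞ Q) (P ⊞ Q) hZ.bounded) e

/-! ### Stable equivalences -/

/-- Over O' the complement is U. Descent yields W ≅ A ⊕ Y with Y' ≅ U, and projectivity of Y'
descends to the lattice Y. Conversely a projective complement extends to a projective complement. -/
theorem exists_projective_complement_iff [Module.Finite O A] [Module.Free O A] {W : BimodCat O A A}
    (hW : IsLattice O W) :
    (∃ U : BimodCat O' (O' ⊗[O] A) (O' ⊗[O] A),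
      Module.Projective ((O' ⊗[O] A) ⊗[O'] (O' ⊗[O] A)ᵐᵒᵖ) U ∧
      Nonempty (baseChange O' W ≅ regular O' (O' ⊗[O] A) ⊞ U)) ↔
    ∃ U : BimodCat O A A, Module.Projective (A ⊗[O] Aᵐᵒᵖ) U ∧
      Nonempty (W ≅ regular O A ⊞ U) := by
  have : Module.FaithfullyFlat O O' := Module.FaithfullyFlat.of_flat_of_isLocalHom
  constructor
  · rintro ⟨U, hU, ⟨e⟩⟩
    obtain ⟨Y, ⟨i⟩, ⟨j⟩⟩ := isLattice_regular.exists_biprod_iso O' hW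
      (e ≪≫ biprod.mapIso (baseChangeRegular O A O').symm (Iso.refl U))
    refine ⟨Y, ?_, ⟨i⟩⟩
    exact projective_of_baseChange O' (hW.of_retract ((retractInr _ _).trans (Retract.ofIso i.symm)))
      (Module.Projective.of_equiv' j.symm.toLinearEquiv)
  · rintro ⟨U, hU, ⟨e⟩⟩
    have hU' : IsLattice O U := hW.of_retract ((retractInr _ _).trans (Retract.ofIso e.symm))
    exact ⟨baseChange O' U, projective_baseChange O' hU'.finiteΛ hU,
      ⟨(baseChangeFunctor O A A O').mapIso e ≪≫ mapBiprodIso (baseChangeFunctor O A A O') _ _ ≪≫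
        biprod.mapIso (baseChangeRegular O A O') (Iso.refl _)⟩⟩

/-- Extension of scalars commutes with tensor products, up to isomorphisms of the factors. -/
def tensorBaseChangeIso {M : BimodCat O A B} {N : BimodCat O B C}
    {M' : BimodCat O' (O' ⊗[O] A) (O' ⊗[O] B)} {N' : BimodCat O' (O' ⊗[O] B) (O' ⊗[O] C)}
    (e : M' ≅ baseChange O' M) (f : N' ≅ baseChange O' N) :
    tensor M' N' ≅ baseChange O' (tensor M N) :=
  ((tensorBifunctor O' (O' ⊗[O] A) (O' ⊗[O] B) (O' ⊗[O] C)).mapIso e).app N' ≪≫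
    ((tensorBifunctor O' (O' ⊗[O] A) (O' ⊗[O] B) (O' ⊗[O] C)).obj _).mapIso f ≪≫
    tensorBaseChange O' M N

variable [Module.Finite O A] [Module.Free O A] [Module.Finite O B] [Module.Free O B]

/-- The isomorphism `(M')^∨ ≅ (M^∨)'` for a lattice `M`. -/
def IsLattice.dualBaseChangeIso {M : BimodCat O A B} (hM : IsLattice O M) :
    SymAlg.dual (SymAlg.baseChange O' M) ≅ SymAlg.baseChange O' (SymAlg.dual M) :=
  have := hM.finite
  have := hM.free
  (dualBaseChange O' M).symm

theorem exists_iso_congr {Λ : Type u} [Ring Λ] {W W' P : ModuleCat.{u} Λ} (e : W ≅ W')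
    (p : ModuleCat.{u} Λ → Prop) :
    (∃ U, p U ∧ Nonempty (W ≅ P ⊞ U)) ↔ ∃ U, p U ∧ Nonempty (W' ≅ P ⊞ U) :=
  exists_congr fun _ => and_congr_right fun _ => ⟨fun ⟨i⟩ => ⟨e.symm ≪≫ i⟩, fun ⟨i⟩ => ⟨e ≪≫ i⟩⟩

/-- The bimodules M ⊗_B M^∨ and M^∨ ⊗_A M are lattices compatible with extension of scalars, so the
two conditions descend separately. -/
theorem inducesStableEquivalence_baseChange_iff (hA : IsSymmetric O A) (hB : IsSymmetric O B)
    {M : BimodCat O A B} (hM : IsBiprojective M) :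
    InducesStableEquivalence (baseChange O' M) ↔ InducesStableEquivalence M := by
  have hd := hM.dual hA hB
  refine and_congr ?_ ?_
  · rw [exists_iso_congr (tensorBaseChangeIso O' (Iso.refl _) (hM.isLattice.dualBaseChangeIso O'))]
    exact exists_projective_complement_iff O' (hM.isLattice_tensor hd.isLattice)
  · rw [exists_iso_congr (tensorBaseChangeIso O' (hM.isLattice.dualBaseChangeIso O') (Iso.refl _))]
    exact exists_projective_complement_iff O' (hd.isLattice_tensor hM.isLattice)

/-! ### Rickard equivalences -/

/-- The same argument as for projective complements, now with chain maps and with the descent of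
contractibility. The isomorphism w absorbs the passage from dualizing over O' to dualizing over O.
-/
theorem exists_contractible_complement_iff {W : CochainComplex (BimodCat O A A) ℤ}
    (hW : IsLatticeComplex O W) {W' : CochainComplex (BimodCat O' (O' ⊗[O] A) (O' ⊗[O] A)) ℤ}
    (w : W' ≅ baseChangeComplex O' W) :
    (∃ Y, IsContractible Y ∧ Nonempty (W' ≅ regularComplex O' (O' ⊗[O] A) ⊞ Y)) ↔
    ∃ Y, IsContractible Y ∧ Nonempty (W ≅ regularComplex O A ⊞ Y) := by
  have : Module.FaithfullyFlat O O' := Module.FaithfullyFlat.of_flat_of_isLocalHom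
  let F := (baseChangeFunctor O A A O').mapHomologicalComplex (ComplexShape.up ℤ)
  constructor
  · rintro ⟨U, hU, ⟨e⟩⟩
    have hr : IsLatticeComplex O (regularComplex O A) := .single isLattice_regular
    obtain ⟨Y, ⟨i⟩, ⟨j⟩⟩ := hr.exists_biprod_iso O' hW
      (w.symm ≪≫ e ≪≫ biprod.mapIso (baseChangeRegularComplex O A O').symm (Iso.refl U))
    refine ⟨Y, ?_, ⟨i⟩⟩
    refine isContractible_of_baseChange O'
      (hW.of_retract ((retractInr _ _).trans (Retract.ofIso i.symm))) ?_
    obtain ⟨h⟩ := hU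
    -- The contraction of U is conjugated by j to one of Y'.
    refine ⟨(Homotopy.ofEq ?_).trans (((h.compLeft j.hom).compRight j.inv).trans (Homotopy.ofEq ?_))⟩
    · simp
    · simp
  · rintro ⟨U, hU, ⟨e⟩⟩
    have : PreservesBinaryBiproducts F := preservesBinaryBiproducts_of_preservesBiproducts F
    exact ⟨baseChangeComplex O' U, hU.baseChange O',
      ⟨w ≪≫ F.mapIso e ≪≫ F.mapBiprod _ _ ≪≫
        biprod.mapIso (baseChangeRegularComplex O A O') (Iso.refl _)⟩⟩

theorem inducesRickardEquivalence_baseChange_iff (hA : IsSymmetric O A) (hB : IsSymmetric O B)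
    {X : CochainComplex (BimodCat O A B) ℤ} (hXb : IsBounded X)
    (hX : ∀ n, IsBiprojective (X.X n)) :
    InducesRickardEquivalence (baseChangeComplex O' X) ↔ InducesRickardEquivalence X := by
  have hL : IsLatticeComplex O X := ⟨hXb, fun i => (hX i).isLattice⟩
  let d := (dualBaseChangeComplex O' X (fun i => (hL.term i).finite) fun i => (hL.term i).free).symm
  have hd (n : ℤ) : IsBiprojective ((dualComplex X).X n) := (hX (-n)).dual hA hB
  refine and_congr ?_ ?_
  · exact exists_contractible_complement_iff O' (.tensor hXb hX hL.dual)
      (((tensorBifunctor O' (O' ⊗[O] A) (O' ⊗[O] B) (O' ⊗[O] A)).map₂CochainComplex.obj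
        (baseChangeComplex O' X)).mapIso d ≪≫ tensorBaseChangeComplex O' X (dualComplex X) hXb)
  · exact exists_contractible_complement_iff O' (.tensor hL.dual.bounded hd hL)
      ((((tensorBifunctor O' (O' ⊗[O] B) (O' ⊗[O] A) (O' ⊗[O] B)).map₂CochainComplex.mapIso d).app
        (baseChangeComplex O' X)) ≪≫ tensorBaseChangeComplex O' (dualComplex X) X hL.dual.bounded)

/-! ### Virtual Morita equivalences -/

/-- Equality of classes means R ⊕ P ≅ R ⊕ Q for some finitely generated R. Over a local noetherian
base R can be cancelled. -/
theorem cls_eq_iff {Λ : Type u} [Ring Λ] [Algebra O Λ] [Module.Finite O Λ] (P Q : ModuleCat.{u} Λ)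
    [Module.Finite Λ P] [Module.Finite Λ Q] : cls P = cls Q ↔ Nonempty (P ≅ Q) := by
  constructor
  · intro h
    obtain ⟨⟨c, _⟩, hc⟩ :=
      (AddLocalization.addMonoidOf (⊤ : AddSubmonoid (IsoClass Λ))).eq_iff_exists.1 h
    replace hc : c + isoClass P = c + isoClass Q := hc
    revert hc
    refine IsoClass.ind (p := fun c => c + isoClass P = c + isoClass Q → Nonempty (P ≅ Q))
      (fun R hR hc => ?_) c
    rw [isoClass_add, isoClass_add, isoClass_eq_iff] at hc
    obtain ⟨e⟩ := hc
    have : Module.Finite O (End ((P ⊞ Q) ⊞ R)) := finite_hom _ _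
    exact nonempty_iso_of_biprod_iso O (biprod.braiding P R ≪≫ e ≪≫ biprod.braiding R Q)
  · rintro ⟨e⟩
    exact congrArg _ (isoClass_eq_iff.2 ⟨e⟩)

theorem cls_biprod {Λ : Type u} [Ring Λ] (P Q : ModuleCat.{u} Λ) [Module.Finite Λ P]
    [Module.Finite Λ Q] : cls (P ⊞ Q) = cls P + cls Q :=
  map_add Algebra.GrothendieckAddGroup.of (isoClass P) (isoClass Q)

end Equivalences

section Virtual

variable {O : Type u} [CommRing O] [IsLocalRing O] [IsNoetherianRing O]
variable {A : Type u} [Ring A] [Algebra O A] {B : Type u} [Ring B] [Algebra O B]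
  [Module.Finite O A] [Module.Finite O B]

/-- Expand the product biadditively and move the negative terms across. Both sides become classes of
actual bimodules, which are equal only if the bimodules are isomorphic. -/
theorem tensorProd_sub_eq_iff (M N : BimodCat O A B) (K L : BimodCat O B A)
    [Module.Finite (A ⊗[O] Bᵐᵒᵖ) M] [Module.Finite (A ⊗[O] Bᵐᵒᵖ) N]
    [Module.Finite (B ⊗[O] Aᵐᵒᵖ) K] [Module.Finite (B ⊗[O] Aᵐᵒᵖ) L] :
    tensorProd (cls M - cls N) (cls K - cls L) = cls (regular O A) ↔
      Nonempty (tensor M K ⊞ tensor N L ≅ regular O A ⊞ (tensor M L ⊞ tensor N K)) := by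
  rw [← cls_eq_iff (O := O), cls_biprod, cls_biprod, cls_biprod, map_sub, map_sub,
    AddMonoidHom.sub_apply, AddMonoidHom.sub_apply, tensorProd_cls, tensorProd_cls, tensorProd_cls,
    tensorProd_cls]
  constructor
  · intro h
    rw [← h]
    abel
  · intro h
    rw [← sub_eq_iff_eq_add] at h
    rw [← h]
    abel

variable (O' : Type u) [CommRing O'] [IsLocalRing O'] [IsNoetherianRing O'] [Algebra O O']
  [IsLocalHom (algebraMap O O')] [Module.Flat O O'] [Module.Free O A] [Module.Free O B]

/-- Both bimodules in the resulting isomorphism are lattices extended from O, so the isomorphism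
descends. The isomorphisms m, n, k, l allow (M')^∨ to stand in for (M^∨)'. -/
theorem tensorProd_sub_baseChange_eq_iff {M N : BimodCat O A B} {K L : BimodCat O B A}
    (hM : IsBiprojective M) (hN : IsBiprojective N) (hK : IsBiprojective K) (hL : IsBiprojective L)
    [Module.Finite (A ⊗[O] Bᵐᵒᵖ) M] [Module.Finite (A ⊗[O] Bᵐᵒᵖ) N]
    [Module.Finite (B ⊗[O] Aᵐᵒᵖ) K] [Module.Finite (B ⊗[O] Aᵐᵒᵖ) L]
    {M' N' : BimodCat O' (O' ⊗[O] A) (O' ⊗[O] B)} {K' L' : BimodCat O' (O' ⊗[O] B) (O' ⊗[O] A)}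
    [Module.Finite ((O' ⊗[O] A) ⊗[O'] (O' ⊗[O] B)ᵐᵒᵖ) M']
    [Module.Finite ((O' ⊗[O] A) ⊗[O'] (O' ⊗[O] B)ᵐᵒᵖ) N']
    [Module.Finite ((O' ⊗[O] B) ⊗[O'] (O' ⊗[O] A)ᵐᵒᵖ) K']
    [Module.Finite ((O' ⊗[O] B) ⊗[O'] (O' ⊗[O] A)ᵐᵒᵖ) L']
    (m : M' ≅ baseChange O' M) (n : N' ≅ baseChange O' N) (k : K' ≅ baseChange O' K)
    (l : L' ≅ baseChange O' L) :
    tensorProd (cls M' - cls N') (cls K' - cls L') = cls (regular O' (O' ⊗[O] A)) ↔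
      tensorProd (cls M - cls N) (cls K - cls L) = cls (regular O A) := by
  rw [tensorProd_sub_eq_iff, tensorProd_sub_eq_iff]
  let i : tensor M' K' ⊞ tensor N' L' ≅ baseChange O' (tensor M K ⊞ tensor N L) :=
    biprod.mapIso (tensorBaseChangeIso O' m k) (tensorBaseChangeIso O' n l) ≪≫
      (mapBiprodIso (baseChangeFunctor O A A O') _ _).symm
  let j : regular O' (O' ⊗[O] A) ⊞ (tensor M' L' ⊞ tensor N' K') ≅
      baseChange O' (regular O A ⊞ (tensor M L ⊞ tensor N K)) :=
    biprod.mapIso (baseChangeRegular O A O').symm (biprod.mapIso (tensorBaseChangeIso O' m l)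
      (tensorBaseChangeIso O' n k) ≪≫ (mapBiprodIso (baseChangeFunctor O A A O') _ _).symm) ≪≫
      (mapBiprodIso (baseChangeFunctor O A A O') _ _).symm
  constructor
  · rintro ⟨e⟩
    exact IsLattice.nonempty_iso O'
      ((hM.isLattice_tensor hK.isLattice).biprod (hN.isLattice_tensor hL.isLattice))
      (isLattice_regular.biprod
        ((hM.isLattice_tensor hL.isLattice).biprod (hN.isLattice_tensor hK.isLattice)))
      (i.symm ≪≫ e ≪≫ j)
  · rintro ⟨e⟩
    exact ⟨i ≪≫ (baseChangeFunctor O A A O').mapIso e ≪≫ j.symm⟩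

/-- Membership in the projective subgroups holds over both rings, since duals and extensions of
biprojective bimodules are biprojective; only the two product equations have to be compared. -/
theorem induceVirtualMoritaEquivalence_baseChange_iff (hA : IsSymmetric O A) (hB : IsSymmetric O B)
    {M N : BimodCat O A B} [Module.Finite (A ⊗[O] Bᵐᵒᵖ) M] [Module.Finite (A ⊗[O] Bᵐᵒᵖ) N]
    (hM : IsBiprojective M) (hN : IsBiprojective N) :
    InduceVirtualMoritaEquivalence (cls (baseChange O' M) - cls (baseChange O' N))
        (cls (dual (baseChange O' M)) - cls (dual (baseChange O' N))) ↔
      InduceVirtualMoritaEquivalence (cls M - cls N) (cls (dual M) - cls (dual N)) := by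
  have hM' := hM.dual hA hB
  have hN' := hN.dual hA hB
  let m := hM.isLattice.dualBaseChangeIso O'
  let n := hN.isLattice.dualBaseChangeIso O'
  have h1 := sub_mem_projGroup (hM.baseChange O') (hN.baseChange O')
  have h2 := sub_mem_projGroup ((hM'.baseChange O').of_iso m.symm) ((hN'.baseChange O').of_iso n.symm)
  unfold InduceVirtualMoritaEquivalence
  rw [tensorProd_sub_baseChange_eq_iff O' hM hN hM' hN' (Iso.refl _) (Iso.refl _) m n,
    tensorProd_sub_baseChange_eq_iff O' hM' hN' hM hN m n (Iso.refl _) (Iso.refl _)]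
  simp only [h1, h2, sub_mem_projGroup hM hN, sub_mem_projGroup hM' hN']

end Virtual

/-! ### Characterization of Morita equivalences -/

section Morita

variable {O : Type u} [CommRing O]
variable {A : Type u} [Ring A] [Algebra O A] {B : Type u} [Ring B] [Algebra O B]

attribute [local instance] moduleO isScalarTowerO

/-- The element `m ⊗ v` of `M ⊗_B V`. -/
def fmk (M : BimodCat O A B) (V : ModuleCat.{u} B) (m : M) (v : V) : (tensorFunctor M).obj V :=
  btmul (rightAct M) (act V) (outerActLeft M V) m v

theorem fmk_balanced (M : BimodCat O A B) (V : ModuleCat.{u} B) (m : M) (b : B) (v : V) :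
    fmk M V (rightAct M (op b) m) v = fmk M V m (b • v) :=
  btmul_balanced m b v

theorem fmk_add_left (M : BimodCat O A B) (V : ModuleCat.{u} B) (m m' : M) (v : V) :
    fmk M V (m + m') v = fmk M V m v + fmk M V m' v := btmul_add_left m m' v

theorem fmk_add_right (M : BimodCat O A B) (V : ModuleCat.{u} B) (m : M) (v v' : V) :
    fmk M V m (v + v') = fmk M V m v + fmk M V m v' := btmul_add_right m v v'

theorem smul_fmk (M : BimodCat O A B) (V : ModuleCat.{u} B) (a : A) (m : M) (v : V) :
    a • fmk M V m v = fmk M V (leftAct M a m) v := rfl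

theorem fmk_induction {M : BimodCat O A B} {V : ModuleCat.{u} B}
    {p : (tensorFunctor M).obj V → Prop} (h0 : p 0) (ht : ∀ m v, p (fmk M V m v))
    (ha : ∀ x y, p x → p y → p (x + y)) (z) : p z :=
  balanced_induction h0 ht ha z

/-- The biadditive map `(m, v) ↦ m ⊗ v`. -/
def fmkHom (M : BimodCat O A B) (V : ModuleCat.{u} B) : M →+ V →+ (tensorFunctor M).obj V :=
  AddMonoidHom.mk' (fun m => AddMonoidHom.mk' (fmk M V m) (fmk_add_right M V m))
    fun m m' => by
      ext v
      exact fmk_add_left M V m m' v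

theorem fmkHom_apply (M : BimodCat O A B) (V : ModuleCat.{u} B) (m : M) (v : V) :
    fmkHom M V m v = fmk M V m v := rfl

/-- The left module `A` is a direct summand of a direct sum of copies of `M`. -/
def IsGenerator (M : BimodCat O A B) : Prop :=
  ∃ (n : ℕ) (x : Fin n → M) (φ : Fin n → M →+ A),
    (∀ i a m, φ i (leftAct M a m) = a * φ i m) ∧ ∑ i, φ i (x i) = 1

/-- Every endomorphism of the left module `M` is the right action of a unique element. -/
def HasDoubleCentralizer (M : BimodCat O A B) : Prop :=
  ∀ f : M →+ M, (∀ a m, f (leftAct M a m) = leftAct M a (f m)) →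
    ∃! b : B, ∀ m, f m = rightAct M (op b) m

namespace HasDoubleCentralizer

variable {M : BimodCat O A B}

theorem ext {b b' : B} (h : HasDoubleCentralizer M)
    (hb : ∀ m, rightAct M (op b) m = rightAct M (op b') m) : b = b' := by
  obtain ⟨c, -, hc⟩ := h (rightAct M (op b')).toAddMonoidHom fun a m =>
    (LinearMap.congr_fun (commute_act M a (op b')).eq m).symm
  rw [hc b fun m => (hb m).symm, hc b' fun m => rfl]

/-- The map x ↦ φ(x) m is an endomorphism of the left module M, hence a right multiplication. -/
theorem exists_pairing (h : HasDoubleCentralizer M) (φ : M →+ A)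
    (hφ : ∀ a m, φ (leftAct M a m) = a * φ m) (m : M) : ∃ b : B, ∀ x, leftAct M (φ x) m = rightAct M (op b) x := by
  obtain ⟨b, hb, -⟩ := h (AddMonoidHom.mk' (fun x => leftAct M (φ x) m) fun x y => by
    rw [map_add, map_add, LinearMap.add_apply]) fun a x => by
      change leftAct M (φ (leftAct M a x)) m = leftAct M a (leftAct M (φ x) m)
      rw [hφ, map_mul]
      rfl
  exact ⟨b, hb⟩

/-- The pairing of a linear form `φ` with `m`: right multiplication with `⟨φ, m⟩` is
`x ↦ φ(x) m`. -/
def pairing (h : HasDoubleCentralizer M) (φ : M →+ A)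
    (hφ : ∀ a m, φ (leftAct M a m) = a * φ m) : M →+ B :=
  AddMonoidHom.mk' (fun m => (h.exists_pairing φ hφ m).choose) fun m m' => by
    refine h.ext fun x => ?_
    rw [MulOpposite.op_add, map_add, LinearMap.add_apply,
      ← (h.exists_pairing φ hφ (m + m')).choose_spec, ← (h.exists_pairing φ hφ m).choose_spec,
      ← (h.exists_pairing φ hφ m').choose_spec, map_add]

theorem rightAct_pairing (h : HasDoubleCentralizer M) (φ : M →+ A)
    (hφ : ∀ a m, φ (leftAct M a m) = a * φ m) (m x : M) :
    rightAct M (op (h.pairing φ hφ m)) x = leftAct M (φ x) m :=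
  ((h.exists_pairing φ hφ m).choose_spec x).symm

theorem pairing_rightAct (h : HasDoubleCentralizer M) (φ : M →+ A)
    (hφ : ∀ a m, φ (leftAct M a m) = a * φ m) (m : M) (b : B) :
    h.pairing φ hφ (rightAct M (op b) m) = h.pairing φ hφ m * b := by
  refine h.ext fun x => ?_
  rw [h.rightAct_pairing, op_mul, map_mul, Module.End.mul_apply, h.rightAct_pairing]
  exact LinearMap.congr_fun (commute_act M (φ x) (op b)).eq m

/-- The contraction `m ⊗ v ↦ ⟨φ, m⟩ v`. -/
def contract (h : HasDoubleCentralizer M) (φ : M →+ A)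
    (hφ : ∀ a m, φ (leftAct M a m) = a * φ m) (V : ModuleCat.{u} B) : (tensorFunctor M).obj V →+ V :=
  tensorFunctorLift (AddMonoidHom.mk' (fun m => DistribSMul.toAddMonoidHom V (h.pairing φ hφ m))
    fun m m' => by
      ext v
      change h.pairing φ hφ (m + m') • v = h.pairing φ hφ m • v + h.pairing φ hφ m' • v
      rw [map_add, add_smul]) fun m b v => by
    change h.pairing φ hφ (rightAct M (op b) m) • v = h.pairing φ hφ m • b • v
    rw [h.pairing_rightAct, mul_smul]

theorem contract_fmk (h : HasDoubleCentralizer M) (φ : M →+ A)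
    (hφ : ∀ a m, φ (leftAct M a m) = a * φ m) (V : ModuleCat.{u} B) (m : M) (v : V) :
    h.contract φ hφ V (fmk M V m v) = h.pairing φ hφ m • v := rfl

/-- On pure tensors, x ⊗ ⟨φ, m⟩ v = x ⟨φ, m⟩ ⊗ v = φ(x) m ⊗ v. Fullness of M ⊗_B - and injectivity
of evaluation rest on this identity. -/
theorem fmk_contract (h : HasDoubleCentralizer M) (φ : M →+ A)
    (hφ : ∀ a m, φ (leftAct M a m) = a * φ m) (V : ModuleCat.{u} B) (x : M) (z : (tensorFunctor M).obj V) :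
    fmk M V x (h.contract φ hφ V z) = φ x • z := by
  rw [← fmkHom_apply]
  refine fmk_induction (p := fun z => fmkHom M V x (h.contract φ hφ V z) = φ x • z)
    (by rw [map_zero, map_zero, smul_zero]) (fun m v => ?_)
    (fun y z hy hz => by rw [map_add, map_add, hy, hz, smul_add]) z
  rw [contract_fmk, fmkHom_apply, ← fmk_balanced, h.rightAct_pairing, smul_fmk]

variable {n : ℕ}

/-- The dual basis identity ∑ coordᵢ(x) xᵢ = x says that right multiplication by ∑ ⟨coordᵢ, xᵢ⟩ is
the identity. -/
theorem sum_pairing (h : HasDoubleCentralizer M) (b : LeftBasis M n) : ∑ i, h.pairing (b.coord i) (b.coord_leftAct i) (b.vec i) = 1 := by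
  refine h.ext fun x => ?_
  rw [MulOpposite.op_one, map_one, Module.End.one_apply]
  refine Eq.trans ?_ (b.sum_eq x)
  rw [← opAddEquiv_apply, map_sum, map_sum, LinearMap.sum_apply]
  exact Finset.sum_congr rfl fun i _ => h.rightAct_pairing _ _ _ _

theorem sum_contract (h : HasDoubleCentralizer M) (b : LeftBasis M n) (V : ModuleCat.{u} B) (v : V) :
    ∑ i, h.contract (b.coord i) (b.coord_leftAct i) V (fmk M V (b.vec i) v) = v := by
  simp only [contract_fmk]
  rw [← Finset.sum_smul, h.sum_pairing, one_smul]

/-- The contractions recover v from the tensors xᵢ ⊗ v, because ∑ ⟨coordᵢ, xᵢ⟩ = 1. -/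
theorem fmk_ext (h : HasDoubleCentralizer M) (b : LeftBasis M n) (V : ModuleCat.{u} B) {v w : V} (hvw : ∀ x, fmk M V x v = fmk M V x w) : v = w := by
  rw [← h.sum_contract b V v, ← h.sum_contract b V w]
  simp only [hvw]

theorem sum_fmk (b : LeftBasis M n) (V : ModuleCat.{u} B) (x : M) :
    ∑ i, b.coord i x • fmkHom M V (b.vec i) = fmkHom M V x := by
  ext v
  have : (fmkHom M V).flip v (∑ i, leftAct M (b.coord i x) (b.vec i)) =
    ∑ i, b.coord i x • fmkHom M V (b.vec i) v := map_sum _ _ _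
  rw [AddMonoidHom.finsetSum_apply]
  refine this.symm.trans ?_
  rw [b.sum_eq]
  rfl

theorem faithful (h : HasDoubleCentralizer M) (b : LeftBasis M n) : (tensorFunctor M).Faithful where
  map_injective {V W f g} hfg := by
    ext v
    exact h.fmk_ext b W fun x =>
      congrArg (fun k : (tensorFunctor M).obj V ⟶ (tensorFunctor M).obj W => k.hom (fmk M V x v)) hfg

/-- Take for w the sum of the contractions of k(xᵢ ⊗ v) by coordᵢ. Then x ⊗ w = ∑ coordᵢ(x) k(xᵢ ⊗
v) = k(x ⊗ v) by linearity of k and the dual basis identity. -/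
theorem exists_preimage (h : HasDoubleCentralizer M) (b : LeftBasis M n) {V W : ModuleCat.{u} B}
    (k : (tensorFunctor M).obj V ⟶ (tensorFunctor M).obj W) (v : V) :
    ∃ w : W, ∀ x, fmk M W x w = k.hom (fmk M V x v) := by
  refine ⟨∑ i, h.contract (b.coord i) (b.coord_leftAct i) W (k.hom (fmk M V (b.vec i) v)),
    fun x => ?_⟩
  rw [← fmkHom_apply, map_sum]
  simp only [fmkHom_apply, fmk_contract]
  rw [← fmkHom_apply M V x, ← sum_fmk b V x, AddMonoidHom.finsetSum_apply, map_sum]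
  exact Finset.sum_congr rfl fun i _ => (k.hom.map_smul _ _).symm

theorem full (h : HasDoubleCentralizer M) (b : LeftBasis M n) : (tensorFunctor M).Full where
  map_surjective {V W} k := by
    choose g hg using h.exists_preimage b k
    refine ⟨ModuleCat.ofHom
      { toFun := g
        map_add' := fun v v' => h.fmk_ext b W fun x => ?_
        map_smul' := fun c v => h.fmk_ext b W fun x => ?_ }, balanced_hom_ext fun m v => hg v m⟩
    · rw [fmk_add_right, hg, hg, hg, fmk_add_right, map_add]
    · rw [RingHom.id_apply, ← fmk_balanced, hg, hg, fmk_balanced]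

end HasDoubleCentralizer

end Morita

/-! ### Evaluation on Hom_A(M, -) and the Morita criterion -/

section Morita

variable {O : Type u} [CommRing O]
variable {A : Type u} [Ring A] [Algebra O A] {B : Type u} [Ring B] [Algebra O B]

attribute [local instance] moduleO isScalarTowerO

/-- The `O`-linear maps commuting with actions of `A`. -/
def LHom {V W : Type*} [AddCommGroup V] [Module O V] [AddCommGroup W] [Module O W]
    (ρ : A →ₐ[O] Module.End O V) (σ : A →ₐ[O] Module.End O W) : Submodule O (V →ₗ[O] W) where
  carrier := {f | ∀ a, f ∘ₗ ρ a = σ a ∘ₗ f}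
  add_mem' {f g} hf hg a := by rw [LinearMap.add_comp, LinearMap.comp_add, hf, hg]
  zero_mem' a := by rw [LinearMap.zero_comp, LinearMap.comp_zero]
  smul_mem' c f hf a := by rw [LinearMap.smul_comp, LinearMap.comp_smul, hf]

instance {V W : Type*} [AddCommGroup V] [Module O V] [AddCommGroup W] [Module O W]
    (ρ : A →ₐ[O] Module.End O V) (σ : A →ₐ[O] Module.End O W) : AddCommGroup (LHom ρ σ) :=
  Submodule.addCommGroup _

theorem mem_LHom {V W : Type*} [AddCommGroup V] [Module O V] [AddCommGroup W] [Module O W]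
    {ρ : A →ₐ[O] Module.End O V} {σ : A →ₐ[O] Module.End O W} {f : V →ₗ[O] W} :
    f ∈ LHom ρ σ ↔ ∀ a v, f (ρ a v) = σ a (f v) :=
  forall_congr' fun _ => LinearMap.ext_iff

/-- The action of `B` on `Hom_A(M, W)`, with `(b f)(m) = f (m b)`. -/
def lhomAct (M : BimodCat O A B) (W : ModuleCat.{u} A) :
    B →ₐ[O] Module.End O (LHom (leftAct M) (act (O := O) W)) where
  toFun b :=
    { toFun := fun f => ⟨f.1 ∘ₗ rightAct M (op b), mem_LHom.2 fun a m => by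
        have h := LinearMap.congr_fun (commute_act M a (op b)).eq m
        rw [LinearMap.comp_apply, LinearMap.comp_apply, ← mem_LHom.1 f.2]
        exact congrArg f.1 h.symm⟩
      map_add' := fun _ _ => rfl
      map_smul' := fun _ _ => rfl }
  map_one' := by
    ext f m
    change f.1 (rightAct M 1 m) = f.1 m
    rw [map_one, Module.End.one_apply]
  map_mul' b c := by
    ext f m
    change f.1 (rightAct M (op (b * c)) m) = f.1 (rightAct M (op c) (rightAct M (op b) m))
    rw [op_mul, map_mul, Module.End.mul_apply]
  map_zero' := by
    ext f m
    change f.1 (rightAct M 0 m) = 0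
    rw [map_zero, LinearMap.zero_apply, map_zero]
  map_add' b c := by
    ext f m
    change f.1 (rightAct M (op b + op c) m) = f.1 (rightAct M (op b) m) + f.1 (rightAct M (op c) m)
    rw [map_add, LinearMap.add_apply, map_add]
  commutes' c := by
    ext f m
    change f.1 (rightAct M (op (algebraMap O B c)) m) = c • f.1 m
    rw [rightAct_algebraMap, map_smul]

/-- The `B`-module `Hom_A(M, W)`. -/
def lhomModule (M : BimodCat O A B) (W : ModuleCat.{u} A) : ModuleCat.{u} B :=
  ofAction (lhomAct M W)

/-- The additive map underlying an element of `Hom_A(M, W)`. -/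
def lhomEval (M : BimodCat O A B) (W : ModuleCat.{u} A) : M →+ lhomModule M W →+ W :=
  AddMonoidHom.mk' (fun m => AddMonoidHom.mk'
      (fun f => (show LHom (leftAct M) (act (O := O) W) from f).1 m) fun _ _ => rfl)
    fun m m' => by
      ext f
      exact map_add (show LHom (leftAct M) (act (O := O) W) from f).1 m m'

theorem lhomEval_leftAct (M : BimodCat O A B) (W : ModuleCat.{u} A) (a : A) (m : M)
    (f : lhomModule M W) : lhomEval M W (leftAct M a m) f = a • lhomEval M W m f :=
  mem_LHom.1 (show LHom (leftAct M) (act (O := O) W) from f).2 a m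

theorem lhomEval_smul (M : BimodCat O A B) (W : ModuleCat.{u} A) (b : B) (m : M)
    (f : lhomModule M W) : lhomEval M W m (b • f) = lhomEval M W (rightAct M (op b) m) f := rfl

theorem lhomModule_ext {M : BimodCat O A B} {W : ModuleCat.{u} A} {f g : lhomModule M W}
    (h : ∀ m, lhomEval M W m f = lhomEval M W m g) : f = g :=
  Subtype.ext (LinearMap.ext h)

theorem exists_lhomEval_eq {M : BimodCat O A B} {W : ModuleCat.{u} A} (f : M →+ W)
    (hf : ∀ a m, f (leftAct M a m) = a • f m) : ∃ g, ∀ m, lhomEval M W m g = f m :=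
  ⟨(⟨{ toFun := f
       map_add' := map_add f
       map_smul' := fun c m => by
        rw [← leftAct_algebraMap, hf]
        rfl }, mem_LHom.2 hf⟩ : LHom (leftAct M) (act (O := O) W)), fun _ => rfl⟩

theorem finite_lhomModule [IsNoetherianRing O] [Module.Finite O A] (M : BimodCat O A B)
    (W : ModuleCat.{u} A) [Module.Finite O M] [Module.Finite A W] :
    Module.Finite B (lhomModule M W) := by
  have : Module.Finite O W := finiteO W
  have := finite_linearMap O O M W
  have : Module.Finite O (LHom (leftAct M) (act (O := O) W)) := inferInstance
  exact finite_ofAction _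

/-- The evaluation `M ⊗_B Hom_A(M, W) → W`. -/
def evaluation (M : BimodCat O A B) (W : ModuleCat.{u} A) :
    (tensorFunctor M).obj (lhomModule M W) ⟶ W :=
  let e : (tensorFunctor M).obj (lhomModule M W) →+ W :=
    tensorFunctorLift (lhomEval M W) fun m b f => (lhomEval_smul M W b m f).symm
  ModuleCat.ofHom
    { toFun := e
      map_add' := map_add e
      map_smul' := fun a z => by
        refine fmk_induction (p := fun z => e (a • z) = a • e z)
          (by rw [smul_zero, map_zero, smul_zero]) (fun m f => lhomEval_leftAct M W a m f)
          (fun y z hy hz => by rw [smul_add, map_add, map_add, hy, hz, smul_add]) z }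

theorem evaluation_fmk (M : BimodCat O A B) (W : ModuleCat.{u} A) (m : M) (f : lhomModule M W) :
    (evaluation M W).hom (fmk M _ m f) = lhomEval M W m f := rfl

theorem HasDoubleCentralizer.lhomEval_contract {M : BimodCat O A B} (h : HasDoubleCentralizer M)
    (φ : M →+ A) (hφ : ∀ a m, φ (leftAct M a m) = a * φ m) (W : ModuleCat.{u} A) (x : M)
    (z : (tensorFunctor M).obj (lhomModule M W)) :
    lhomEval M W x (h.contract φ hφ _ z) = φ x • (evaluation M W).hom z := by
  refine fmk_induction (p := fun z => lhomEval M W x (h.contract φ hφ _ z) =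
    φ x • (evaluation M W).hom z) (by rw [map_zero, map_zero, map_zero, smul_zero]) (fun m f => ?_)
    (fun y z hy hz => by rw [map_add, map_add, map_add, hy, hz, smul_add]) z
  rw [h.contract_fmk, evaluation_fmk, lhomEval_smul, h.rightAct_pairing, lhomEval_leftAct]

/-- Write 1 = ∑ φᵢ(xᵢ). Then z = ∑ xᵢ ⊗ zᵢ, where zᵢ is the contraction of z by φᵢ, that is, the
homomorphism m ↦ φᵢ(m) ev(z); so ev(z) = 0 forces z = 0. Also w = ∑ φᵢ(xᵢ) w is the value at ∑ xᵢ ⊗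
(m ↦ φᵢ(m) w). -/
theorem IsGenerator.evaluation_bijective {M : BimodCat O A B} (hM : IsGenerator M)
    (h : HasDoubleCentralizer M) (W : ModuleCat.{u} A) :
    Function.Bijective (evaluation M W).hom := by
  obtain ⟨n, x, φ, hφ, hx⟩ := hM
  constructor
  · rw [injective_iff_map_eq_zero]
    intro z hz
    have h0 (i : Fin n) : h.contract (φ i) (hφ i) _ z = 0 := by
      refine lhomModule_ext fun m => ?_
      rw [h.lhomEval_contract, hz, smul_zero, map_zero]
    rw [← one_smul A z, ← hx, Finset.sum_smul]
    refine Finset.sum_eq_zero fun i _ => ?_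
    rw [← h.fmk_contract _ (hφ i), h0, ← fmkHom_apply, map_zero]
  · intro w
    choose g hg using fun i => exists_lhomEval_eq (M := M)
      (AddMonoidHom.mk' (fun m => φ i m • w) fun m m' => by rw [map_add, add_smul])
      fun a m => by
        change φ i (leftAct M a m) • w = a • φ i m • w
        rw [hφ, mul_smul]
    refine ⟨∑ i, fmk M _ (x i) (g i), ?_⟩
    rw [map_sum]
    simp only [evaluation_fmk, hg, AddMonoidHom.mk'_apply]
    rw [← Finset.sum_smul, hx, one_smul]

/-- The dual basis and the double centralizer property make the functor fully faithful. Evaluation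
exhibits W as the image of Hom_A(M, W), which is finitely generated by noetherianity. -/
theorem IsGenerator.inducesMoritaEquivalence [IsNoetherianRing O] [Module.Finite O A]
    [Module.Finite O B] {M : BimodCat O A B} [Module.Finite (A ⊗[O] Bᵐᵒᵖ) M] (hM : IsGenerator M)
    (h : HasDoubleCentralizer M) {n : ℕ} (b : LeftBasis M n) : InducesMoritaEquivalence M := by
  have h₁ := h.faithful b
  have h₂ := h.full b
  have : Module.Finite O M := finiteO M
  have h₃ : ((ModuleCat.isFG.{u} B).ι ⋙ tensorFunctor M).Faithful := Functor.Faithful.comp _ _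
  have h₄ : ((ModuleCat.isFG.{u} B).ι ⋙ tensorFunctor M).Full := Functor.Full.comp _ _
  have hf : (tensorFunctorFG M).Faithful := Functor.Faithful.of_comp_iso
    (ObjectProperty.liftCompιIso _ ((ModuleCat.isFG.{u} B).ι ⋙ tensorFunctor M) _)
  have hF : (tensorFunctorFG M).Full := Functor.Full.of_comp_faithful_iso
    (ObjectProperty.liftCompιIso _ ((ModuleCat.isFG.{u} B).ι ⋙ tensorFunctor M) _)
  refine { essSurj := ⟨fun W => ?_⟩ }
  have : Module.Finite A W.obj := W.property
  exact ⟨⟨lhomModule M W.obj, finite_lhomModule M W.obj⟩,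
    ⟨ObjectProperty.isoMk _ (isoOfBijective (evaluation M W.obj)
      (hM.evaluation_bijective h W.obj))⟩⟩

/-- The isomorphism `M ⊗_B B ≅ M`. -/
def tensorSelf (M : BimodCat O A B) : (tensorFunctor M).obj (ModuleCat.of B B) →+ M :=
  tensorFunctorLift (AddMonoidHom.mk' (fun m => AddMonoidHom.mk'
      (fun b : B => rightAct M (op b) m) fun b b' => by
        rw [MulOpposite.op_add, map_add, LinearMap.add_apply]) fun m m' => by
      ext b
      exact map_add (rightAct M (op b)) m m') fun m b c => by
    change rightAct M (op c) (rightAct M (op b) m) = rightAct M (op (b * c)) m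
    rw [op_mul, map_mul, Module.End.mul_apply]

theorem tensorSelf_fmk (M : BimodCat O A B) (m : M) (b : B) :
    tensorSelf M (fmk M (ModuleCat.of B B) m b) = rightAct M (op b) m := rfl

theorem tensorSelf_smul (M : BimodCat O A B) (a : A) (z : (tensorFunctor M).obj (ModuleCat.of B B)) :
    tensorSelf M (a • z) = leftAct M a (tensorSelf M z) := by
  refine fmk_induction (p := fun z => tensorSelf M (a • z) = leftAct M a (tensorSelf M z))
    (by rw [smul_zero, map_zero, map_zero]) (fun m b => ?_)
    (fun y z hy hz => by rw [smul_add, map_add, map_add, map_add, hy, hz]) z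
  exact (LinearMap.congr_fun (commute_act M a (op b)).eq m).symm

/-- An endomorphism of the left module `M`, on `M ⊗_B B`. -/
def tensorSelfMap {M : BimodCat O A B} (f : M →+ M)
    (hf : ∀ a m, f (leftAct M a m) = leftAct M a (f m)) :
    (tensorFunctor M).obj (ModuleCat.of B B) ⟶ (tensorFunctor M).obj (ModuleCat.of B B) :=
  ModuleCat.ofHom
    { toFun := fun z => fmk M (ModuleCat.of B B) (f (tensorSelf M z)) (1 : B)
      map_add' := fun y z => (congrArg (fun x => fmk M (ModuleCat.of B B) (f x) (1 : B))
        (map_add (tensorSelf M) y z)).trans (by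
          rw [map_add, fmk_add_left]
          rfl)
      map_smul' := fun a z => (congrArg (fun x => fmk M (ModuleCat.of B B) (f x) (1 : B))
        (tensorSelf_smul M a z)).trans (by
          rw [hf, RingHom.id_apply]
          rfl) }

/-- Endomorphisms of the left module B are right multiplications by unique elements. A fully
faithful functor carries this to M ⊗_B B ≅ M. -/
theorem InducesMoritaEquivalence.hasDoubleCentralizer [Module.Finite O A]
    [Module.Finite O B] {M : BimodCat O A B} [Module.Finite (A ⊗[O] Bᵐᵒᵖ) M]
    (hM : InducesMoritaEquivalence M) : HasDoubleCentralizer M := by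
  have hM : (tensorFunctorFG M).IsEquivalence := hM
  let B₀ : FGModuleCat.{u} B := ⟨ModuleCat.of B B, inferInstanceAs (Module.Finite B B)⟩
  intro f hf
  obtain ⟨g, hg⟩ := (tensorFunctorFG M).map_surjective (X := B₀) (Y := B₀)
    (ObjectProperty.homMk (tensorSelfMap f hf))
  have hg' : (tensorFunctor M).map g.hom = tensorSelfMap f hf := congrArg (fun k => k.hom) hg
  have one (m : M) : tensorSelf M (fmk M (ModuleCat.of B B) m (1 : B)) = m := by
    rw [tensorSelf_fmk, MulOpposite.op_one, map_one, Module.End.one_apply]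
  refine ⟨g.hom.hom (1 : B), fun m => ?_, fun c hc => ?_⟩
  · have h := congrArg (fun k : (tensorFunctor M).obj (ModuleCat.of B B) ⟶
      (tensorFunctor M).obj (ModuleCat.of B B) =>
        tensorSelf M (k.hom (fmk M (ModuleCat.of B B) m (1 : B)))) hg'
    refine Eq.trans ?_ h.symm
    change f m = tensorSelf M (fmk M (ModuleCat.of B B)
      (f (tensorSelf M (fmk M (ModuleCat.of B B) m (1 : B)))) (1 : B))
    rw [one, one]
  -- Uniqueness: right multiplication by c on B induces f as well, so by faithfulness it equals g,
  -- and c = g(1).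
  · let γ : B₀ ⟶ B₀ := ObjectProperty.homMk (ModuleCat.ofHom (LinearMap.toSpanSingleton B B c))
    have hγ : γ = g := by
      refine (tensorFunctorFG M).map_injective ?_
      rw [hg]
      refine ObjectProperty.hom_ext _ (balanced_hom_ext fun m v => ?_)
      change fmk M (ModuleCat.of B B) m ((show B from v) * c) =
        fmk M (ModuleCat.of B B) (f (rightAct M (op v) m)) (1 : B)
      rw [hc]
      exact ((fmk_balanced M (ModuleCat.of B B) (rightAct M (op v) m) c (1 : B)).trans
        ((congrArg (fmk M (ModuleCat.of B B) (rightAct M (op v) m)) (mul_one c)).trans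
          (fmk_balanced M (ModuleCat.of B B) m v c))).symm
    rw [← hγ]
    exact (one_mul c).symm

/-- By essential surjectivity A ≅ M ⊗_B V. If ∑ xᵢ ⊗ vᵢ corresponds to 1, the forms m ↦ ψ(m ⊗ vᵢ)
satisfy ∑ φᵢ(xᵢ) = 1. -/
theorem InducesMoritaEquivalence.isGenerator [Module.Finite O A]
    [Module.Finite O B] {M : BimodCat O A B} [Module.Finite (A ⊗[O] Bᵐᵒᵖ) M]
    (hM : InducesMoritaEquivalence M) : IsGenerator M := by
  have hM : (tensorFunctorFG M).IsEquivalence := hM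
  let A₀ : FGModuleCat.{u} A := ⟨ModuleCat.of A A, inferInstanceAs (Module.Finite A A)⟩
  let V := (tensorFunctorFG M).objPreimage A₀
  let ψ : (tensorFunctor M).obj V.obj ≅ ModuleCat.of A A :=
    (ModuleCat.isFG A).ι.mapIso ((tensorFunctorFG M).objObjPreimageIso A₀)
  have key (z : (tensorFunctor M).obj V.obj) : ∃ (n : ℕ) (x : Fin n → M) (v : Fin n → V.obj),
      z = ∑ i, fmk M V.obj (x i) (v i) := by
    refine fmk_induction (p := fun z => ∃ (n : ℕ) (x : Fin n → M) (v : Fin n → V.obj),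
      z = ∑ i, fmk M V.obj (x i) (v i)) ⟨0, 0, 0, by simp⟩ (fun m v => ⟨1, fun _ => m, fun _ => v,
        by simp⟩) ?_ z
    rintro _ _ ⟨n, x, v, rfl⟩ ⟨n', x', v', rfl⟩
    refine ⟨n + n', Fin.append x x', Fin.append v v', ?_⟩
    simp [Fin.sum_univ_add]
  obtain ⟨n, x, v, h⟩ := key (ψ.inv.hom (1 : A))
  refine ⟨n, x, fun i => ψ.hom.hom.toAddMonoidHom.comp ((fmkHom M V.obj).flip (v i)),
    fun i a m => ψ.hom.hom.map_smul a (fmk M V.obj m (v i)), ?_⟩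
  have h' := congrArg ψ.hom.hom h
  rw [map_sum] at h'
  refine h'.symm.trans ?_
  exact LinearMap.congr_fun (congrArg ModuleCat.Hom.hom ψ.inv_hom_id) (1 : A)

end Morita

section MoritaDescent

variable {O : Type u} [CommRing O]
variable {A : Type u} [Ring A] [Algebra O A] {B : Type u} [Ring B] [Algebra O B]

attribute [local instance] moduleO isScalarTowerO

/-! ### Morita equivalences and extension of scalars -/

/-- Additive maps compatible with A are automatically O-linear. The isomorphism e is carried along
because the scalar structure of M' arising from its algebra action is only identified with that of
O' ⊗ M through `baseChangeEquiv`. -/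
theorem lhom_of_addHom {M : BimodCat O A B} {V W : Type u} [AddCommGroup V] [Module O V]
    [AddCommGroup W] [Module O W] (e : M ≃ₗ[O] V) {ρ : A →ₐ[O] Module.End O V}
    {σ : A →ₐ[O] Module.End O W} (he : ∀ a m, e (leftAct M a m) = ρ a (e m)) (f : M →+ W)
    (hf : ∀ a m, f (leftAct M a m) = σ a (f m)) : ∃ g ∈ LHom ρ σ, ∀ m, g (e m) = f m := by
  let f₀ : M →ₗ[O] W :=
    { toFun := f
      map_add' := map_add f
      map_smul' := fun c m => by
        rw [← leftAct_algebraMap, hf, AlgHom.commutes]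
        rfl }
  refine ⟨f₀ ∘ₗ e.symm.toLinearMap, mem_LHom.2 fun a v => ?_, fun m => ?_⟩
  · obtain ⟨m, rfl⟩ := e.surjective v
    change f (e.symm (ρ a (e m))) = σ a (f (e.symm (e m)))
    rw [← he, e.symm_apply_apply, e.symm_apply_apply, hf]
  · exact congrArg f (e.symm_apply_apply m)

/-- Fixing O-module generators of M makes the vectors in the generator condition constants, so that
it becomes a single linear equation in the forms. -/
theorem isGenerator_iff {M : BimodCat O A B} {V : Type u} [AddCommGroup V] [Module O V]
    (e : M ≃ₗ[O] V) {ρ : A →ₐ[O] Module.End O V} (he : ∀ a m, e (leftAct M a m) = ρ a (e m))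
    {n : ℕ} (x : Fin n → V) (hx : Submodule.span O (Set.range x) = ⊤) :
    IsGenerator M ↔ ∃ φ : Fin n → LHom ρ (Algebra.lmul O A), ∑ i, (φ i).1 (x i) = 1 := by
  constructor
  · rintro ⟨m, y, φ, hφ, hy⟩
    choose g hg hgφ using fun i => lhom_of_addHom e he (σ := Algebra.lmul O A) (φ i) (hφ i)
    have hc (i : Fin m) : ∃ c : Fin n → O, ∑ j, c j • x j = e (y i) :=
      (Submodule.mem_span_range_iff_exists_fun O).1 (hx ▸ Submodule.mem_top)
    choose c hc using hc
    -- Expanding yᵢ = ∑ cᵢⱼ xⱼ and regrouping by j moves the coefficients onto the forms.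
    refine ⟨fun j => ∑ i, c i j • (⟨g i, hg i⟩ : LHom ρ (Algebra.lmul O A)), ?_⟩
    have h (j : Fin n) : (∑ i, c i j • (⟨g i, hg i⟩ : LHom ρ (Algebra.lmul O A))).1 (x j) =
        ∑ i, c i j • g i (x j) := by
      simp
    simp only [h]
    rw [Finset.sum_comm, ← hy]
    refine Finset.sum_congr rfl fun i _ => ?_
    rw [← hgφ, ← hc, map_sum]
    simp only [map_smul]
  · rintro ⟨φ, hφ⟩
    refine ⟨n, fun i => e.symm (x i), fun i => ((φ i).1 ∘ₗ e.toLinearMap).toAddMonoidHom,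
      fun i a m => ?_, ?_⟩
    · change (φ i).1 (e (leftAct M a m)) = a * (φ i).1 (e m)
      rw [he, mem_LHom.1 (φ i).2]
      rfl
    · refine Eq.trans (Finset.sum_congr rfl fun i _ => ?_) hφ
      exact congrArg (φ i).1 (e.apply_symm_apply (x i))

theorem hasDoubleCentralizer_iff {M : BimodCat O A B} {V : Type u} [AddCommGroup V] [Module O V]
    (e : M ≃ₗ[O] V) {ρ : A →ₐ[O] Module.End O V} (he : ∀ a m, e (leftAct M a m) = ρ a (e m))
    (r : B → LHom ρ ρ) (hr : ∀ b m, e (rightAct M (op b) m) = (r b).1 (e m)) :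
    HasDoubleCentralizer M ↔ Function.Bijective r := by
  rw [Function.bijective_iff_existsUnique]
  constructor
  · intro h f
    obtain ⟨b, hb, hb'⟩ := h
      (e.symm.toLinearMap ∘ₗ f.1 ∘ₗ e.toLinearMap).toAddMonoidHom fun a m => by
        change e.symm (f.1 (e (leftAct M a m))) = leftAct M a (e.symm (f.1 (e m)))
        rw [he, mem_LHom.1 f.2, LinearEquiv.symm_apply_eq, he, LinearEquiv.apply_symm_apply]
    have key (c : B) : (∀ m, e.symm (f.1 (e m)) = rightAct M (op c) m) ↔ r c = f := by
      rw [Subtype.ext_iff, LinearMap.ext_iff, e.surjective.forall]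
      refine forall_congr' fun m => ?_
      rw [LinearEquiv.symm_apply_eq, hr, eq_comm]
    exact ⟨b, (key b).1 hb, fun c hc => hb' c ((key c).2 hc)⟩
  · intro h f hf
    obtain ⟨g, hg, hgf⟩ := lhom_of_addHom e he (σ := ρ) (e.toLinearMap.toAddMonoidHom.comp f)
      fun a m => (congrArg e (hf a m)).trans (he a (f m))
    have key (c : B) : (∀ m, f m = rightAct M (op c) m) ↔ r c = ⟨g, hg⟩ := by
      rw [Subtype.ext_iff, LinearMap.ext_iff, e.surjective.forall]
      refine forall_congr' fun m => ?_
      rw [← hr, hgf, eq_comm]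
      exact e.injective.eq_iff.symm
    obtain ⟨b, hb, hb'⟩ := h ⟨g, hg⟩
    exact ⟨b, (key b).2 hb, fun c hc => hb' c ((key c).1 hc)⟩

/-- The right action of `B`, by endomorphisms of the left module `M`. -/
def rightActLHom (M : BimodCat O A B) : B →ₗ[O] LHom (leftAct M) (leftAct M) :=
  LinearMap.codRestrict _ ((rightAct M).toLinearMap ∘ₗ (opLinearEquiv O).toLinearMap) fun b =>
    mem_LHom.2 fun a m => (LinearMap.congr_fun (commute_act M a (op b)).eq m).symm

variable (O' : Type u) [CommRing O'] [Algebra O O']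

theorem isExtension_lhom [Module.Flat O O'] [Module.Finite O A] {V W : Type u} [AddCommGroup V]
    [Module O V] [Module.Finite O V] [Module.Free O V] [AddCommGroup W] [Module O W]
    {ρ : A →ₐ[O] Module.End O V} {σ : A →ₐ[O] Module.End O W}
    {ρ' : O' ⊗[O] A →ₐ[O'] Module.End O' (O' ⊗[O] V)}
    {σ' : O' ⊗[O] A →ₐ[O'] Module.End O' (O' ⊗[O] W)}
    (hρ : ∀ a, ρ' (1 ⊗ₜ a) = (ρ a).baseChange O') (hσ : ∀ a, σ' (1 ⊗ₜ a) = (σ a).baseChange O') :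
    ∃ φ : LHom ρ σ → LHom ρ' σ', (∀ f, (φ f).1 = f.1.baseChange O') ∧ IsExtension O O' φ := by
  obtain ⟨n, s, hs⟩ := Module.Finite.exists_fin (R := O) (M := A)
  have h (f : V →ₗ[O] W) : f ∈ LHom ρ σ ↔ ∀ i, f ∘ₗ ρ (s i) = σ (s i) ∘ₗ f :=
    ⟨fun h i => h (s i), fun h => intertwining_of_span hs (Set.forall_mem_range.2 h)⟩
  have h' (f : O' ⊗[O] V →ₗ[O'] O' ⊗[O] W) : f ∈ LHom ρ' σ' ↔
      ∀ i, f ∘ₗ (ρ (s i)).baseChange O' = (σ (s i)).baseChange O' ∘ₗ f := by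
    simp only [← hρ, ← hσ]
    exact ⟨fun h i => h _, fun h => intertwining_of_span (span_one_tmul O' hs)
      (Set.forall_mem_image.2 (Set.forall_mem_range.2 h))⟩
  refine ⟨fun f => ⟨f.1.baseChange O', (h' _).2 fun i => ?_⟩, fun f => rfl,
    IsExtension.intertwining (fun i => ρ (s i)) (fun i => σ (s i)) (LHom ρ σ).subtype
      (LHom ρ' σ').subtype Subtype.val_injective Subtype.val_injective (fun f => ?_) (fun f => ?_)
      fun f => rfl⟩
  · rw [← LinearMap.baseChange_comp, ← LinearMap.baseChange_comp, (h _).1 f.2]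
  · rw [← h]
    exact ⟨fun ⟨g, hg⟩ => hg ▸ g.2, fun hf => ⟨⟨f, hf⟩, rfl⟩⟩
  · rw [← h']
    exact ⟨fun ⟨g, hg⟩ => hg ▸ g.2, fun hf => ⟨⟨f, hf⟩, rfl⟩⟩

/-- Up to the isomorphism O' ⊗ H ≅ H', the map L' is the extension of L, and faithfully flat
extension both preserves and reflects bijectivity. -/
theorem IsExtension.bijective_iff [Module.FaithfullyFlat O O'] {H H' K : Type*} [AddCommGroup H]
    [Module O H] [AddCommGroup H'] [Module O' H'] [AddCommGroup K] [Module O K] {φ : H → H'}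
    (hφ : IsExtension O O' φ) (L : K →ₗ[O] H) (L' : O' ⊗[O] K →ₗ[O'] H')
    (hL : ∀ k, L' (1 ⊗ₜ k) = φ (L k)) : Function.Bijective L' ↔ Function.Bijective L := by
  obtain ⟨θ, hθ, hθφ⟩ := hφ
  have : L' = θ ∘ₗ L.baseChange O' := by
    refine LinearMap.ext fun z => ?_
    induction z with
    | zero => rw [map_zero, map_zero]
    | add x y hx hy => rw [map_add, map_add, hx, hy]
    | tmul c k =>
      have h : c ⊗ₜ[O] k = c • ((1 : O') ⊗ₜ[O] k) := by rw [smul_tmul', smul_eq_mul, mul_one]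
      rw [h, map_smul, map_smul, hL, LinearMap.comp_apply, LinearMap.baseChange_tmul, hθφ]
  rw [this, LinearMap.coe_comp, hθ.of_comp_iff']
  exact Module.FaithfullyFlat.lTensor_bijective_iff_bijective O O' L

/-- The condition says that 1 lies in the range of the linear map (φⱼ) ↦ ∑ φⱼ(xⱼ). Since Hom_A(M, A)
extends to O', its solvability descends, and solutions over O extend. -/
theorem isGenerator_baseChange_iff [Module.FaithfullyFlat O O'] [Module.Finite O A]
    {M : BimodCat O A B} [Module.Finite O M] [Module.Free O M] :
    IsGenerator (baseChange O' M) ↔ IsGenerator M := by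
  obtain ⟨n, x, hx⟩ := Module.Finite.exists_fin (R := O) (M := M)
  have hx' : Submodule.span O' (Set.range fun i => (1 : O') ⊗ₜ[O] x i) = ⊤ := by
    rw [← span_one_tmul O' hx, ← Set.range_comp]
    rfl
  rw [isGenerator_iff (LinearEquiv.refl O M) (ρ := leftAct M) (fun _ _ => rfl) x hx,
    isGenerator_iff (baseChangeEquiv M) (leftAct_baseChange M) _ hx']
  obtain ⟨φ, hφ, hext⟩ := isExtension_lhom O' (ρ := leftAct M) (σ := Algebra.lmul O A)
    (ρ' := baseChangeLeftAct O' M) (σ' := Algebra.lmul O' (O' ⊗[O] A))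
    (baseChangeLeftAct_one_tmul O' M) fun a => by
      refine TensorProduct.AlgebraTensorModule.ext fun c a' => ?_
      rw [LinearMap.baseChange_tmul]
      exact (Algebra.TensorProduct.tmul_mul_tmul (1 : O') c a a').trans (by rw [one_mul]; rfl)
  let L : (Fin n → LHom (leftAct M) (Algebra.lmul O A)) →ₗ[O] A :=
    ∑ i, LinearMap.applyₗ (x i) ∘ₗ (LHom (leftAct M) (Algebra.lmul O A)).subtype ∘ₗ
      LinearMap.proj i
  have hL (f) : L f = ∑ i, (f i).1 (x i) := LinearMap.sum_apply _ _ _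
  let L' : (Fin n → LHom (baseChangeLeftAct O' M) (Algebra.lmul O' (O' ⊗[O] A))) →ₗ[O'] O' ⊗[O] A :=
    ∑ i, LinearMap.applyₗ ((1 : O') ⊗ₜ[O] x i) ∘ₗ
      (LHom (baseChangeLeftAct O' M) (Algebra.lmul O' (O' ⊗[O] A))).subtype ∘ₗ LinearMap.proj i
  have hL' (f) : L' f = ∑ i, (f i).1 ((1 : O') ⊗ₜ[O] x i) := LinearMap.sum_apply _ _ _
  have key (f) : L' (fun i => φ (f i)) = (1 : O') ⊗ₜ[O] L f := by
    rw [hL, hL', TensorProduct.tmul_sum]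
    refine Finset.sum_congr rfl fun i _ => ?_
    rw [hφ, LinearMap.baseChange_tmul]
  simp only [← hL, ← hL']
  constructor
  · intro h
    exact IsExtension.mem_range (IsExtension.pi fun _ : Fin n => hext)
      (ψ := fun a : A => (1 : O') ⊗ₜ[O] a) ⟨LinearMap.id, Function.bijective_id, fun _ => rfl⟩
      L L' key 1 h
  · rintro ⟨f, hf⟩
    exact ⟨fun i => φ (f i), (key f).trans (by rw [hf]; rfl)⟩

theorem hasDoubleCentralizer_baseChange_iff [Module.FaithfullyFlat O O'] [Module.Finite O A]
    {M : BimodCat O A B} [Module.Finite O M] [Module.Free O M] :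
    HasDoubleCentralizer (baseChange O' M) ↔ HasDoubleCentralizer M := by
  obtain ⟨φ, hφ, hext⟩ := isExtension_lhom O' (ρ := leftAct M) (σ := leftAct M)
    (ρ' := baseChangeLeftAct O' M) (σ' := baseChangeLeftAct O' M)
    (baseChangeLeftAct_one_tmul O' M) (baseChangeLeftAct_one_tmul O' M)
  let r' : O' ⊗[O] B →ₗ[O'] LHom (baseChangeLeftAct O' M) (baseChangeLeftAct O' M) :=
    LinearMap.codRestrict _ ((baseChangeRightAct O' M).toLinearMap ∘ₗ
      (opLinearEquiv O').toLinearMap) fun b => mem_LHom.2 fun a z => by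
        have := LinearMap.congr_fun (commute_act (baseChange O' M) a (op b)).eq
          ((baseChangeEquiv M).symm z)
        rw [Module.End.mul_apply, Module.End.mul_apply] at this
        refine Eq.trans ?_ (this.symm.trans ?_)
        · exact (rightAct_baseChange M (op b) _).symm.trans
            (congrArg _ (leftAct_baseChange M a z).symm)
        · exact (leftAct_baseChange M a _).trans
            (congrArg (baseChangeLeftAct O' M a) (rightAct_baseChange M (op b) z))
  rw [hasDoubleCentralizer_iff (LinearEquiv.refl O M) (ρ := leftAct M) (fun _ _ => rfl)
      (rightActLHom M) (fun _ _ => rfl),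
    hasDoubleCentralizer_iff (baseChangeEquiv M) (leftAct_baseChange M) r'
      fun b => rightAct_baseChange M (op b)]
  refine hext.bijective_iff O' (rightActLHom M) r' fun b => Subtype.ext ?_
  rw [hφ]
  exact baseChangeRightAct_one_tmul O' M b

theorem inducesMoritaEquivalence_iff [IsNoetherianRing O] [Module.Finite O A] [Module.Finite O B]
    {M : BimodCat O A B} [Module.Finite (A ⊗[O] Bᵐᵒᵖ) M] (hM : IsBiprojective M) :
    InducesMoritaEquivalence M ↔ IsGenerator M ∧ HasDoubleCentralizer M := by
  obtain ⟨n, ⟨b⟩⟩ := hM.exists_leftBasis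
  exact ⟨fun h => ⟨h.isGenerator, h.hasDoubleCentralizer⟩,
    fun h => h.1.inducesMoritaEquivalence h.2 b⟩

theorem inducesMoritaEquivalence_baseChange_iff [IsLocalRing O] [IsNoetherianRing O]
    [IsNoetherianRing O'] [Module.FaithfullyFlat O O'] [Module.Finite O A] [Module.Free O A]
    [Module.Finite O B] {M : BimodCat O A B} [Module.Finite (A ⊗[O] Bᵐᵒᵖ) M]
    (hM : IsBiprojective M) :
    InducesMoritaEquivalence (baseChange O' M) ↔ InducesMoritaEquivalence M := by
  have := hM.finiteO
  have := hM.freeO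
  rw [inducesMoritaEquivalence_iff hM, inducesMoritaEquivalence_iff (hM.baseChange O'),
    isGenerator_baseChange_iff, hasDoubleCentralizer_baseChange_iff]

end MoritaDescent

end SymAlg

end

theorem proposition4p5
    (O O' : Type u)
    [CommRing O] [IsDomain O] [IsPrincipalIdealRing O] [IsLocalRing O]
    [IsAdicComplete (IsLocalRing.maximalIdeal O) O]
    [CommRing O'] [IsDomain O'] [IsPrincipalIdealRing O'] [IsLocalRing O']
    [IsAdicComplete (IsLocalRing.maximalIdeal O') O']
    [Algebra O O'] (hO : Function.Injective (algebraMap O O'))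
    (hJ : ∀ x ∈ IsLocalRing.maximalIdeal O, algebraMap O O' x ∈ IsLocalRing.maximalIdeal O')
    (A B : Type u)
    [Ring A] [Algebra O A] [Module.Finite O A] [Module.Free O A] (hA : IsSymmetric O A)
    [Ring B] [Algebra O B] [Module.Finite O B] [Module.Free O B] (hB : IsSymmetric O B)
    (M N : BimodCat O A B) [Module.Finite (A ⊗[O] Bᵐᵒᵖ) M] [Module.Finite (A ⊗[O] Bᵐᵒᵖ) N]
    (hM : IsBiprojective M) (hN : IsBiprojective N)
    (X : CochainComplex (BimodCat O A B) ℤ) (hXb : IsBounded X)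
    (hX : ∀ n, IsBiprojective (X.X n)) :
    (InducesRickardEquivalence (baseChangeComplex O' X) ↔ InducesRickardEquivalence X) ∧
    (InducesStableEquivalence (baseChange O' M) ↔ InducesStableEquivalence M) ∧
    (InducesMoritaEquivalence (baseChange O' M) ↔ InducesMoritaEquivalence M) ∧
    (InduceVirtualMoritaEquivalence
        (cls (baseChange O' M) - cls (baseChange O' N))
        (cls (dual (baseChange O' M)) - cls (dual (baseChange O' N))) ↔
      InduceVirtualMoritaEquivalence (cls M - cls N) (cls (dual M) - cls (dual N))) := by
  -- An x that becomes a unit in O' cannot lie in the maximal ideal of O, since that would map it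
  -- into the maximal ideal of O'.
  have : IsLocalHom (algebraMap O O') := ⟨fun x hx => by
    by_contra h
    exact (IsLocalRing.mem_maximalIdeal _).1 (hJ x ((IsLocalRing.mem_maximalIdeal x).2 h)) hx⟩
  -- Injectivity into a domain gives torsion-freeness, hence flatness over the principal ideal
  -- domain O; together with locality this gives faithful flatness.
  have : Module.IsTorsionFree O O' := Module.isTorsionFree_iff_algebraMap_injective.2 hO
  have : Module.Flat O O' := inferInstance
  have : Module.FaithfullyFlat O O' := Module.FaithfullyFlat.of_flat_of_isLocalHom
  exact ⟨inducesRickardEquivalence_baseChange_iff O' hA hB hXb hX,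
    inducesStableEquivalence_baseChange_iff O' hA hB hM,
    inducesMoritaEquivalence_baseChange_iff O' hM,
    induceVirtualMoritaEquivalence_baseChange_iff O' hA hB hM hN⟩
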